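/- Let $0<L\le\infty$ and let $F:(-L,L)\to\mathbb R$ be an odd $C^2$ function with $F'>0$ and $\lim_{x\to\pm L}F(x)=\pm\infty$; put $G=F^{-1}:\mathbb R\to(-L,L)$, and $\mathcal Q^{-1}[F](x,y)=\frac{x-y}{F(x)-F(y)}$ for $x\ne y$, $\mathcal Q^{-1}[F](x,x)=\frac1{F'(x)}$. Let $\mathbb T=\mathbb R/2\pi\mathbb Z$ with its arc-length distance, and for $q\in[1,\infty)$ let $W_q$ be the $q$-Wasserstein distance between probability measures on $\mathbb T\times\mathbb R$ for the metric $d_q\big((\theta,\nu),(\tilde\theta,\tilde\nu)\big)=(|\theta-\tilde\theta|^q+|\nu-\tilde\nu|^q)^{1/q}$. A (global) measure-valued solution of the kinetic generalized Kuramoto (GK) equation $$\partial_t\rho+\partial_\theta(\mathfrak L[\rho]\rho)=0,\qquad \mathfrak L[\rho](\theta,\nu)=G\Big(\nu+\kappa\int_{\mathbb T\times\mathbb R}\sin(\theta'-\theta)\,d\rho(\theta',\nu')\Big),$$ with initial datum $\rho_0$ is a family $(\rho_t)_{t\ge0}$ of Borel probability measures on $\mathbb T\times\mathbb R$ such that $t\mapsto\int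 g\,d\rho_t$ is continuous on $[0,\infty)$ for every continuous $g$ vanishing at infinity, and such that for all $t\ge0$ and all $C^1$ functions $\varphi$ on $[0,\infty)\times\mathbb T\times\mathbb R$ that vanish at infinity together with their first derivatives, $$\int\varphi(t,\cdot)\,d\rho_t-\int\varphi(0,\cdot)\,d\rho_0=\int_0^t\int\big(\partial_s\varphi+\mathfrak L[\rho_s]\,\partial_\theta\varphi\big)\,d\rho_s\,ds,$$ all these integrals being well defined. The GK particle system is $F(\dot\theta_\alpha)=\nu_\alpha+\frac\kappa N\sum_{\beta=1}^N\sin(\theta_\beta-\theta_\alpha)$, $1\le\alpha\le N$, and a solution of it has the empirical measures $\rho^N_t=\frac1N\sum_{\alpha=1}^N\delta_{\theta_\alpha(t)}\otimes\delta_{\nu_\alpha}$. **Theorem 5.1.** Let $\theta_*\in(0,\pi/2)$, $\nu_l<\nu_r$, $\kappa\in\mathbb R$, $a_G=G(\nu_l-\kappa)$, $b_G=G(\nu_r+\kappa)$, $S=(0,\theta_*)\times(\nu_l,\nu_r)$, and suppose that $$\kappa\cos\theta_*\Big(\min_{F(a_G)\le y\le F(b_G)}G'(y)\Big)^2\ge2\max_{[a_G,b_G]^2}\mathcal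 Q^{-1}[F],\qquad \kappa\sin\theta_*>\nu_r-\nu_l .$$ Let $q\in[1,\infty)$. (1) Let $\rho_0$ be a probability measure on $\mathbb T\times\mathbb R$ with $\operatorname{supp}\rho_0\subset S$. Then there is a unique measure-valued solution $(\rho_t)_{t\ge0}$ with initial datum $\rho_0$. For every $t\ge0$, $\operatorname{supp}\rho_t$ is contained in $I_t\times[\nu_l,\nu_r]$ for some closed arc $I_t\subset\mathbb T$ of length $\theta_*$. Moreover, for each $N\ge1$ there is a global solution of the $N$-particle GK system with all $(\theta_\alpha(0),\nu_\alpha)$ in $S$, whose empirical measures $\rho^N_t$ form a measure-valued solution, such that $$\lim_{N\to\infty}\ \sup_{t\ge0}W_q(\rho_t,\rho_t^N)=0 .$$ (2) There is a constant $\Lambda_4>0$, depending only on $L,F,\kappa,\theta_*,\nu_l,\nu_r,q$, such that any two measure-valued solutions $\rho_t,\tilde\rho_t$ whose initial data have supports contained in $S$ and have the same mean natural frequency, $\int\nu\,d\rho_0=\int\nu\,d\tilde\rho_0$, satisfy $$W_q(\rho_t,\tilde\rho_t)\le\Lambda_4\,W_q(\rho_0,\tilde\rho_0)\qquad\text{for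 all }t\ge0 .$$ -/

import Mathlib

open MeasureTheory Filter Topology Set
open scoped ENNReal ZeroAtInfty

noncomputable section

namespace GKuramoto

/-- The circle `𝕋 = ℝ / 2πℤ`. Its norm is the arc-length distance to `0`. -/
abbrev Torus : Type := AddCircle (2 * Real.pi)

/-- The phase space `𝕋 × ℝ` of pairs (phase, natural frequency). -/
abbrev Phase : Type := Torus × ℝ

/-- The sine function on the circle. -/
def torusSin : Torus → ℝ := Real.sin_periodic.lift

/-- The interval `(-L, L)`, where `0 < L ≤ ∞`. -/
def freqDomain (L : EReal) : Set ℝ := {x | ((|x| : ℝ) : EReal) < L}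

/-- The structural conditions on `F : (-L, L) → ℝ`: it is of class `C²`, odd, has a positive
derivative, and tends to `±∞` at `±L`. Only the values of `F` on `(-L, L)` matter. -/
structure IsResponse (L : EReal) (F : ℝ → ℝ) : Prop where
  pos : 0 < L
  contDiffOn : ContDiffOn ℝ 2 F (freqDomain L)
  odd : ∀ x ∈ freqDomain L, F (-x) = -F x
  deriv_pos : ∀ x ∈ freqDomain L, 0 < deriv F x
  tendsto_right : Tendsto F (comap Real.toEReal (𝓝[<] L)) atTop
  tendsto_left : Tendsto F (comap Real.toEReal (𝓝[>] (-L))) atBot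

/-- The inverse function `G : ℝ → (-L, L)` of `F : (-L, L) → ℝ`. -/
def inverse (L : EReal) (F : ℝ → ℝ) : ℝ → ℝ := Function.invFunOn F (freqDomain L)

/-- The inverse difference quotient `(x - y) / (F x - F y)`, extended by `1 / F' x` to the
diagonal. -/
def invQuotient (F : ℝ → ℝ) (x y : ℝ) : ℝ :=
  open Classical in if x = y then 1 / deriv F x else (x - y) / (F x - F y)

/-- The set `(0, θ) × (νl, νr)`, seen in `𝕋 × ℝ`. -/
def initialStrip (θ νl νr : ℝ) : Set Phase :=
  ((fun x : ℝ => (x : Torus)) '' Ioo 0 θ) ×ˢ Ioo νl νr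

/-- The set `[c, c + θ] × [νl, νr]`: a closed arc of the circle with left endpoint `c` and
length `θ`, times a compact interval of natural frequencies. -/
def closedStrip (c : Torus) (θ νl νr : ℝ) : Set Phase :=
  ((fun x : ℝ => c + (x : Torus)) '' Icc 0 θ) ×ˢ Icc νl νr

/-- The conditions on the parameters:
`κ cos θ (min_{F a ≤ y ≤ F b} G' y)² ≥ 2 max_{[a, b]²} (inverse difference quotient of F)` with
`a = G (νl - κ)` and `b = G (νr + κ)`, and `κ sin θ > νr - νl`. -/
structure IsLargeCoupling (L : EReal) (F : ℝ → ℝ) (κ θ νl νr : ℝ) : Prop where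
  theta_mem : θ ∈ Ioo 0 (Real.pi / 2)
  freq_lt : νl < νr
  coupling :
    2 * sSup ((fun p : ℝ × ℝ => invQuotient F p.1 p.2) ''
        (Icc (inverse L F (νl - κ)) (inverse L F (νr + κ)) ×ˢ
          Icc (inverse L F (νl - κ)) (inverse L F (νr + κ)))) ≤
      κ * Real.cos θ *
        (sInf (deriv (inverse L F) ''
          Icc (F (inverse L F (νl - κ))) (F (inverse L F (νr + κ))))) ^ 2
  sin_gt : νr - νl < κ * Real.sin θ

/-- The velocity field
`𝔏[ρ](θ, ν) = G (ν + κ ∫ sin (θ' - θ) dρ(θ', ν'))` of the kinetic equation. -/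
def velocity (L : EReal) (F : ℝ → ℝ) (κ : ℝ) (ρ : Measure Phase) (z : Phase) : ℝ :=
  inverse L F (z.2 + κ * ∫ w, torusSin (w.1 - z.1) ∂ρ)

/-- The time derivative of a function on `ℝ × (𝕋 × ℝ)`. -/
def dTime (φ : ℝ × Phase → ℝ) (p : ℝ × Phase) : ℝ :=
  deriv (fun s : ℝ => φ (s, p.2)) p.1

/-- The phase derivative of a function on `ℝ × (𝕋 × ℝ)`. -/
def dPhase (φ : ℝ × Phase → ℝ) (p : ℝ × Phase) : ℝ :=
  deriv (fun h : ℝ => φ (p.1, p.2.1 + (h : Torus), p.2.2)) 0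

/-- The derivative of a function on `ℝ × (𝕋 × ℝ)` in the natural frequency. -/
def dFreq (φ : ℝ × Phase → ℝ) (p : ℝ × Phase) : ℝ :=
  deriv (fun v : ℝ => φ (p.1, p.2.1, v)) p.2.2

/-- A function on `[0, ∞) × (𝕋 × ℝ)` vanishes at infinity. -/
def VanishesAtInfinity (f : ℝ × Phase → ℝ) : Prop :=
  Tendsto f (cocompact (ℝ × Phase) ⊓ 𝓟 {p | 0 ≤ p.1}) (𝓝 0)

/-- Test functions of class `C¹₀([0, ∞) × (𝕋 × ℝ))`: continuously differentiable functions that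
vanish at infinity together with their first derivatives. Smoothness is tested on the lift
`(t, x, ν) ↦ φ (t, x mod 2π, ν)`. A `C¹` function on `[0, ∞) × 𝕋 × ℝ` is the restriction of
one on `ℝ × 𝕋 × ℝ`, so we let `φ` be defined for negative times too; its values there are
irrelevant. -/
structure IsTestFunction (φ : ℝ × Phase → ℝ) : Prop where
  contDiff : ContDiff ℝ 1 (fun p : ℝ × ℝ × ℝ => φ (p.1, ((p.2.1 : ℝ) : Torus), p.2.2))
  vanishes : VanishesAtInfinity φ
  vanishes_dTime : VanishesAtInfinity (dTime φ)
  vanishes_dPhase : VanishesAtInfinity (dPhase φ)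
  vanishes_dFreq : VanishesAtInfinity (dFreq φ)

/-- The function `∂ₛφ + 𝔏[ρ] ∂_θ φ` at time `s`, that is, the integrand of the weak form. -/
def weakIntegrand (L : EReal) (F : ℝ → ℝ) (κ : ℝ) (ρ : Measure Phase) (φ : ℝ × Phase → ℝ)
    (s : ℝ) (z : Phase) : ℝ :=
  dTime φ (s, z) + velocity L F κ ρ z * dPhase φ (s, z)

/-- Global measure-valued solutions `(ρ_t)_{t ≥ 0}` of the kinetic equation
`∂_t ρ + ∂_θ (𝔏[ρ] ρ) = 0`: weakly continuous curves of Borel probability measures on `𝕋 × ℝ`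
satisfying the equation in the weak sense, where all integrals in the weak form make sense.
The initial datum is `ρ 0`. Only the values `ρ t` with `0 ≤ t` matter. -/
structure IsMeasureSolution (L : EReal) (F : ℝ → ℝ) (κ : ℝ) (ρ : ℝ → Measure Phase) :
    Prop where
  prob : ∀ t, 0 ≤ t → IsProbabilityMeasure (ρ t)
  weak_continuous : ∀ g : C₀(Phase, ℝ), ContinuousOn (fun t => ∫ z, g z ∂ρ t) (Ici 0)
  integrable : ∀ φ : ℝ × Phase → ℝ, IsTestFunction φ → ∀ s, 0 ≤ s →
    Integrable (weakIntegrand L F κ (ρ s) φ s) (ρ s)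
  intervalIntegrable : ∀ φ : ℝ × Phase → ℝ, IsTestFunction φ → ∀ t, 0 ≤ t →
    IntervalIntegrable (fun s => ∫ z, weakIntegrand L F κ (ρ s) φ s z ∂ρ s) volume 0 t
  weak_eq : ∀ φ : ℝ × Phase → ℝ, IsTestFunction φ → ∀ t, 0 ≤ t →
    (∫ z, φ (t, z) ∂ρ t) - ∫ z, φ (0, z) ∂ρ 0 =
      ∫ s in (0 : ℝ)..t, ∫ z, weakIntegrand L F κ (ρ s) φ s z ∂ρ s

/-- Global solutions of the particle system
`F (θ̇_α) = ν_α + (κ / N) ∑_β sin (θ_β - θ_α)`, in terms of lifted phases `θ_α(t) ∈ ℝ`. -/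
def IsParticleSolution (L : EReal) (F : ℝ → ℝ) (κ : ℝ) {N : ℕ} (ν : Fin N → ℝ)
    (θ : ℝ → Fin N → ℝ) : Prop :=
  ∀ t, 0 ≤ t → ∀ α, ∃ ω ∈ freqDomain L,
    HasDerivWithinAt (fun s => θ s α) ω (Ici 0) t ∧
      F ω = ν α + κ / N * ∑ β, Real.sin (θ t β - θ t α)

/-- The empirical measure `(1 / N) ∑_α δ_{θ_α} ⊗ δ_{ν_α}` on `𝕋 × ℝ`. -/
def empirical {N : ℕ} (θ ν : Fin N → ℝ) : Measure Phase :=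
  (N : ℝ≥0∞)⁻¹ • ∑ α, Measure.dirac (((θ α : ℝ) : Torus), ν α)

/-- The distance `d_q` on `𝕋 × ℝ`, for `1 ≤ q < ∞`. -/
def phaseDist (q : ℝ) (z w : Phase) : ℝ :=
  (‖z.1 - w.1‖ ^ q + |z.2 - w.2| ^ q) ^ (1 / q)

/-- The set of couplings of two measures: the measures on the product with these marginals. -/
def couplings (μ ν : Measure Phase) : Set (Measure (Phase × Phase)) :=
  {γ | γ.map Prod.fst = μ ∧ γ.map Prod.snd = ν}

/-- The Wasserstein distance `W_q` for the metric `d_q`, with values in `[0, ∞]`. -/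
def wasserstein (q : ℝ) (μ ν : Measure Phase) : ℝ≥0∞ :=
  ⨅ γ ∈ couplings μ ν,
    (∫⁻ p, ENNReal.ofReal (phaseDist q p.1 p.2 ^ q) ∂γ) ^ (1 / q)

end GKuramoto

end

/-! The proof works in Lagrangian variables. A solution is written as the law of a mean-field system
θ̇_α = Γ(ω_α), ω_α = ν_α + κ ∫ sin(θ_β - θ_α) dP(β), with labels α in an arbitrary probability space
(`IsMeanField`). The drives ω_α never leave [νl - κ, νr + κ], so G may be replaced there by a
function Γ whose derivative is globally bounded, bounded away from 0 and Lipschitz. Particles are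
the case of N equally likely labels, and a coupling of two initial data is a label space that
carries both solutions.

The uniform-in-time stability `lpNorm_phase_sub_le` rests on three facts. First, phases that start
within ϑ of each other stay so, because at separation ϑ the pull κ sin ϑ beats the largest frequency
gap νr - νl (`phase_sub_le`). Second, all cosines of phase differences are then at least cos ϑ > 0,
so the drives approach each other exponentially (`abs_drive_sub_le`). The sine is odd, so the mean
drive stays equal to the mean frequency, which is therefore the common limit. Third, if two systems
have the same mean frequency, Γ can be linearised at this one point for both systems and all labels,
with slope γ. The linear part of the equation for the difference of the two systems is then an
interaction with a symmetric kernel of size at least γ κ cos ϑ. It preserves the mean and contracts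
the L^p distance to the mean (`lpNorm_add_interaction_le`). The linearisation error carries an
exponentially decaying, hence integrable, factor, and Grönwall's inequality gives a bound
independent of time.

Conversely, every measure-valued solution starting in the strip has this form
(`IsMeasureSolution.exists_isMeanField`). It enters its own velocity only through the two continuous
functions ∫ sin and ∫ cos of time. These define a C¹ flow, and testing with functions that are
constant along the flow shows that the solution is its transported initial datum.

The Wasserstein estimate follows by using each coupling of the initial data as label space, and
uniqueness by comparing two solutions over the same labels. For the mean-field limit the labels are
[0, 1), and initial phases and frequencies are replaced by averages over N equal cells. This keeps
the mean frequency exactly and converges in L^q. -/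

namespace GKuramoto

/-! ### The response function and its inverse -/

/-- A globally defined `C¹` function `Γ` with derivative `g`, bounded above and below by positive
constants and Lipschitz continuous. -/
structure IsRegularResponse (Γ g : ℝ → ℝ) (m M K : ℝ) : Prop where
  lower_pos : 0 < m
  hasDerivAt : ∀ y, HasDerivAt Γ (g y) y
  lower : ∀ y, m ≤ g y
  upper : ∀ y, g y ≤ M
  lipschitz : ∀ x y, |g x - g y| ≤ K * |x - y|

theorem isOpen_freqDomain (L : EReal) : IsOpen (freqDomain L) :=
  isOpen_lt (continuous_coe_real_ereal.comp continuous_abs) continuous_const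

theorem convex_freqDomain (L : EReal) : Convex ℝ (freqDomain L) := by
  apply OrdConnected.convex
  refine ⟨fun x hx y hy z hz => ?_⟩
  have h : |z| ≤ max |x| |y| := abs_le_max_abs_abs hz.1 hz.2
  rcases le_max_iff.1 h with h | h
  · exact lt_of_le_of_lt (EReal.coe_le_coe_iff.2 h) hx
  · exact lt_of_le_of_lt (EReal.coe_le_coe_iff.2 h) hy

namespace IsResponse

variable {L : EReal} {F : ℝ → ℝ}

theorem exists_ge (hF : IsResponse L F) (y : ℝ) : ∃ x ∈ freqDomain L, y ≤ F x := by
  have h := hF.tendsto_right.eventually_ge_atTop y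
  rw [eventually_comap] at h
  obtain ⟨a, ha, hsub⟩ := (mem_nhdsLT_iff_exists_Ioo_subset' hF.pos).1 h
  -- The maximum with 0 forces x > 0, so that |x| = x lies below L.
  obtain ⟨x, hx1, hx2⟩ := EReal.lt_iff_exists_real_btwn.1 (max_lt ha hF.pos)
  refine ⟨x, ?_, hsub ⟨(le_max_left _ _).trans_lt hx1, hx2⟩ x rfl⟩
  have hx0 : 0 < x := EReal.coe_lt_coe_iff.1 ((le_max_right a 0).trans_lt hx1)
  simpa [freqDomain, abs_of_pos hx0] using hx2

theorem neg_mem {x : ℝ} (hx : x ∈ freqDomain L) : -x ∈ freqDomain L := by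
  simpa [freqDomain] using hx

theorem strictMonoOn (hF : IsResponse L F) : StrictMonoOn F (freqDomain L) :=
  strictMonoOn_of_deriv_pos (convex_freqDomain L) hF.contDiffOn.continuousOn
    fun x hx => hF.deriv_pos x (interior_subset hx)

/-- Oddness turns a point where F is at least -y into one where F is at most y; the intermediate
value theorem does the rest. -/
theorem surjOn (hF : IsResponse L F) : SurjOn F (freqDomain L) univ := by
  intro y _
  obtain ⟨b, hb, hby⟩ := hF.exists_ge y
  obtain ⟨a, ha, hay⟩ := hF.exists_ge (-y)
  have := (convex_freqDomain L).isPreconnected.intermediate_value (neg_mem ha) hb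
    hF.contDiffOn.continuousOn
  exact this ⟨by rw [hF.odd a ha]; linarith, hby⟩

theorem inverse_mem (hF : IsResponse L F) (y : ℝ) : inverse L F y ∈ freqDomain L :=
  Function.invFunOn_mem (hF.surjOn (mem_univ y))

theorem apply_inverse (hF : IsResponse L F) (y : ℝ) : F (inverse L F y) = y :=
  Function.invFunOn_eq (hF.surjOn (mem_univ y))

theorem inverse_apply (hF : IsResponse L F) {x : ℝ} (hx : x ∈ freqDomain L) :
    inverse L F (F x) = x :=
  hF.strictMonoOn.injOn (hF.inverse_mem _) hx (hF.apply_inverse _)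

theorem inverse_strictMono (hF : IsResponse L F) : StrictMono (inverse L F) := by
  intro x y hxy
  by_contra! h
  have := hF.strictMonoOn.monotoneOn (hF.inverse_mem y) (hF.inverse_mem x) h
  rw [hF.apply_inverse, hF.apply_inverse] at this
  exact absurd hxy (not_lt.2 this)

theorem range_inverse (hF : IsResponse L F) : range (inverse L F) = freqDomain L := by
  refine subset_antisymm (range_subset_iff.2 hF.inverse_mem) fun x hx => ⟨F x, hF.inverse_apply hx⟩

/-- A monotone function whose range is open cannot jump. -/
theorem inverse_continuous (hF : IsResponse L F) : Continuous (inverse L F) := by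
  refine continuous_iff_continuousAt.2 fun y => ?_
  refine continuousAt_of_monotoneOn_of_image_mem_nhds (s := univ)
    (hF.inverse_strictMono.monotone.monotoneOn _) univ_mem ?_
  rw [image_univ, hF.range_inverse]
  exact (isOpen_freqDomain L).mem_nhds (hF.inverse_mem y)

theorem hasDerivAt_inverse (hF : IsResponse L F) (y : ℝ) :
    HasDerivAt (inverse L F) (deriv F (inverse L F y))⁻¹ y := by
  refine HasDerivAt.of_local_left_inverse hF.inverse_continuous.continuousAt ?_
    (hF.deriv_pos _ (hF.inverse_mem y)).ne' (Eventually.of_forall hF.apply_inverse)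
  exact (differentiableAt_of_deriv_ne_zero (hF.deriv_pos _ (hF.inverse_mem y)).ne').hasDerivAt

/-- Bootstrapping: G' = 1 / (F' ∘ G) is continuous, so G is C¹; since F' is C¹ too, so is 1 / (F' ∘
G). This is where two derivatives of F are needed: the Lipschitz bound on G' controls the
linearisation error in the stability estimate. -/
theorem contDiff_deriv_inverse (hF : IsResponse L F) :
    ContDiff ℝ 1 fun y => (deriv F (inverse L F y))⁻¹ := by
  have h1 : ContDiffOn ℝ 1 (deriv F) (freqDomain L) :=
    hF.contDiffOn.deriv_of_isOpen (isOpen_freqDomain L) (by norm_num)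
  have hG : ContDiff ℝ 1 (inverse L F) := by
    rw [contDiff_one_iff_deriv]
    refine ⟨fun y => (hF.hasDerivAt_inverse y).differentiableAt, ?_⟩
    rw [funext fun y => (hF.hasDerivAt_inverse y).deriv]
    refine Continuous.inv₀ ?_ fun y => (hF.deriv_pos _ (hF.inverse_mem y)).ne'
    exact h1.continuousOn.comp_continuous hF.inverse_continuous hF.inverse_mem
  refine ContDiff.inv ?_ fun y => (hF.deriv_pos _ (hF.inverse_mem y)).ne'
  exact h1.comp_contDiff hG hF.inverse_mem

/-- On a compact interval, the inverse of a response function agrees with a regular response. -/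
theorem exists_isRegularResponse (hF : IsResponse L F) {y₀ y₁ : ℝ} (hy : y₀ ≤ y₁) :
    ∃ Γ g : ℝ → ℝ, ∃ m M K : ℝ, IsRegularResponse Γ g m M K ∧
      ∀ y ∈ Icc y₀ y₁, Γ y = inverse L F y := by
  set g₀ : ℝ → ℝ := fun y => (deriv F (inverse L F y))⁻¹ with hg₀
  have hc : Continuous g₀ := hF.contDiff_deriv_inverse.continuous
  have hpos : ∀ y, 0 < g₀ y := fun y => inv_pos.2 (hF.deriv_pos _ (hF.inverse_mem y))
  obtain ⟨a, ha, hamin⟩ := isCompact_Icc.exists_isMinOn (nonempty_Icc.2 hy) hc.continuousOn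
  obtain ⟨b, hb, hbmax⟩ := isCompact_Icc.exists_isMaxOn (nonempty_Icc.2 hy) hc.continuousOn
  obtain ⟨K, hK⟩ := LocallyLipschitzOn.exists_lipschitzOnWith_of_compact
    (isCompact_Icc (a := y₀) (b := y₁))
    (hF.contDiff_deriv_inverse.locallyLipschitz.locallyLipschitzOn)
  -- Clamping the argument freezes G' outside the interval. The bounds over the compact interval
  -- thereby become global, and Γ is recovered as the primitive that equals G at y₀.
  set p : ℝ → ℝ := fun y => projIcc y₀ y₁ hy y with hp
  have hpc : Continuous p := continuous_subtype_val.comp continuous_projIcc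
  have hpm : ∀ y, p y ∈ Icc y₀ y₁ := fun y => (projIcc y₀ y₁ hy y).2
  set g : ℝ → ℝ := g₀ ∘ p with hg
  have hgc : Continuous g := hc.comp hpc
  refine ⟨fun y => inverse L F y₀ + ∫ u in y₀..y, g u, g, g₀ a, g₀ b, K,
    ⟨hpos a, fun y => ?_, fun y => hamin (hpm y), fun y => hbmax (hpm y), fun x y => ?_⟩,
    fun y hyy => ?_⟩
  · exact (intervalIntegral.integral_hasDerivAt_right (hgc.intervalIntegrable _ _)
      (hgc.stronglyMeasurableAtFilter _ _) hgc.continuousAt).const_add _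
  · have h1 := hK.dist_le_mul (p x) (hpm x) (p y) (hpm y)
    have h2 : dist (p x) (p y) ≤ dist x y := by
      have : dist (projIcc y₀ y₁ hy x) (projIcc y₀ y₁ hy y) ≤ dist x y := by
        simpa using (LipschitzWith.projIcc hy).dist_le_mul x y
      exact this
    rw [Real.dist_eq] at h1
    exact h1.trans (mul_le_mul_of_nonneg_left h2 K.2)
  · have : ∫ u in y₀..y, g u = ∫ u in y₀..y, g₀ u := by
      refine intervalIntegral.integral_congr fun u hu => ?_
      rw [uIcc_of_le hyy.1] at hu
      simp only [hg, hp, Function.comp]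
      rw [projIcc_of_mem hy ⟨hu.1, hu.2.trans hyy.2⟩]
    simp only [this]
    rw [intervalIntegral.integral_eq_sub_of_hasDerivAt (fun u _ => hF.hasDerivAt_inverse u)
      (hc.intervalIntegrable _ _)]
    ring

end IsResponse

end GKuramoto

namespace GKuramoto

/-! ### Elementary estimates -/

/-- If `f'` stays within `C` of `c` between `x` and `y`, then `f` is affine with slope `c` up to an
error `C |y - x|`. -/
theorem abs_sub_sub_mul_le {f f' : ℝ → ℝ} {x y c C : ℝ}
    (hf : ∀ s ∈ uIcc x y, HasDerivAt f (f' s) s) (hC : ∀ s ∈ uIcc x y, |f' s - c| ≤ C) :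
    |f y - f x - c * (y - x)| ≤ C * |y - x| := by
  have h := Convex.norm_image_sub_le_of_norm_hasDerivWithin_le (f := fun s => f s - c * s)
    (f' := fun s => f' s - c) (s := uIcc x y) (C := C)
    (fun s hs => by
      have := ((hf s hs).sub ((hasDerivAt_id s).const_mul c)).hasDerivWithinAt (s := uIcc x y)
      rw [mul_one] at this
      exact this)
    hC (convex_uIcc x y) left_mem_uIcc right_mem_uIcc
  simp only [Real.norm_eq_abs] at h
  calc _ = |f y - c * y - (f x - c * x)| := by congr 1; ring
    _ ≤ _ := h

theorem abs_sin_sub_sub_le (x y : ℝ) :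
    |Real.sin y - Real.sin x - Real.cos x * (y - x)| ≤ (y - x) ^ 2 := by
  have h := abs_sub_sub_mul_le (f := Real.sin) (f' := Real.cos) (x := x) (y := y)
    (c := Real.cos x) (C := |y - x|) (fun s _ => Real.hasDerivAt_sin s)
    (fun s hs => (Real.abs_cos_sub_cos_le s x).trans (abs_sub_left_of_mem_uIcc hs))
  rwa [← sq, sq_abs] at h

/-- The sum equals 2 sin(d/2) cos(x - d/2), and |x - d/2| ≤ θ - d/2, so it is smallest at x = θ,
with value sin θ - sin(θ - d). In the trapping argument d is the separation of two oscillators and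
x, d - x are their separations from a third one. The bound says that every third oscillator pulls
the two together with nearly full strength sin θ when d is near θ. -/
theorem sin_add_sin_sub_ge {θ d x : ℝ} (hθ : θ < Real.pi / 2) (hd0 : 0 ≤ d) (hd : d ≤ θ)
    (hx : x ≤ θ) (hx' : d - x ≤ θ) :
    Real.sin θ - (θ - d) ≤ Real.sin x + Real.sin (d - x) := by
  have hpi := Real.pi_pos
  have e1 : Real.sin x + Real.sin (d - x) = 2 * Real.sin (d / 2) * Real.cos (x - d / 2) := by
    have h1 := Real.sin_add (d / 2) (x - d / 2)
    have h2 := Real.sin_sub (d / 2) (x - d / 2)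
    rw [show d / 2 + (x - d / 2) = x by ring] at h1
    rw [show d / 2 - (x - d / 2) = d - x by ring] at h2
    linarith
  have e2 : Real.sin θ - Real.sin (θ - d) = 2 * Real.sin (d / 2) * Real.cos (θ - d / 2) := by
    have h1 := Real.sin_add (d / 2) (θ - d / 2)
    have h2 := Real.sin_sub (d / 2) (θ - d / 2)
    rw [show d / 2 + (θ - d / 2) = θ by ring] at h1
    rw [show d / 2 - (θ - d / 2) = -(θ - d) by ring, Real.sin_neg] at h2
    linarith
  have h3 : Real.cos (θ - d / 2) ≤ Real.cos (x - d / 2) := by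
    rw [← Real.cos_abs (x - d / 2)]
    apply Real.cos_le_cos_of_nonneg_of_le_pi (abs_nonneg _) (by linarith)
    rw [abs_le]; constructor <;> linarith
  have h4 : 0 ≤ Real.sin (d / 2) := Real.sin_nonneg_of_nonneg_of_le_pi (by linarith) (by linarith)
  have h5 : Real.sin (θ - d) ≤ θ - d := Real.sin_le (by linarith)
  nlinarith [mul_le_mul_of_nonneg_left h3 h4]

theorem cos_le_cos_of_abs_le {θ x : ℝ} (hθ : θ < Real.pi / 2) (hx : |x| ≤ θ) :
    Real.cos θ ≤ Real.cos x := by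
  rw [← Real.cos_abs x]
  exact Real.cos_le_cos_of_nonneg_of_le_pi (abs_nonneg _) (by linarith [Real.pi_pos]) hx

/-- Grönwall's inequality in the form of a one-step estimate. -/
theorem le_mul_exp_of_step {f b β : ℝ → ℝ} {C C' h₀ : ℝ} (hh₀ : 0 < h₀)
    (hlip : ∀ t, 0 ≤ t → ∀ h, 0 ≤ h → |f (t + h) - f t| ≤ C' * h)
    (hstep : ∀ t, 0 ≤ t → ∀ h, 0 ≤ h → h ≤ h₀ → f (t + h) ≤ f t + h * (b t * f t) + C * h ^ 2)
    (hβ : ∀ t, HasDerivAt β (b t) t) {t : ℝ} (ht : 0 ≤ t) :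
    f t ≤ f 0 * Real.exp (β t - β 0) := by
  have hcont : ContinuousOn f (Ici 0) := by
    have : LipschitzOnWith (Real.toNNReal C') f (Ici 0) := by
      refine LipschitzOnWith.of_dist_le_mul ?_
      have key : ∀ x ∈ Ici (0 : ℝ), ∀ y, x ≤ y → dist (f x) (f y) ≤ Real.toNNReal C' * dist x y := by
        intro x hx y hxy
        have := hlip x hx (y - x) (by linarith)
        rw [add_sub_cancel] at this
        rw [dist_comm, Real.dist_eq, dist_comm, Real.dist_eq, abs_of_nonneg (sub_nonneg.2 hxy)]
        exact this.trans (mul_le_mul_of_nonneg_right (Real.le_coe_toNNReal _) (by linarith))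
      intro x hx y hy
      rcases le_total x y with h | h
      · exact key x hx y h
      · rw [dist_comm, dist_comm x]; exact key y hy x h
    exact this.continuousOn
  -- The term ε t makes the comparison function grow strictly faster wherever f touches it. Only
  -- right difference quotients of f are examined, so f may be a supremum or a norm.
  have hlim : ∀ ε > 0, f t ≤ (f 0 + ε * t) * Real.exp (β t - β 0) := by
    intro ε hε
    refine image_le_of_liminf_slope_right_lt_deriv_boundary (f := f) (f' := fun s => b s * f s)
      (a := 0) (b := t) (hcont.mono Icc_subset_Ici_self) ?_
      (B := fun s => (f 0 + ε * s) * Real.exp (β s - β 0))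
      (B' := fun s => ε * Real.exp (β s - β 0) +
        (f 0 + ε * s) * (Real.exp (β s - β 0) * b s)) (by simp) ?_ ?_ ⟨ht, le_rfl⟩
    · intro x hx r hr
      apply Eventually.frequently
      have : Tendsto (fun z => b x * f x + C * (z - x)) (𝓝[>] x) (𝓝 (b x * f x)) := by
        have : Tendsto (fun z => b x * f x + C * (z - x)) (𝓝 x) (𝓝 (b x * f x + C * (x - x))) :=
          Continuous.tendsto (by fun_prop) x
        simpa using this.mono_left nhdsWithin_le_nhds
      filter_upwards [this.eventually_lt_const hr, self_mem_nhdsWithin,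
        nhdsWithin_le_nhds (Iio_mem_nhds (show x < x + h₀ by linarith))] with z hz hxz hzh
      have hxz' : 0 < z - x := sub_pos.2 hxz
      have := hstep x hx.1 (z - x) hxz'.le (by linarith [show z < x + h₀ from hzh])
      rw [add_sub_cancel] at this
      refine lt_of_le_of_lt ?_ hz
      rw [slope_def_field, div_le_iff₀ hxz']
      nlinarith
    · intro s
      have h1 : HasDerivAt (fun s => f 0 + ε * s) ε s := by
        simpa using ((hasDerivAt_id s).const_mul ε).const_add (f 0)
      exact h1.mul ((hβ s).sub_const _).exp
    · intro s hs heq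
      have := mul_pos hε (Real.exp_pos (β s - β 0))
      simp only [heq]
      nlinarith
  have : Tendsto (fun ε : ℝ => (f 0 + ε * t) * Real.exp (β t - β 0)) (𝓝[>] 0)
      (𝓝 ((f 0 + 0 * t) * Real.exp (β t - β 0))) :=
    (Continuous.tendsto (by fun_prop) 0).mono_left nhdsWithin_le_nhds
  rw [zero_mul, add_zero] at this
  exact ge_of_tendsto this (eventually_nhdsWithin_of_forall hlim)

namespace IsRegularResponse

variable {Γ g : ℝ → ℝ} {m M K : ℝ}

theorem upper_pos (hΓ : IsRegularResponse Γ g m M K) : 0 < M :=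
  hΓ.lower_pos.trans_le ((hΓ.lower 0).trans (hΓ.upper 0))

theorem lipschitz_nonneg (hΓ : IsRegularResponse Γ g m M K) : 0 ≤ K := by
  simpa using (abs_nonneg _).trans (hΓ.lipschitz 1 0)

theorem continuous (hΓ : IsRegularResponse Γ g m M K) : Continuous Γ :=
  continuous_iff_continuousAt.2 fun y => (hΓ.hasDerivAt y).continuousAt

theorem continuous_deriv (hΓ : IsRegularResponse Γ g m M K) : Continuous g :=
  (LipschitzWith.of_dist_le_mul (K := ⟨K, hΓ.lipschitz_nonneg⟩) hΓ.lipschitz).continuous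

theorem exists_slope (hΓ : IsRegularResponse Γ g m M K) (x y : ℝ) :
    ∃ k, m ≤ k ∧ k ≤ M ∧ Γ x - Γ y = k * (x - y) := by
  have key : ∀ x y, x < y → ∃ k, m ≤ k ∧ k ≤ M ∧ Γ x - Γ y = k * (x - y) := by
    intro x y h
    obtain ⟨c, -, hc⟩ := exists_hasDerivAt_eq_slope Γ g h hΓ.continuous.continuousOn
      fun z _ => hΓ.hasDerivAt z
    refine ⟨g c, hΓ.lower c, hΓ.upper c, ?_⟩
    rw [hc]
    field_simp [sub_ne_zero.2 h.ne']
    ring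
  rcases lt_trichotomy x y with h | h | h
  · exact key x y h
  · exact ⟨m, le_rfl, (hΓ.lower 0).trans (hΓ.upper 0), by simp [h]⟩
  · obtain ⟨k, h1, h2, h3⟩ := key y x h
    exact ⟨k, h1, h2, by linarith⟩

theorem abs_sub_le (hΓ : IsRegularResponse Γ g m M K) (x y : ℝ) : |Γ x - Γ y| ≤ M * |x - y| := by
  obtain ⟨k, h1, h2, h3⟩ := hΓ.exists_slope x y
  rw [h3, abs_mul, abs_of_nonneg (hΓ.lower_pos.le.trans h1)]
  exact mul_le_mul_of_nonneg_right h2 (abs_nonneg _)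

/-- On the segment from x to y the derivative stays within K D of its value at z. In the application
x and y are drives of two systems, z is their common mean frequency, and D decays exponentially. -/
theorem abs_sub_sub_le (hΓ : IsRegularResponse Γ g m M K) {x y z D : ℝ} (hx : |x - z| ≤ D)
    (hy : |y - z| ≤ D) : |Γ x - Γ y - g z * (x - y)| ≤ K * D * |x - y| := by
  refine abs_sub_sub_mul_le (fun s _ => hΓ.hasDerivAt s) fun s hs => ?_
  refine (hΓ.lipschitz s z).trans (mul_le_mul_of_nonneg_left ?_ hΓ.lipschitz_nonneg)
  rw [abs_le] at *
  rw [mem_uIcc] at hs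
  constructor <;> rcases hs with hs | hs <;> linarith

end IsRegularResponse

/-- The parameters of the coupled dynamics: a regular response and a coupling strength for which
phase differences of size `θ` shrink. -/
structure IsTrapping (Γ g : ℝ → ℝ) (m M K κ θ νl νr : ℝ) : Prop
    extends IsRegularResponse Γ g m M K where
  theta_mem : θ ∈ Ioo 0 (Real.pi / 2)
  freq_lt : νl < νr
  sin_gt : νr - νl < κ * Real.sin θ

namespace IsTrapping

variable {Γ g : ℝ → ℝ} {m M K κ θ νl νr : ℝ}

theorem cos_pos (h : IsTrapping Γ g m M K κ θ νl νr) : 0 < Real.cos θ :=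
  Real.cos_pos_of_mem_Ioo ⟨by linarith [h.theta_mem.1, Real.pi_pos], h.theta_mem.2⟩

theorem coupling_pos (h : IsTrapping Γ g m M K κ θ νl νr) : 0 < κ := by
  have h1 := h.sin_gt
  have h2 := h.freq_lt
  have h3 : 0 < Real.sin θ := Real.sin_pos_of_pos_of_lt_pi h.theta_mem.1
    (by linarith [h.theta_mem.2, Real.pi_pos])
  by_contra! h4
  nlinarith

end IsTrapping

end GKuramoto

namespace GKuramoto

/-! ### Mean-field systems over a probability space of labels -/

variable {Ω : Type*} [MeasurableSpace Ω]

/-- The argument `ν_α + κ ∫ sin (θ_β - θ_α) dP(β)` of the response function. -/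
noncomputable def drive (κ : ℝ) (P : Measure Ω) (ν θ : Ω → ℝ) (α : Ω) : ℝ :=
  ν α + κ * ∫ β, Real.sin (θ β - θ α) ∂P

/-- A mean-field system `θ̇_α = Γ (ν_α + κ ∫ sin (θ_β - θ_α) dP(β))` with labels `α` in a
probability space, with initial phases in `[0, ϑ]` and natural frequencies in `[νl, νr]`. -/
structure IsMeanField (Γ : ℝ → ℝ) (κ ϑ νl νr : ℝ) (P : Measure Ω) (ν : Ω → ℝ) (θ : ℝ → Ω → ℝ) :
    Prop where
  measurable_freq : Measurable ν
  measurable_phase : ∀ t, 0 ≤ t → Measurable (θ t)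
  freq_mem : ∀ α, ν α ∈ Icc νl νr
  init_mem : ∀ α, θ 0 α ∈ Icc 0 ϑ
  hasDerivAt : ∀ t, 0 ≤ t → ∀ α, HasDerivAt (fun s => θ s α) (Γ (drive κ P ν (θ t) α)) t

theorem integrable_of_abs_le {P : Measure Ω} [IsFiniteMeasure P] {f : Ω → ℝ} (hf : Measurable f)
    {C : ℝ} (hC : ∀ α, |f α| ≤ C) : Integrable f P :=
  Integrable.of_bound hf.aestronglyMeasurable C (ae_of_all _ hC)

theorem abs_integral_le_of_abs_le {P : Measure Ω} [IsProbabilityMeasure P] {f : Ω → ℝ}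
    {C : ℝ} (hC : ∀ α, |f α| ≤ C) : |∫ α, f α ∂P| ≤ C := by
  simpa using norm_integral_le_of_norm_le_const (μ := P) (f := f) (ae_of_all _ hC)

theorem integral_le_of_le {P : Measure Ω} [IsProbabilityMeasure P] {f : Ω → ℝ} {C : ℝ}
    (hf : Integrable f P) (hC : ∀ α, f α ≤ C) : ∫ α, f α ∂P ≤ C := by
  simpa using integral_mono hf (integrable_const C) hC

theorem le_integral_of_le {P : Measure Ω} [IsProbabilityMeasure P] {f : Ω → ℝ} {C : ℝ}
    (hf : Integrable f P) (hC : ∀ α, C ≤ f α) : C ≤ ∫ α, f α ∂P := by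
  simpa using integral_mono (integrable_const C) hf hC

theorem integrable_sin {P : Measure Ω} [IsFiniteMeasure P] {θ : Ω → ℝ} (hθ : Measurable θ)
    (x : ℝ) : Integrable (fun β => Real.sin (θ β - x)) P :=
  integrable_of_abs_le (by fun_prop) fun _ => Real.abs_sin_le_one _

theorem measurable_drive {κ : ℝ} {P : Measure Ω} [IsProbabilityMeasure P] {ν θ : Ω → ℝ}
    (hν : Measurable ν) (hθ : Measurable θ) : Measurable (drive κ P ν θ) := by
  have h : Measurable (Function.uncurry fun α β => Real.sin (θ β - θ α)) := by
    unfold Function.uncurry; fun_prop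
  exact hν.add ((h.stronglyMeasurable.integral_prod_right (ν := P)).measurable.const_mul κ)

namespace IsMeanField

variable {Γ g : ℝ → ℝ} {m M K κ ϑ νl νr : ℝ} {P : Measure Ω} [IsProbabilityMeasure P]
  {ν : Ω → ℝ} {θ : ℝ → Ω → ℝ}

theorem measurable_drive (hs : IsMeanField Γ κ ϑ νl νr P ν θ) {t : ℝ} (ht : 0 ≤ t) :
    Measurable (drive κ P ν (θ t)) :=
  GKuramoto.measurable_drive hs.measurable_freq (hs.measurable_phase t ht)

theorem abs_drive_le (hp : IsTrapping Γ g m M K κ ϑ νl νr) (hs : IsMeanField Γ κ ϑ νl νr P ν θ)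
    (t : ℝ) (α : Ω) : |drive κ P ν (θ t) α| ≤ max |νl| |νr| + κ := by
  refine (abs_add_le _ _).trans (add_le_add ?_ ?_)
  · exact abs_le_max_abs_abs (hs.freq_mem α).1 (hs.freq_mem α).2
  · rw [abs_mul, abs_of_pos hp.coupling_pos]
    refine mul_le_of_le_one_right hp.coupling_pos.le ?_
    exact abs_integral_le_of_abs_le fun β => Real.abs_sin_le_one _

theorem abs_velocity_le (hp : IsTrapping Γ g m M K κ ϑ νl νr)
    (hs : IsMeanField Γ κ ϑ νl νr P ν θ) (t : ℝ) (α : Ω) :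
    |Γ (drive κ P ν (θ t) α)| ≤ |Γ 0| + M * (max |νl| |νr| + κ) := by
  have h1 := hp.abs_sub_le (drive κ P ν (θ t) α) 0
  have h2 := mul_le_mul_of_nonneg_left (hs.abs_drive_le hp t α) hp.upper_pos.le
  rw [sub_zero] at h1
  have h3 := abs_sub_abs_le_abs_sub (Γ (drive κ P ν (θ t) α)) (Γ 0)
  linarith

/-- Constants controlling the short-time behaviour, uniformly in time and labels. -/
structure HasRates (κ M : ℝ) (P : Measure Ω) (Γ : ℝ → ℝ) (ν : Ω → ℝ) (θ : ℝ → Ω → ℝ)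
    (B C : ℝ) : Prop where
  nonneg_B : 0 ≤ B
  nonneg_C : 0 ≤ C
  speed : ∀ t, 0 ≤ t → ∀ h, 0 ≤ h → ∀ α, |θ (t + h) α - θ t α| ≤ B * h
  taylor : ∀ t, 0 ≤ t → ∀ h, 0 ≤ h → ∀ α,
    |θ (t + h) α - θ t α - h * Γ (drive κ P ν (θ t) α)| ≤ C * h ^ 2
  drive : ∀ t, 0 ≤ t → ∀ h, 0 ≤ h → ∀ α,
    |drive κ P ν (θ (t + h)) α - drive κ P ν (θ t) α| ≤ 2 * κ * B * h
  abs_velocity_le : ∀ t, 0 ≤ t → ∀ α, |Γ (GKuramoto.drive κ P ν (θ t) α)| ≤ B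

theorem exists_hasRates (hp : IsTrapping Γ g m M K κ ϑ νl νr)
    (hs : IsMeanField Γ κ ϑ νl νr P ν θ) : ∃ B C, HasRates κ M P Γ ν θ B C := by
  have hκ := hp.coupling_pos
  have hM := hp.upper_pos
  set B := |Γ 0| + M * (max |νl| |νr| + κ) with hB
  have hB0 : 0 ≤ B := by positivity
  have speed : ∀ t, 0 ≤ t → ∀ h, 0 ≤ h → ∀ α, |θ (t + h) α - θ t α| ≤ B * h := by
    intro t ht h hh α
    have := abs_sub_sub_mul_le (f := fun s => θ s α) (x := t) (y := t + h) (c := 0) (C := B)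
      (f' := fun s => Γ (GKuramoto.drive κ P ν (θ s) α))
      (fun s hs' => hs.hasDerivAt s (ht.trans (by
        rw [uIcc_of_le (by linarith)] at hs'; exact hs'.1)) α)
      (fun s _ => by rw [sub_zero]; exact hs.abs_velocity_le hp s α)
    simpa [abs_of_nonneg hh] using this
  have drive_bd : ∀ t, 0 ≤ t → ∀ h, 0 ≤ h → ∀ α,
      |GKuramoto.drive κ P ν (θ (t + h)) α - GKuramoto.drive κ P ν (θ t) α| ≤ 2 * κ * B * h := by
    intro t ht h hh α
    have e : GKuramoto.drive κ P ν (θ (t + h)) α - GKuramoto.drive κ P ν (θ t) α =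
        κ * ∫ β, (Real.sin (θ (t + h) β - θ (t + h) α) - Real.sin (θ t β - θ t α)) ∂P := by
      rw [integral_sub (integrable_sin (hs.measurable_phase _ (by linarith)) _)
        (integrable_sin (hs.measurable_phase _ ht) _)]
      unfold GKuramoto.drive
      ring
    rw [e, abs_mul, abs_of_pos hκ]
    have : |∫ β, (Real.sin (θ (t + h) β - θ (t + h) α) - Real.sin (θ t β - θ t α)) ∂P| ≤
        2 * B * h := by
      refine abs_integral_le_of_abs_le fun β => (Real.abs_sin_sub_sin_le _ _).trans ?_
      have h1 := abs_le.1 (speed t ht h hh α)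
      have h2 := abs_le.1 (speed t ht h hh β)
      rw [abs_le]; constructor <;> linarith
    nlinarith
  -- Drives vary at rate at most 2 κ B and Γ is M-Lipschitz, so velocities vary at rate at most 2 M
  -- κ B. The mean value inequality turns this into a quadratic Taylor remainder.
  refine ⟨B, 2 * M * κ * B, hB0, by positivity, speed, ?_, drive_bd,
    fun t _ α => hs.abs_velocity_le hp t α⟩
  intro t ht h hh α
  have := abs_sub_sub_mul_le (f := fun s => θ s α) (x := t) (y := t + h)
    (c := Γ (GKuramoto.drive κ P ν (θ t) α)) (C := 2 * M * κ * B * h)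
    (f' := fun s => Γ (GKuramoto.drive κ P ν (θ s) α))
    (fun s hs' => hs.hasDerivAt s (ht.trans (by
      rw [uIcc_of_le (by linarith)] at hs'; exact hs'.1)) α)
    (fun s hs' => by
      rw [uIcc_of_le (by linarith)] at hs'
      refine (hp.abs_sub_le _ _).trans ?_
      have := drive_bd t ht (s - t) (by linarith [hs'.1]) α
      rw [add_sub_cancel] at this
      have h2 : 2 * κ * B * (s - t) ≤ 2 * κ * B * h :=
        mul_le_mul_of_nonneg_left (by linarith [hs'.2]) (by positivity)
      nlinarith [mul_le_mul_of_nonneg_left (this.trans h2) hM.le])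
  rw [add_sub_cancel_left, abs_of_nonneg hh] at this
  rw [mul_comm h]
  exact this.trans_eq (by ring)

/-! ### Trapping of the phases. -/

/-- One short time step does not increase the phase diameter beyond `ϑ`. -/
theorem phase_diam_step (hp : IsTrapping Γ g m M K κ ϑ νl νr)
    (hs : IsMeanField Γ κ ϑ νl νr P ν θ) {B C : ℝ} (hr : HasRates κ M P Γ ν θ B C) {t h : ℝ}
    (ht : 0 ≤ t) (hh : 0 ≤ h) (h1 : 2 * B * h ≤ ϑ) (h2 : M * κ * h ≤ 1)
    (h3 : 2 * C * h ≤ m * (κ * Real.sin ϑ - (νr - νl)))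
    (hd : ∀ α β, θ t α - θ t β ≤ ϑ) (α β : Ω) : θ (t + h) α - θ (t + h) β ≤ ϑ := by
  have hκ := hp.coupling_pos
  have hM := hp.upper_pos
  have hm := hp.lower_pos
  -- A negative difference can grow by at most 2 B h ≤ ϑ, so it cannot exceed ϑ after the step.
  rcases lt_or_ge (θ t α - θ t β) 0 with hneg | hpos
  · have ha := abs_le.1 (hr.speed t ht h hh α)
    have hb := abs_le.1 (hr.speed t ht h hh β)
    linarith
  set d := θ t α - θ t β with hd'
  have hω : drive κ P ν (θ t) α - drive κ P ν (θ t) β ≤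
      (νr - νl) - κ * (Real.sin ϑ - (ϑ - d)) := by
    have hint : Real.sin ϑ - (ϑ - d) ≤
        ∫ γ, (Real.sin (θ t γ - θ t β) - Real.sin (θ t γ - θ t α)) ∂P := by
      refine le_integral_of_le ((integrable_sin (hs.measurable_phase t ht) _).sub
        (integrable_sin (hs.measurable_phase t ht) _)) fun γ => ?_
      have := sin_add_sin_sub_ge (x := θ t α - θ t γ) (d := d) hp.theta_mem.2 hpos (hd α β)
        (hd α γ) (by rw [hd']; linarith [hd γ β])
      rw [← neg_sub (θ t α) (θ t γ), Real.sin_neg]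
      rw [hd', show θ t α - θ t β - (θ t α - θ t γ) = θ t γ - θ t β by ring] at this
      linarith
    rw [integral_sub (integrable_sin (hs.measurable_phase t ht) _)
      (integrable_sin (hs.measurable_phase t ht) _)] at hint
    have h4 := (hs.freq_mem α).2
    have h5 := (hs.freq_mem β).1
    unfold drive
    nlinarith
  obtain ⟨k, hk1, hk2, hk⟩ := hp.exists_slope (drive κ P ν (θ t) α) (drive κ P ν (θ t) β)
  have hgap : 0 < κ * Real.sin ϑ - (νr - νl) := by linarith [hp.sin_gt]
  have hed : 0 ≤ ϑ - d := by linarith [hd α β]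
  have hvel : Γ (drive κ P ν (θ t) α) - Γ (drive κ P ν (θ t) β) ≤
      -(m * (κ * Real.sin ϑ - (νr - νl))) + M * κ * (ϑ - d) := by
    rw [hk]
    have h6 : k * (drive κ P ν (θ t) α - drive κ P ν (θ t) β) ≤
        k * (-(κ * Real.sin ϑ - (νr - νl)) + κ * (ϑ - d)) :=
      mul_le_mul_of_nonneg_left (by linarith) (hm.le.trans hk1)
    have h7 : m * (κ * Real.sin ϑ - (νr - νl)) ≤ k * (κ * Real.sin ϑ - (νr - νl)) :=
      mul_le_mul_of_nonneg_right hk1 hgap.le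
    have h8 : k * (κ * (ϑ - d)) ≤ M * (κ * (ϑ - d)) :=
      mul_le_mul_of_nonneg_right hk2 (by positivity)
    linarith
  -- The new difference is at most d + h(-m(κ sin ϑ - (νr - νl)) + M κ (ϑ - d)) + 2 C h². The first
  -- smallness condition gives h M κ (ϑ - d) ≤ ϑ - d, and the other absorbs the Taylor error into
  -- the negative drift, leaving ϑ.
  have ha := abs_le.1 (hr.taylor t ht h hh α)
  have hb := abs_le.1 (hr.taylor t ht h hh β)
  have h9 : h * (Γ (drive κ P ν (θ t) α) - Γ (drive κ P ν (θ t) β)) ≤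
      h * (-(m * (κ * Real.sin ϑ - (νr - νl))) + M * κ * (ϑ - d)) :=
    mul_le_mul_of_nonneg_left hvel hh
  have h10 : M * κ * h * (ϑ - d) ≤ 1 * (ϑ - d) := mul_le_mul_of_nonneg_right h2 hed
  have h11 : h * (2 * C * h) ≤ h * (m * (κ * Real.sin ϑ - (νr - νl))) :=
    mul_le_mul_of_nonneg_left h3 hh
  linarith

/-- Phase differences stay below `ϑ`. -/
theorem phase_sub_le (hp : IsTrapping Γ g m M K κ ϑ νl νr)
    (hs : IsMeanField Γ κ ϑ νl νr P ν θ) {t : ℝ} (ht : 0 ≤ t) (α β : Ω) :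
    θ t α - θ t β ≤ ϑ := by
  obtain ⟨B, C, hr⟩ := hs.exists_hasRates hp
  have hκ := hp.coupling_pos
  have hM := hp.upper_pos
  have hgap : 0 < m * (κ * Real.sin ϑ - (νr - νl)) :=
    mul_pos hp.lower_pos (by linarith [hp.sin_gt])
  have hsmall : ∀ a b : ℝ, 0 < b → ∀ᶠ n : ℕ in atTop, a * (t / n) ≤ b := by
    intro a b hb
    have : Tendsto (fun n : ℕ => a * (t / n)) atTop (𝓝 (a * 0)) :=
      (tendsto_const_div_atTop_nhds_zero_nat t).const_mul a
    rw [mul_zero] at this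
    exact (this.eventually_lt_const hb).mono fun _ h => h.le
  -- The rates B and C hold for all times and labels, so a single step size t / n works throughout
  -- and the one-step estimate can be iterated for all pairs of labels at once.
  obtain ⟨n, h1, h2, h3, hn⟩ := ((hsmall (2 * B) ϑ hp.theta_mem.1).and
    ((hsmall (M * κ) 1 one_pos).and ((hsmall (2 * C) _ hgap).and (eventually_gt_atTop 0)))).exists
  have hn' : (0 : ℝ) < n := Nat.cast_pos.2 hn
  have key : ∀ j : ℕ, ∀ α β, θ (j * (t / n)) α - θ (j * (t / n)) β ≤ ϑ := by
    intro j
    induction j with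
    | zero =>
      intro α β
      have ha := hs.init_mem α
      have hb := hs.init_mem β
      simp only [CharP.cast_eq_zero, zero_mul]
      linarith [ha.2, hb.1]
    | succ j ih =>
      intro α β
      have := hs.phase_diam_step hp hr (t := j * (t / n)) (h := t / n) (by positivity)
        (by positivity) h1 h2 h3 ih α β
      rwa [show ((j + 1 : ℕ) : ℝ) * (t / n) = j * (t / n) + t / n by push_cast; ring]
  have := key n α β
  rwa [mul_div_cancel₀ _ hn'.ne'] at this

theorem abs_phase_sub_le (hp : IsTrapping Γ g m M K κ ϑ νl νr)
    (hs : IsMeanField Γ κ ϑ νl νr P ν θ) {t : ℝ} (ht : 0 ≤ t) (α β : Ω) :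
    |θ t α - θ t β| ≤ ϑ :=
  abs_le.2 ⟨by linarith [hs.phase_sub_le hp ht β α], hs.phase_sub_le hp ht α β⟩

end IsMeanField

end GKuramoto

/-! ### Exponential synchronization of the drives. -/

namespace GKuramoto

variable {Ω : Type*} [MeasurableSpace Ω]

/-- The contraction estimate for two consecutive frequency differences. -/
theorem contraction_of_abs_le {k₁ k₂ l u v D : ℝ} (h1 : l ≤ k₁) (h1' : k₁ ≤ 1) (h2 : l ≤ k₂)
    (h2' : k₂ ≤ 1) (hu : u ≤ D) (hv : v ≤ D) (huv : u + v ≤ D) (hD : 0 ≤ D) :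
    (1 - k₁) * u + (1 - k₂) * v ≤ (1 - l) * D := by
  -- A nonnegative term only grows when its coefficient is raised to 1 - l, and a nonpositive one
  -- may be dropped. What remains is bounded by D through u + v, u, v or 0.
  rcases le_total 0 u with hu0 | hu0 <;> rcases le_total 0 v with hv0 | hv0
  · nlinarith [mul_le_mul_of_nonneg_right h1 hu0, mul_le_mul_of_nonneg_right h2 hv0,
      mul_le_mul_of_nonneg_left huv (show 0 ≤ 1 - l by linarith)]
  · nlinarith [mul_le_mul_of_nonneg_right h1 hu0,
      mul_le_mul_of_nonneg_left hu (show 0 ≤ 1 - l by linarith),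
      mul_nonneg_of_nonpos_of_nonpos (show -(1 - k₂) ≤ 0 by linarith) hv0]
  · nlinarith [mul_le_mul_of_nonneg_right h2 hv0,
      mul_le_mul_of_nonneg_left hv (show 0 ≤ 1 - l by linarith),
      mul_nonneg_of_nonpos_of_nonpos (show -(1 - k₁) ≤ 0 by linarith) hu0]
  · nlinarith [mul_nonneg (show 0 ≤ 1 - l by linarith) hD,
      mul_nonneg_of_nonpos_of_nonpos (show -(1 - k₁) ≤ 0 by linarith) hu0,
      mul_nonneg_of_nonpos_of_nonpos (show -(1 - k₂) ≤ 0 by linarith) hv0]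

theorem abs_iSup_sub_iSup_le {ι : Type*} [Nonempty ι] {f f' : ι → ℝ} {C : ℝ}
    (hf : BddAbove (range f)) (hf' : BddAbove (range f')) (h : ∀ i, |f i - f' i| ≤ C) :
    |(⨆ i, f i) - ⨆ i, f' i| ≤ C := by
  rw [abs_le]
  constructor
  · have : (⨆ i, f' i) ≤ (⨆ i, f i) + C := ciSup_le fun i => by
      linarith [le_ciSup hf i, (abs_le.1 (h i)).1]
    linarith
  · have : (⨆ i, f i) ≤ (⨆ i, f' i) + C := ciSup_le fun i => by
      linarith [le_ciSup hf' i, (abs_le.1 (h i)).2]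
    linarith

namespace IsMeanField

variable {Γ g : ℝ → ℝ} {m M K κ ϑ νl νr : ℝ} {P : Measure Ω} [IsProbabilityMeasure P]
  {ν : Ω → ℝ} {θ : ℝ → Ω → ℝ}

/-- One Euler step for the difference of two drives. -/
theorem drive_sub_step (hp : IsTrapping Γ g m M K κ ϑ νl νr)
    (hs : IsMeanField Γ κ ϑ νl νr P ν θ) {B C : ℝ} (hr : HasRates κ M P Γ ν θ B C) {t h D : ℝ}
    (ht : 0 ≤ t) (hh : 0 ≤ h) (h1 : κ * M * h ≤ 1)
    (hD : ∀ α β, drive κ P ν (θ t) α - drive κ P ν (θ t) β ≤ D) (α β : Ω) :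
    drive κ P ν (θ (t + h)) α - drive κ P ν (θ (t + h)) β ≤
      (1 - κ * Real.cos ϑ * m * h) * D + 2 * κ * (4 * B ^ 2 + 2 * C) * h ^ 2 := by
  have hκ := hp.coupling_pos
  have hM := hp.upper_pos
  have hm := hp.lower_pos
  have hcos := hp.cos_pos
  set ω := drive κ P ν (θ t) with hω
  have hD0 : 0 ≤ D := by simpa using hD α α
  -- The remainder adds the quadratic error of the sine, (2 B h)², and twice the Taylor error C h²
  -- of the phases.
  have euler : ∀ α γ, |Real.sin (θ (t + h) γ - θ (t + h) α) - Real.sin (θ t γ - θ t α) -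
      h * (Real.cos (θ t γ - θ t α) * (Γ (ω γ) - Γ (ω α)))| ≤ (4 * B ^ 2 + 2 * C) * h ^ 2 := by
    intro α γ
    set x := θ t γ - θ t α
    set y := θ (t + h) γ - θ (t + h) α
    have a1 := abs_le.1 (hr.speed t ht h hh α)
    have a2 := abs_le.1 (hr.speed t ht h hh γ)
    have b1 := abs_le.1 (hr.taylor t ht h hh α)
    have b2 := abs_le.1 (hr.taylor t ht h hh γ)
    have hxy : |y - x| ≤ 2 * B * h := by rw [abs_le]; constructor <;> simp only [x, y] <;> linarith
    have hsq : (y - x) ^ 2 ≤ 4 * B ^ 2 * h ^ 2 := by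
      rw [← sq_abs]
      have := pow_le_pow_left₀ (abs_nonneg _) hxy 2
      linarith [this, show (2 * B * h) ^ 2 = 4 * B ^ 2 * h ^ 2 by ring]
    have hT : |y - x - h * (Γ (ω γ) - Γ (ω α))| ≤ 2 * C * h ^ 2 := by
      rw [abs_le]; constructor <;> simp only [x, y] <;> linarith
    have hc : |Real.cos x * (y - x - h * (Γ (ω γ) - Γ (ω α)))| ≤ 2 * C * h ^ 2 := by
      rw [abs_mul]
      exact (mul_le_of_le_one_left (abs_nonneg _) (Real.abs_cos_le_one _)).trans hT
    have hs := abs_sin_sub_sub_le x y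
    calc _ = |(Real.sin y - Real.sin x - Real.cos x * (y - x)) +
          Real.cos x * (y - x - h * (Γ (ω γ) - Γ (ω α)))| := by congr 1; ring
      _ ≤ _ := (abs_add_le _ _).trans (by linarith)
  have hint : ∀ t, 0 ≤ t → ∀ α, Integrable (fun γ => Real.sin (θ t γ - θ t α)) P :=
    fun t ht α => integrable_sin (hs.measurable_phase t ht) _
  have ht' : 0 ≤ t + h := by linarith
  have hint2 : ∀ α, Integrable (fun γ => Real.sin (θ (t + h) γ - θ (t + h) α) -
      Real.sin (θ t γ - θ t α)) P := fun α => (hint _ ht' α).sub (hint _ ht α)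
  have e : drive κ P ν (θ (t + h)) α - drive κ P ν (θ (t + h)) β = ω α - ω β +
      ∫ γ, κ * ((Real.sin (θ (t + h) γ - θ (t + h) α) - Real.sin (θ t γ - θ t α)) -
        (Real.sin (θ (t + h) γ - θ (t + h) β) - Real.sin (θ t γ - θ t β))) ∂P := by
    rw [integral_const_mul, integral_sub (hint2 _) (hint2 _), integral_sub (hint _ ht' _) (hint _ ht _),
      integral_sub (hint _ ht' _) (hint _ ht _)]
    simp only [hω, drive]
    ring
  rw [e]
  have hb : ∫ γ, κ * ((Real.sin (θ (t + h) γ - θ (t + h) α) - Real.sin (θ t γ - θ t α)) -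
        (Real.sin (θ (t + h) γ - θ (t + h) β) - Real.sin (θ t γ - θ t β))) ∂P ≤
      (1 - κ * Real.cos ϑ * m * h) * D + 2 * κ * (4 * B ^ 2 + 2 * C) * h ^ 2 - (ω α - ω β) := by
    -- The estimate already holds for each third label γ. With u = ω α - ω γ and v = ω γ - ω β the
    -- Euler step turns u + v into (1 - k)u + (1 - k')v, where each coefficient is κ h times a
    -- cosine times a slope of Γ. Both coefficients lie between κ cos ϑ m h and 1.
    refine integral_le_of_le (((hint2 _).sub (hint2 _)).const_mul κ) fun γ => ?_
    obtain ⟨k₁, p1, p2, p3⟩ := hp.exists_slope (ω γ) (ω α)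
    obtain ⟨k₂, q1, q2, q3⟩ := hp.exists_slope (ω γ) (ω β)
    have e1 := abs_le.1 (euler α γ)
    have e2 := abs_le.1 (euler β γ)
    have c1 := cos_le_cos_of_abs_le hp.theta_mem.2 (hs.abs_phase_sub_le hp ht γ α)
    have c2 := cos_le_cos_of_abs_le hp.theta_mem.2 (hs.abs_phase_sub_le hp ht γ β)
    have hk : ∀ c k, Real.cos ϑ ≤ c → c ≤ 1 → m ≤ k → k ≤ M →
        κ * Real.cos ϑ * m * h ≤ κ * h * (c * k) ∧ κ * h * (c * k) ≤ 1 := by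
      intro c k hc hc1 hk hkM
      have : Real.cos ϑ * m ≤ c * k := mul_le_mul hc hk hm.le (hcos.le.trans hc)
      have h' : c * k ≤ M :=
        (mul_le_of_le_one_left (hm.le.trans hk) hc1).trans hkM
      have hκh : 0 ≤ κ * h := by positivity
      constructor
      · nlinarith [mul_le_mul_of_nonneg_left this hκh]
      · nlinarith [mul_le_mul_of_nonneg_left h' hκh]
    have k1 := hk _ _ c1 (Real.cos_le_one _) p1 p2
    have k2 := hk _ _ c2 (Real.cos_le_one _) q1 q2
    have main := contraction_of_abs_le k1.1 k1.2 k2.1 k2.2 (hD α γ) (hD γ β)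
      (by linarith [hD α β]) hD0
    rw [p3] at e1
    rw [q3] at e2
    have f1 := mul_le_mul_of_nonneg_left e1.2 hκ.le
    have f2 := mul_le_mul_of_nonneg_left e2.1 hκ.le
    linarith
  linarith

/-- Exponential synchronization: drives approach each other at the rate `κ m cos ϑ`. -/
theorem abs_drive_sub_le (hp : IsTrapping Γ g m M K κ ϑ νl νr)
    (hs : IsMeanField Γ κ ϑ νl νr P ν θ) {t : ℝ} (ht : 0 ≤ t) (α β : Ω) :
    |drive κ P ν (θ t) α - drive κ P ν (θ t) β| ≤
      2 * (max |νl| |νr| + κ) * Real.exp (-(κ * Real.cos ϑ * m) * t) := by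
  obtain ⟨B, C, hr⟩ := hs.exists_hasRates hp
  have hκ := hp.coupling_pos
  have hM := hp.upper_pos
  have hm := hp.lower_pos
  have hcos := hp.cos_pos
  set Y := max |νl| |νr| + κ
  set D : ℝ → Ω × Ω → ℝ := fun t p => drive κ P ν (θ t) p.1 - drive κ P ν (θ t) p.2 with hDdef
  have hDY : ∀ t p, D t p ≤ 2 * Y := fun t p => by
    have h1 := abs_le.1 (hs.abs_drive_le hp t p.1)
    have h2 := abs_le.1 (hs.abs_drive_le hp t p.2)
    simp only [hDdef, Y]; linarith
  have hbdd : ∀ t, BddAbove (range (D t)) := fun t => ⟨2 * Y, forall_mem_range.2 (hDY t)⟩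
  have : Nonempty (Ω × Ω) := ⟨(α, β)⟩
  -- The step length 1 / (κ M) keeps the contraction coefficients at most 1, and 4 κ B is twice the
  -- rate of change of a single drive.
  have key := le_mul_exp_of_step (f := fun t => ⨆ p, D t p)
    (b := fun _ => -(κ * Real.cos ϑ * m)) (β := fun t => -(κ * Real.cos ϑ * m) * t)
    (C := 2 * κ * (4 * B ^ 2 + 2 * C)) (C' := 4 * κ * B) (h₀ := (κ * M)⁻¹) (by positivity)
    (fun t ht h hh => abs_iSup_sub_iSup_le (hbdd _) (hbdd _) fun p => by
      have h1 := abs_le.1 (hr.drive t ht h hh p.1)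
      have h2 := abs_le.1 (hr.drive t ht h hh p.2)
      rw [abs_le]
      constructor <;> simp only [hDdef] <;> linarith)
    (fun t ht h hh hh0 => ciSup_le fun p => by
      have := hs.drive_sub_step hp hr ht hh (D := ⨆ p, D t p)
        (by
          have := mul_le_mul_of_nonneg_left hh0 (by positivity : 0 ≤ κ * M)
          rwa [mul_inv_cancel₀ (by positivity)] at this)
        (fun α β => le_ciSup (hbdd t) (α, β)) p.1 p.2
      refine this.trans (le_of_eq ?_)
      ring)
    (fun t => by simpa using (hasDerivAt_id t).const_mul (-(κ * Real.cos ϑ * m))) ht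
  have h0 : (⨆ p, D 0 p) ≤ 2 * Y := ciSup_le (hDY 0)
  have h1 : ∀ p, D t p ≤ 2 * Y * Real.exp (-(κ * Real.cos ϑ * m) * t) := fun p => by
    refine (le_ciSup (hbdd t) p).trans (key.trans ?_)
    simp only [mul_zero, sub_zero]
    exact mul_le_mul_of_nonneg_right h0 (Real.exp_pos _).le
  rw [abs_le]
  have h2 := h1 (α, β)
  have h3 := h1 (β, α)
  simp only [hDdef] at h2 h3
  constructor <;> linarith

/-- Antisymmetric interactions cancel in the mean. -/
theorem integral_integral_eq_zero_of_antisymm {k : Ω → Ω → ℝ}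
    (hk : Integrable (Function.uncurry k) (P.prod P)) (ha : ∀ α β, k α β = -k β α) :
    ∫ α, ∫ β, k α β ∂P ∂P = 0 := by
  have h := integral_integral_swap hk
  have h2 : ∫ α, ∫ β, k α β ∂P ∂P = -∫ β, ∫ α, k α β ∂P ∂P := by
    rw [← integral_neg]
    refine integral_congr_ae (ae_of_all _ fun α => ?_)
    simp only
    rw [← integral_neg]
    exact integral_congr_ae (ae_of_all _ fun β => ha α β)
  linarith

theorem integrable_freq (hs : IsMeanField Γ κ ϑ νl νr P ν θ) : Integrable ν P :=
  integrable_of_abs_le hs.measurable_freq fun α =>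
    abs_le_max_abs_abs (hs.freq_mem α).1 (hs.freq_mem α).2

/-- The interaction is antisymmetric and averages out. This conservation law identifies the common
limit of the drives. -/
theorem integral_drive (hs : IsMeanField Γ κ ϑ νl νr P ν θ) {t : ℝ} (ht : 0 ≤ t) :
    ∫ α, drive κ P ν (θ t) α ∂P = ∫ α, ν α ∂P := by
  have hmeas : Measurable (Function.uncurry fun α β => Real.sin (θ t β - θ t α)) := by
    have := hs.measurable_phase t ht
    unfold Function.uncurry; fun_prop
  have hi : Integrable (Function.uncurry fun α β => Real.sin (θ t β - θ t α)) (P.prod P) :=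
    integrable_of_abs_le hmeas fun _ => Real.abs_sin_le_one _
  have hi' : Integrable (fun α => κ * ∫ β, Real.sin (θ t β - θ t α) ∂P) P :=
    hi.integral_prod_left.const_mul κ
  unfold drive
  rw [integral_add hs.integrable_freq hi', integral_const_mul,
    integral_integral_eq_zero_of_antisymm hi fun α β => by
      rw [← Real.sin_neg]; congr 1; ring]
  simp

/-- The mean frequency is the average of the drives, so the deviation from it is an average of
pairwise differences, and these decay exponentially. -/
theorem abs_drive_sub_mean_le (hp : IsTrapping Γ g m M K κ ϑ νl νr)
    (hs : IsMeanField Γ κ ϑ νl νr P ν θ) {t : ℝ} (ht : 0 ≤ t) (α : Ω) :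
    |drive κ P ν (θ t) α - ∫ β, ν β ∂P| ≤
      2 * (max |νl| |νr| + κ) * Real.exp (-(κ * Real.cos ϑ * m) * t) := by
  have hi : Integrable (drive κ P ν (θ t)) P :=
    integrable_of_abs_le (hs.measurable_drive ht) (hs.abs_drive_le hp t)
  have : drive κ P ν (θ t) α - ∫ β, ν β ∂P =
      ∫ β, (drive κ P ν (θ t) α - drive κ P ν (θ t) β) ∂P := by
    rw [integral_sub (integrable_const _) hi, hs.integral_drive ht]
    simp
  rw [this]
  exact abs_integral_le_of_abs_le fun β => hs.abs_drive_sub_le hp ht α β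

end IsMeanField

end GKuramoto

namespace GKuramoto

variable {Ω : Type*} [MeasurableSpace Ω]

/-! ### Bounded measurable functions and their `L^p` norms -/

/-- Bounded measurable real functions. -/
def IsBddMeas (f : Ω → ℝ) : Prop := Measurable f ∧ ∃ C, ∀ α, |f α| ≤ C

namespace IsBddMeas

variable {f f' : Ω → ℝ} {P : Measure Ω} {p : ℝ≥0∞}

theorem const (c : ℝ) : IsBddMeas fun _ : Ω => c := ⟨measurable_const, |c|, fun _ => le_rfl⟩

theorem add (hf : IsBddMeas f) (hf' : IsBddMeas f') : IsBddMeas fun α => f α + f' α := by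
  obtain ⟨h, C, hC⟩ := hf
  obtain ⟨h', C', hC'⟩ := hf'
  exact ⟨h.add h', C + C', fun α => (abs_add_le _ _).trans (add_le_add (hC α) (hC' α))⟩

theorem const_mul (c : ℝ) (hf : IsBddMeas f) : IsBddMeas fun α => c * f α := by
  obtain ⟨h, C, hC⟩ := hf
  refine ⟨h.const_mul c, |c| * C, fun α => ?_⟩
  rw [abs_mul]
  exact mul_le_mul_of_nonneg_left (hC α) (abs_nonneg _)

theorem sub (hf : IsBddMeas f) (hf' : IsBddMeas f') : IsBddMeas fun α => f α - f' α := by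
  simpa [sub_eq_add_neg] using hf.add (hf'.const_mul (-1))

theorem abs (hf : IsBddMeas f) : IsBddMeas fun α => |f α| := by
  obtain ⟨h, C, hC⟩ := hf
  exact ⟨h.abs, C, fun α => by rw [abs_abs]; exact hC α⟩

theorem mul (hf : IsBddMeas f) (hf' : IsBddMeas f') : IsBddMeas fun α => f α * f' α := by
  obtain ⟨h, C, hC⟩ := hf
  obtain ⟨h', C', hC'⟩ := hf'
  refine ⟨h.mul h', C * C', fun α => ?_⟩
  rw [abs_mul]
  exact mul_le_mul (hC α) (hC' α) (abs_nonneg _) ((abs_nonneg _).trans (hC α))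

theorem rpow (hf : IsBddMeas f) {q : ℝ} (hq : 0 ≤ q) : IsBddMeas fun α => |f α| ^ q := by
  obtain ⟨h, C, hC⟩ := hf
  refine ⟨h.abs.pow_const q, C ^ q, fun α => ?_⟩
  rw [abs_of_nonneg (Real.rpow_nonneg (abs_nonneg _) _)]
  exact Real.rpow_le_rpow (abs_nonneg _) (hC α) hq

theorem integrable (hf : IsBddMeas f) [IsFiniteMeasure P] : Integrable f P :=
  integrable_of_abs_le hf.1 hf.2.choose_spec

theorem memLp (hf : IsBddMeas f) [IsFiniteMeasure P] : MemLp f p P :=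
  MemLp.of_bound hf.1.aestronglyMeasurable _ (ae_of_all _ hf.2.choose_spec)

theorem comp_measurable {Ω' : Type*} [MeasurableSpace Ω'] (hf : IsBddMeas f) {φ : Ω' → Ω}
    (hφ : Measurable φ) : IsBddMeas fun α => f (φ α) :=
  ⟨hf.1.comp hφ, hf.2.choose, fun α => hf.2.choose_spec (φ α)⟩

theorem integral_right {k : Ω → Ω → ℝ} [IsProbabilityMeasure P]
    (hk : IsBddMeas (Function.uncurry k)) : IsBddMeas fun α => ∫ β, k α β ∂P := by
  obtain ⟨h, C, hC⟩ := hk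
  exact ⟨(h.stronglyMeasurable.integral_prod_right (ν := P)).measurable, C,
    fun α => abs_integral_le_of_abs_le fun β => hC (α, β)⟩

theorem right {k : Ω → Ω → ℝ} (hk : IsBddMeas (Function.uncurry k)) (α : Ω) :
    IsBddMeas (k α) := hk.comp_measurable (φ := fun β => (α, β)) (by fun_prop)

theorem lpNorm_add_le [IsFiniteMeasure P] (hp : 1 ≤ p) (hf : IsBddMeas f) :
    lpNorm (fun α => f α + f' α) p P ≤ lpNorm f p P + lpNorm f' p P :=
  MeasureTheory.lpNorm_add_le hf.memLp hp

theorem lpNorm_le_of_le [IsFiniteMeasure P] (hf' : IsBddMeas f')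
    (h : ∀ α, |f α| ≤ f' α) : lpNorm f p P ≤ lpNorm f' p P :=
  lpNorm_mono_real hf'.memLp h

theorem lpNorm_const_mul (c : ℝ) : lpNorm (fun α => c * f α) p P = |c| * lpNorm f p P := by
  have := MeasureTheory.lpNorm_const_smul (p := p) c f P
  rw [coe_nnnorm, Real.norm_eq_abs] at this
  exact this

theorem lpNorm_const_fun [IsProbabilityMeasure P] (hp : 1 ≤ p) (c : ℝ) :
    lpNorm (fun _ : Ω => c) p P = |c| := by
  rw [MeasureTheory.lpNorm_const (by positivity) (IsProbabilityMeasure.ne_zero P)]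
  simp

theorem lpNorm_le_const [IsProbabilityMeasure P] (hp : 1 ≤ p) {C : ℝ}
    (h : ∀ α, |f α| ≤ C) : lpNorm f p P ≤ C := by
  have hne : Nonempty Ω := nonempty_of_isProbabilityMeasure P
  have hC : 0 ≤ C := (abs_nonneg _).trans (h hne.some)
  refine (lpNorm_le_of_le (const C) h).trans ?_
  rw [lpNorm_const_fun hp, abs_of_nonneg hC]

theorem lpNorm_add_const_le [IsProbabilityMeasure P] (hp : 1 ≤ p) (c : ℝ) (hf : IsBddMeas f) :
    lpNorm (fun α => f α + c) p P ≤ lpNorm f p P + |c| := by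
  refine (hf.lpNorm_add_le hp (f' := fun _ => c)).trans ?_
  rw [lpNorm_const_fun hp]

theorem integral_abs_le_lpNorm [IsProbabilityMeasure P] (hp : 1 ≤ p) (hf : IsBddMeas f) :
    ∫ α, |f α| ∂P ≤ lpNorm f p P := by
  have h := eLpNorm_le_eLpNorm_of_exponent_le (μ := P) hp hf.1.aestronglyMeasurable
  have h1 := lpNorm_one_eq_integral_norm (μ := P) hf.1.aestronglyMeasurable
  simp only [Real.norm_eq_abs] at h1
  rw [← h1, ← toReal_eLpNorm hf.1.aestronglyMeasurable, ← toReal_eLpNorm hf.1.aestronglyMeasurable]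
  exact ENNReal.toReal_mono hf.memLp.eLpNorm_ne_top h

theorem abs_integral_le_lpNorm [IsProbabilityMeasure P] (hp : 1 ≤ p) (hf : IsBddMeas f) :
    |∫ α, f α ∂P| ≤ lpNorm f p P :=
  (abs_integral_le_integral_abs).trans (hf.integral_abs_le_lpNorm hp)

theorem lpNorm_sub_mean_le [IsProbabilityMeasure P] (hp : 1 ≤ p) (hf : IsBddMeas f) :
    lpNorm (fun α => f α - ∫ β, f β ∂P) p P ≤ 2 * lpNorm f p P := by
  have h := lpNorm_add_const_le (P := P) hp (-∫ β, f β ∂P) hf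
  simp only [← sub_eq_add_neg, abs_neg] at h
  linarith [hf.abs_integral_le_lpNorm (P := P) hp]

theorem lpNorm_eq [IsFiniteMeasure P] (hp : 1 ≤ p) (hp' : p ≠ ∞) (hf : IsBddMeas f) :
    lpNorm f p P = (∫ α, |f α| ^ p.toReal ∂P) ^ p.toReal⁻¹ :=
  lpNorm_eq_integral_norm_rpow_toReal (by positivity) hp' hf.1.aestronglyMeasurable

/-- Jensen's inequality for `|x| ^ q`. -/
theorem rpow_abs_integral_le [IsProbabilityMeasure P] {q : ℝ} (hq : 1 ≤ q) (hf : IsBddMeas f) :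
    |∫ α, f α ∂P| ^ q ≤ ∫ α, |f α| ^ q ∂P := by
  refine (Real.rpow_le_rpow (abs_nonneg _) abs_integral_le_integral_abs (by linarith)).trans ?_
  exact (convexOn_rpow hq).map_integral_le (μ := P) (f := fun α => |f α|)
    (Real.continuous_rpow_const (by linarith)).continuousOn isClosed_Ici
    (ae_of_all _ fun α => mem_Ici.2 (abs_nonneg _)) hf.abs.integrable
    (hf.rpow (by linarith)).integrable

/-- Averaging against a symmetric kernel is a contraction in `L^p`. -/
theorem lpNorm_average_le [IsProbabilityMeasure P] (hp : 1 ≤ p) (hp' : p ≠ ∞) (hf : IsBddMeas f)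
    {k : Ω → Ω → ℝ} (hk : Measurable (Function.uncurry k)) (hk0 : ∀ α β, 0 ≤ k α β)
    (hk1 : ∀ α β, k α β ≤ 1) (hsymm : ∀ α β, k α β = k β α) :
    lpNorm (fun α => ∫ β, ((1 - k α β) * f α + k α β * f β) ∂P) p P ≤ lpNorm f p P := by
  have hq : 1 ≤ p.toReal := by
    simpa using (ENNReal.toReal_le_toReal ENNReal.one_ne_top hp').2 hp
  set q := p.toReal
  have bk : IsBddMeas (Function.uncurry k) :=
    ⟨hk, 1, fun z => by
      rw [abs_le, Function.uncurry]
      constructor <;> linarith [hk0 z.1 z.2, hk1 z.1 z.2]⟩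
  have bfst := hf.comp_measurable (φ := fun z : Ω × Ω => z.1) measurable_fst
  have bsnd := hf.comp_measurable (φ := fun z : Ω × Ω => z.2) measurable_snd
  have b1 : IsBddMeas (Function.uncurry fun α β => (1 - k α β) * f α + k α β * f β) :=
    (((const 1).sub bk).mul bfst).add (bk.mul bsnd)
  have bF := (hf.rpow (q := q) (by linarith))
  have b2 : IsBddMeas (Function.uncurry fun α β => k α β * |f α| ^ q) :=
    bk.mul (bF.comp_measurable measurable_fst)
  have b3 : IsBddMeas (Function.uncurry fun α β => k α β * |f β| ^ q) :=
    bk.mul (bF.comp_measurable measurable_snd)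
  rw [(integral_right b1).lpNorm_eq hp hp', hf.lpNorm_eq hp hp']
  refine Real.rpow_le_rpow (integral_nonneg fun α => Real.rpow_nonneg (abs_nonneg _) _) ?_
    (by positivity)
  -- Jensen's inequality moves the power inside the integral over β, and convexity of the power
  -- splits the convex combination.
  have hpt : ∀ α, |∫ β, ((1 - k α β) * f α + k α β * f β) ∂P| ^ q ≤
      |f α| ^ q - ∫ β, k α β * |f α| ^ q ∂P + ∫ β, k α β * |f β| ^ q ∂P := by
    intro α
    refine (rpow_abs_integral_le hq (b1.right α)).trans ?_
    have e : |f α| ^ q - ∫ β, k α β * |f α| ^ q ∂P + ∫ β, k α β * |f β| ^ q ∂P =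
        ∫ β, (|f α| ^ q - k α β * |f α| ^ q + k α β * |f β| ^ q) ∂P := by
      have i1 : Integrable (fun β => |f α| ^ q - k α β * |f α| ^ q) P :=
        (integrable_const _).sub (b2.right α).integrable
      rw [integral_add i1 (b3.right α).integrable,
        integral_sub (integrable_const _) (b2.right α).integrable]
      simp
    rw [e]
    have b4 : IsBddMeas fun β => |f α| ^ q - k α β * |f α| ^ q + k α β * |f β| ^ q :=
      ((const _).sub (b2.right α)).add (b3.right α)
    refine integral_mono ((b1.right α).rpow (by linarith)).integrable b4.integrable fun β => ?_
    have hc := (convexOn_rpow hq).2 (mem_Ici.2 (abs_nonneg (f α))) (mem_Ici.2 (abs_nonneg (f β)))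
      (show 0 ≤ 1 - k α β by linarith [hk1 α β]) (hk0 α β) (by ring)
    simp only [smul_eq_mul] at hc
    refine (Real.rpow_le_rpow (abs_nonneg _) ((abs_add_le _ _).trans (le_of_eq ?_))
      (by linarith)).trans (hc.trans (le_of_eq (by ring)))
    rw [abs_mul, abs_mul, abs_of_nonneg (hk0 α β), abs_of_nonneg (by linarith [hk1 α β])]
  have b5 : IsBddMeas fun α => ∫ β, k α β * |f α| ^ q ∂P := integral_right b2
  have b6 : IsBddMeas fun α => ∫ β, k α β * |f β| ^ q ∂P := integral_right b3
  refine (integral_mono ((integral_right b1).rpow (by linarith)).integrable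
    ((bF.sub b5).add b6).integrable hpt).trans (le_of_eq ?_)
  -- By symmetry of the kernel, what α receives from β balances what it gives away, so the two
  -- kernel terms cancel after integration.
  have hsw : ∫ α, ∫ β, k α β * |f β| ^ q ∂P ∂P = ∫ α, ∫ β, k α β * |f α| ^ q ∂P ∂P := by
    rw [integral_integral_swap b3.integrable]
    refine integral_congr_ae (ae_of_all _ fun α => integral_congr_ae (ae_of_all _ fun β => ?_))
    simp only [hsymm α β]
  rw [integral_add (bF.sub b5).integrable b6.integrable, integral_sub bF.integrable b5.integrable,
    hsw]
  ring

/-- For functions of mean zero, a symmetric interaction of strength at least `w₀` contracts `L^p`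
norms by the factor `1 - w₀`. -/
theorem lpNorm_add_interaction_le [IsProbabilityMeasure P] (hp : 1 ≤ p) (hp' : p ≠ ∞)
    (hf : IsBddMeas f) (hmean : ∫ α, f α ∂P = 0) {w : Ω → Ω → ℝ} {w₀ : ℝ}
    (hw : Measurable (Function.uncurry w)) (hw0 : ∀ α β, w₀ ≤ w α β)
    (hw1 : ∀ α β, w α β ≤ 1) (hsymm : ∀ α β, w α β = w β α) (hlt : w₀ < 1) :
    lpNorm (fun α => f α + ∫ β, w α β * (f β - f α) ∂P) p P ≤ (1 - w₀) * lpNorm f p P := by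
  have h0 : 0 < 1 - w₀ := by linarith
  have bw : IsBddMeas (Function.uncurry w) := ⟨hw, max |w₀| |1|, fun z =>
    abs_le_max_abs_abs (hw0 _ _) (hw1 _ _)⟩
  -- Since f has mean zero, the constant part w₀ of the kernel contributes exactly -w₀ f. The rest,
  -- rescaled by 1 - w₀, is an averaging with a symmetric kernel in [0, 1].
  have e : (fun α => f α + ∫ β, w α β * (f β - f α) ∂P) = fun α => (1 - w₀) *
      ∫ β, ((1 - (w α β - w₀) / (1 - w₀)) * f α + (w α β - w₀) / (1 - w₀) * f β) ∂P := by
    funext α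
    rw [← integral_const_mul]
    have b1 : IsBddMeas fun β => w α β * (f β - f α) := (bw.right α).mul (hf.sub (const _))
    have : ∀ β, (1 - w₀) * ((1 - (w α β - w₀) / (1 - w₀)) * f α +
        (w α β - w₀) / (1 - w₀) * f β) = f α + w α β * (f β - f α) - w₀ * f β := by
      intro β
      field_simp
      ring
    simp_rw [this]
    have i1 : Integrable (fun β => f α + w α β * (f β - f α)) P :=
      ((const _).add b1).integrable
    rw [integral_sub i1 (hf.const_mul w₀).integrable,
      integral_add (integrable_const _) b1.integrable, integral_const_mul, hmean]
    simp
  rw [e, lpNorm_const_mul, abs_of_pos h0]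
  refine mul_le_mul_of_nonneg_left (lpNorm_average_le hp hp' hf ?_ (fun α β => ?_)
    (fun α β => ?_) fun α β => by rw [hsymm]) h0.le
  · exact (hw.sub_const w₀).div_const _
  · exact div_nonneg (by linarith [hw0 α β]) h0.le
  · rw [div_le_one h0]; linarith [hw1 α β]

end IsBddMeas

/-! ### The difference quotient of the sine function -/

/-- The slope `(sin x - sin y) / (x - y)`. -/
noncomputable def sinSlope (x y : ℝ) : ℝ := Real.cos ((x + y) / 2) * Real.sinc ((x - y) / 2)

/-- This is the sum-to-product formula; absorbing the vanishing factor into `Real.sinc` makes the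
slope continuous across the diagonal. -/
theorem sinSlope_mul (x y : ℝ) : sinSlope x y * (x - y) = Real.sin x - Real.sin y := by
  rw [Real.sin_sub_sin, sinSlope]
  rcases eq_or_ne x y with rfl | h
  · simp
  · rw [Real.sinc_of_ne_zero (div_ne_zero (sub_ne_zero.2 h) two_ne_zero)]
    field_simp [sub_ne_zero.2 h]

theorem continuous_sinSlope : Continuous fun z : ℝ × ℝ => sinSlope z.1 z.2 := by
  have := Real.continuous_sinc
  unfold sinSlope
  fun_prop

/-- Exchanging two labels negates the phase differences in both systems, so this evenness is the
symmetry of the interaction kernel. -/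
theorem sinSlope_neg (x y : ℝ) : sinSlope (-x) (-y) = sinSlope x y := by
  unfold sinSlope
  rw [show (-x + -y) / 2 = -((x + y) / 2) by ring, show (-x - -y) / 2 = -((x - y) / 2) by ring,
    Real.cos_neg, Real.sinc_neg]

theorem abs_sinSlope_le_one (x y : ℝ) : |sinSlope x y| ≤ 1 := by
  unfold sinSlope
  rw [abs_mul]
  exact mul_le_one₀ (Real.abs_cos_le_one _) (abs_nonneg _)
    (abs_le.2 ⟨Real.neg_one_le_sinc _, Real.sinc_le_one _⟩)

theorem cos_le_sinSlope {θ x y : ℝ} (hθ : θ < Real.pi / 2) (hx : |x| ≤ θ) (hy : |y| ≤ θ) :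
    Real.cos θ ≤ sinSlope x y := by
  have key : ∀ x y, |x| ≤ θ → |y| ≤ θ → x < y → Real.cos θ * (y - x) ≤ Real.sin y - Real.sin x := by
    intro x y hx hy h
    obtain ⟨c, hc, h'⟩ := exists_hasDerivAt_eq_slope Real.sin Real.cos h
      Real.continuous_sin.continuousOn fun z _ => Real.hasDerivAt_sin z
    have hcθ : |c| ≤ θ := by
      rw [abs_le] at *
      exact ⟨hx.1.trans hc.1.le, hc.2.le.trans hy.2⟩
    have := cos_le_cos_of_abs_le hθ hcθ
    rwa [h', le_div_iff₀ (sub_pos.2 h)] at this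
  rcases lt_trichotomy x y with h | h | h
  · have := key x y hx hy h
    have h2 := sinSlope_mul x y
    nlinarith [sub_pos.2 h]
  · subst h
    have : sinSlope x x = Real.cos x := by simp [sinSlope]
    rw [this]
    exact cos_le_cos_of_abs_le hθ hx
  · have := key y x hy hx h
    rw [← sinSlope_mul] at this
    exact le_of_mul_le_mul_right this (sub_pos.2 h)

end GKuramoto

namespace GKuramoto

variable {Ω : Type*} [MeasurableSpace Ω]

/-! ### Uniform-in-time stability of mean-field systems -/

namespace IsMeanField

variable {Γ g : ℝ → ℝ} {m M K κ ϑ νl νr : ℝ} {P : Measure Ω} [IsProbabilityMeasure P]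
  {ν ν' : Ω → ℝ} {θ θ' : ℝ → Ω → ℝ}

theorem isBddMeas_freq (hs : IsMeanField Γ κ ϑ νl νr P ν θ) : IsBddMeas ν :=
  ⟨hs.measurable_freq, _, fun α => abs_le_max_abs_abs (hs.freq_mem α).1 (hs.freq_mem α).2⟩

theorem isBddMeas_phase (hp : IsTrapping Γ g m M K κ ϑ νl νr)
    (hs : IsMeanField Γ κ ϑ νl νr P ν θ) {t : ℝ} (ht : 0 ≤ t) : IsBddMeas (θ t) := by
  obtain ⟨B, C, hr⟩ := hs.exists_hasRates hp
  refine ⟨hs.measurable_phase t ht, ϑ + B * t, fun α => ?_⟩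
  have h1 := hr.speed 0 le_rfl t ht α
  rw [zero_add] at h1
  have h2 := hs.init_mem α
  rw [abs_le] at *
  constructor <;> linarith [h2.1, h2.2, hp.theta_mem.1]

theorem isBddMeas_drive (hp : IsTrapping Γ g m M K κ ϑ νl νr)
    (hs : IsMeanField Γ κ ϑ νl νr P ν θ) {t : ℝ} (ht : 0 ≤ t) :
    IsBddMeas (drive κ P ν (θ t)) := ⟨hs.measurable_drive ht, _, hs.abs_drive_le hp t⟩

theorem isBddMeas_velocity (hp : IsTrapping Γ g m M K κ ϑ νl νr)
    (hs : IsMeanField Γ κ ϑ νl νr P ν θ) {t : ℝ} (ht : 0 ≤ t) :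
    IsBddMeas fun α => Γ (drive κ P ν (θ t) α) :=
  ⟨hp.continuous.measurable.comp (hs.measurable_drive ht), _, hs.abs_velocity_le hp t⟩

theorem measurable_slope (hs : IsMeanField Γ κ ϑ νl νr P ν θ)
    (hs' : IsMeanField Γ κ ϑ νl νr P ν' θ') {t : ℝ} (ht : 0 ≤ t) :
    Measurable (Function.uncurry fun α β => sinSlope (θ t β - θ t α) (θ' t β - θ' t α)) := by
  have h1 := hs.measurable_phase t ht
  have h2 := hs'.measurable_phase t ht
  exact continuous_sinSlope.measurable.comp (f := fun z : Ω × Ω =>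
    (θ t z.2 - θ t z.1, θ' t z.2 - θ' t z.1)) (by fun_prop)

theorem isBddMeas_slope_mul (hs : IsMeanField Γ κ ϑ νl νr P ν θ)
    (hs' : IsMeanField Γ κ ϑ νl νr P ν' θ') {t : ℝ} (ht : 0 ≤ t) {f : Ω → ℝ} (hf : IsBddMeas f)
    (α : Ω) :
    IsBddMeas fun β => sinSlope (θ t β - θ t α) (θ' t β - θ' t α) * (f β - f α) := by
  have b : IsBddMeas (Function.uncurry fun α β => sinSlope (θ t β - θ t α) (θ' t β - θ' t α)) :=
    ⟨hs.measurable_slope hs' ht, 1, fun z => abs_sinSlope_le_one _ _⟩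
  exact (b.right α).mul (hf.sub (.const _))

/-- The difference of the drives of two systems. -/
theorem drive_sub_drive (hs : IsMeanField Γ κ ϑ νl νr P ν θ)
    (hs' : IsMeanField Γ κ ϑ νl νr P ν' θ') {t : ℝ} (ht : 0 ≤ t) (c : ℝ) (α : Ω) :
    drive κ P ν (θ t) α - drive κ P ν' (θ' t) α = ν α - ν' α +
      κ * ∫ β, sinSlope (θ t β - θ t α) (θ' t β - θ' t α) *
        ((θ t β - θ' t β - c) - (θ t α - θ' t α - c)) ∂P := by
  have : ∀ β, sinSlope (θ t β - θ t α) (θ' t β - θ' t α) *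
        ((θ t β - θ' t β - c) - (θ t α - θ' t α - c)) =
      Real.sin (θ t β - θ t α) - Real.sin (θ' t β - θ' t α) := by
    intro β
    rw [← sinSlope_mul]
    ring
  simp_rw [this]
  rw [integral_sub (integrable_sin (hs.measurable_phase t ht) _)
    (integrable_sin (hs'.measurable_phase t ht) _)]
  unfold drive
  ring

/-- The interaction does not see a common shift c of the phases. With c the mean phase difference,
the bound involves only the dispersion, not the mean itself. -/
theorem abs_drive_sub_drive_le (hp : IsTrapping Γ g m M K κ ϑ νl νr)
    (hs : IsMeanField Γ κ ϑ νl νr P ν θ)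
    (hs' : IsMeanField Γ κ ϑ νl νr P ν' θ') {t : ℝ} (ht : 0 ≤ t) (c : ℝ) (α : Ω) :
    |drive κ P ν (θ t) α - drive κ P ν' (θ' t) α| ≤ |ν α - ν' α| +
      κ * (|θ t α - θ' t α - c| + ∫ β, |θ t β - θ' t β - c| ∂P) := by
  have hκ := hp.coupling_pos
  have bξ : IsBddMeas fun α => θ t α - θ' t α - c :=
    ((hs.isBddMeas_phase hp ht).sub (hs'.isBddMeas_phase hp ht)).sub (.const c)
  rw [hs.drive_sub_drive hs' ht c α]
  refine (abs_add_le _ _).trans (add_le_add le_rfl ?_)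
  rw [abs_mul, abs_of_pos hκ]
  refine mul_le_mul_of_nonneg_left ?_ hκ.le
  refine abs_integral_le_integral_abs.trans ?_
  have : |θ t α - θ' t α - c| + ∫ β, |θ t β - θ' t β - c| ∂P =
      ∫ β, (|θ t α - θ' t α - c| + |θ t β - θ' t β - c|) ∂P := by
    rw [integral_add (integrable_const _) bξ.abs.integrable]; simp
  rw [this]
  refine integral_mono (hs.isBddMeas_slope_mul hs' ht bξ α).abs.integrable
    ((IsBddMeas.const _).add bξ.abs).integrable fun β => ?_
  simp only
  rw [abs_mul]
  refine (mul_le_of_le_one_left (abs_nonneg _) (abs_sinSlope_le_one _ _)).trans ?_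
  rw [add_comm]
  exact abs_sub _ _

variable {p : ℝ≥0∞}

/-- The `L^p` dispersion of `f` about its mean. -/
noncomputable def dispersion (p : ℝ≥0∞) (P : Measure Ω) (f : Ω → ℝ) : ℝ :=
  lpNorm (fun α => f α - ∫ β, f β ∂P) p P

/-- One Euler step for the dispersion and the mean of the difference of two systems. -/
theorem dispersion_step (hp : IsTrapping Γ g m M K κ ϑ νl νr)
    (hs : IsMeanField Γ κ ϑ νl νr P ν θ) (hs' : IsMeanField Γ κ ϑ νl νr P ν' θ')
    (hmean : ∫ α, ν α ∂P = ∫ α, ν' α ∂P) (hp1 : 1 ≤ p) (hp' : p ≠ ∞) {B C B' C' : ℝ}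
    (hr : HasRates κ M P Γ ν θ B C) (hr' : HasRates κ M P Γ ν' θ' B' C') {t h : ℝ} (ht : 0 ≤ t)
    (hh : 0 ≤ h) (hh0 : κ * M * h ≤ 1 / 2) :
    ∃ e : ℝ, e ≤ K * (2 * (max |νl| |νr| + κ) * Real.exp (-(κ * Real.cos ϑ * m) * t)) *
        (lpNorm (fun α => ν α - ν' α) p P +
          2 * κ * dispersion p P fun α => θ t α - θ' t α) ∧
      dispersion p P (fun α => θ (t + h) α - θ' (t + h) α) ≤
        (1 - h * (g (∫ α, ν α ∂P) * κ * Real.cos ϑ)) *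
          dispersion p P (fun α => θ t α - θ' t α) +
        h * (g (∫ α, ν α ∂P) * lpNorm (fun α => ν α - ν' α) p P) + 2 * (h * e) +
        2 * (C + C') * h ^ 2 ∧
      |∫ α, (θ (t + h) α - θ' (t + h) α) ∂P| ≤ |∫ α, (θ t α - θ' t α) ∂P| + h * e +
        (C + C') * h ^ 2 := by
  have hκ := hp.coupling_pos
  have hM := hp.upper_pos
  have hcos := hp.cos_pos
  have ht' : 0 ≤ t + h := by linarith
  -- The slope of Γ is taken at the common mean frequency. Its independence of the label keeps the
  -- linearised interaction symmetric and mean-preserving.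
  set γ := g (∫ α, ν α ∂P) with hγ
  have hγ0 : 0 < γ := hp.lower_pos.trans_le (hp.lower _)
  have hγM : γ ≤ M := hp.upper _
  set D := 2 * (max |νl| |νr| + κ) * Real.exp (-(κ * Real.cos ϑ * m) * t) with hD
  have hD0 : 0 ≤ D := by positivity
  set ω := drive κ P ν (θ t)
  set ω' := drive κ P ν' (θ' t)
  set δ : Ω → ℝ := fun α => θ t α - θ' t α with hδ
  set δ₁ : Ω → ℝ := fun α => θ (t + h) α - θ' (t + h) α with hδ₁
  set μ : Ω → ℝ := fun α => ν α - ν' α with hμ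
  set c := ∫ β, δ β ∂P with hc
  set ξ : Ω → ℝ := fun α => δ α - c with hξ
  -- E is the linearisation error, R below the time discretisation error.
  set E : Ω → ℝ := fun α => Γ (ω α) - Γ (ω' α) - γ * (ω α - ω' α) with hE
  set R : Ω → ℝ := fun α => δ₁ α - δ α - h * (Γ (ω α) - Γ (ω' α)) with hR
  have bω : IsBddMeas ω := hs.isBddMeas_drive hp ht
  have bω' : IsBddMeas ω' := hs'.isBddMeas_drive hp ht
  have bδ : IsBddMeas δ := (hs.isBddMeas_phase hp ht).sub (hs'.isBddMeas_phase hp ht)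
  have bδ₁ : IsBddMeas δ₁ := (hs.isBddMeas_phase hp ht').sub (hs'.isBddMeas_phase hp ht')
  have bμ : IsBddMeas μ := hs.isBddMeas_freq.sub hs'.isBddMeas_freq
  have bξ : IsBddMeas ξ := bδ.sub (.const c)
  have bΓ : IsBddMeas fun α => Γ (ω α) - Γ (ω' α) :=
    (hs.isBddMeas_velocity hp ht).sub (hs'.isBddMeas_velocity hp ht)
  have bE : IsBddMeas E := bΓ.sub ((bω.sub bω').const_mul γ)
  have bR : IsBddMeas R := (bδ₁.sub bδ).sub (bΓ.const_mul h)
  have hRle : ∀ α, |R α| ≤ (C + C') * h ^ 2 := by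
    intro α
    have h1 := abs_le.1 (hr.taylor t ht h hh α)
    have h2 := abs_le.1 (hr'.taylor t ht h hh α)
    rw [abs_le]
    constructor <;> simp only [hR, hδ, hδ₁, ω, ω'] <;> linarith
  have hEle : lpNorm E p P ≤ K * D * (lpNorm μ p P + 2 * κ * lpNorm ξ p P) := by
    have h1 : ∀ α, |E α| ≤ K * D * (|μ α| + κ * (|ξ α| + ∫ β, |ξ β| ∂P)) := by
      intro α
      have h2 := hs.abs_drive_sub_mean_le hp ht α
      have h3 := hs'.abs_drive_sub_mean_le hp ht α
      rw [← hmean] at h3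
      refine (hp.abs_sub_sub_le h2 h3).trans ?_
      exact mul_le_mul_of_nonneg_left (hs.abs_drive_sub_drive_le hp hs' ht c α)
        (mul_nonneg hp.lipschitz_nonneg hD0)
    have b1 : IsBddMeas fun α => κ * (|ξ α| + ∫ β, |ξ β| ∂P) :=
      (bξ.abs.add (.const _)).const_mul κ
    refine (IsBddMeas.lpNorm_le_of_le ((bμ.abs.add b1).const_mul (K * D)) h1).trans ?_
    rw [IsBddMeas.lpNorm_const_mul, abs_of_nonneg (mul_nonneg hp.lipschitz_nonneg hD0)]
    refine mul_le_mul_of_nonneg_left ?_ (mul_nonneg hp.lipschitz_nonneg hD0)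
    refine (IsBddMeas.lpNorm_add_le hp1 bμ.abs).trans ?_
    rw [IsBddMeas.lpNorm_const_mul, abs_of_pos hκ, lpNorm_fun_abs bμ.1.aestronglyMeasurable]
    have h4 := IsBddMeas.lpNorm_add_const_le (P := P) hp1 (∫ β, |ξ β| ∂P) bξ.abs
    rw [lpNorm_fun_abs bξ.1.aestronglyMeasurable,
      abs_of_nonneg (integral_nonneg fun _ => abs_nonneg _)] at h4
    have h5 := bξ.integral_abs_le_lpNorm (P := P) hp1
    nlinarith
  have hδ₁eq : ∀ α, δ₁ α = δ α + h * (γ * (ω α - ω' α)) + h * E α + R α := by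
    intro α; simp only [hR, hE]; ring
  -- Both systems have the same mean drive, so the linear part does not move the mean difference.
  have hc₁ : ∫ α, δ₁ α ∂P = c + h * ∫ α, E α ∂P + ∫ α, R α ∂P := by
    simp_rw [hδ₁eq]
    rw [integral_add ((bδ.add (((bω.sub bω').const_mul γ).const_mul h)).add
        (bE.const_mul h)).integrable bR.integrable,
      integral_add (bδ.add (((bω.sub bω').const_mul γ).const_mul h)).integrable
        (bE.const_mul h).integrable,
      integral_add bδ.integrable (((bω.sub bω').const_mul γ).const_mul h).integrable,
      integral_const_mul, integral_const_mul, integral_const_mul,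
      integral_sub bω.integrable bω'.integrable, hs.integral_drive ht, hs'.integral_drive ht,
      hmean]
    ring
  have hmeanE := bE.abs_integral_le_lpNorm (P := P) hp1
  have hmeanR : |∫ α, R α ∂P| ≤ (C + C') * h ^ 2 := abs_integral_le_of_abs_le hRle
  refine ⟨lpNorm E p P, hEle, ?_, ?_⟩
  · set w : Ω → Ω → ℝ := fun α β =>
      h * γ * κ * sinSlope (θ t β - θ t α) (θ' t β - θ' t α) with hw
    have hξint : ∫ α, ξ α ∂P = 0 := by
      rw [hξ, integral_sub bδ.integrable (integrable_const _)]
      simp [hc]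
    have hhγκ : 0 ≤ h * γ * κ := by positivity
    have hle1 : h * γ * κ ≤ 1 / 2 := by
      refine le_trans ?_ hh0
      have := mul_le_mul_of_nonneg_left hγM (show 0 ≤ h * κ by positivity)
      linarith
    have hmain := IsBddMeas.lpNorm_add_interaction_le (P := P) hp1 hp' bξ hξint (w := w)
      (w₀ := h * γ * κ * Real.cos ϑ) ((hs.measurable_slope hs' ht).const_mul (h * γ * κ))
      (fun α β => mul_le_mul_of_nonneg_left (cos_le_sinSlope hp.theta_mem.2
        (hs.abs_phase_sub_le hp ht _ _) (hs'.abs_phase_sub_le hp ht _ _)) hhγκ)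
      (fun α β => by
        have := (abs_le.1 (abs_sinSlope_le_one (θ t β - θ t α) (θ' t β - θ' t α))).2
        have := mul_le_mul_of_nonneg_left this hhγκ
        simp only [hw]; linarith)
      (fun α β => by
        simp only [hw]
        rw [← sinSlope_neg, neg_sub, neg_sub])
      (by
        have := mul_le_mul_of_nonneg_left (Real.cos_le_one ϑ) hhγκ
        linarith)
    set T : Ω → ℝ := fun α => ξ α + ∫ β, w α β * (ξ β - ξ α) ∂P with hT
    have hωeq : ∀ α, h * (γ * (ω α - ω' α)) = h * γ * μ α + ∫ β, w α β * (ξ β - ξ α) ∂P := by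
      intro α
      have e1 := hs.drive_sub_drive hs' ht c α
      have e2 : ∫ β, w α β * (ξ β - ξ α) ∂P = h * γ * κ *
          ∫ β, sinSlope (θ t β - θ t α) (θ' t β - θ' t α) *
            ((θ t β - θ' t β - c) - (θ t α - θ' t α - c)) ∂P := by
        rw [← integral_const_mul]
        refine integral_congr_ae (ae_of_all _ fun β => ?_)
        simp only [hw, hξ, hδ]
        ring
      simp only [ω, ω', e2, e1, hμ]
      ring
    -- The new deviation from the mean splits into the centred errors, the forcing by the frequency
    -- difference, and the contracted old deviation T.
    have hξ₁ : (fun α => δ₁ α - ∫ β, δ₁ β ∂P) = fun α => ((h * (E α - ∫ β, E β ∂P) +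
        (R α - ∫ β, R β ∂P)) + h * γ * μ α) + T α := by
      funext α
      rw [hc₁, hδ₁eq, hωeq]
      simp only [hT, hξ]
      ring
    have b1 : IsBddMeas fun α => h * (E α - ∫ β, E β ∂P) := (bE.sub (.const _)).const_mul h
    have b2 : IsBddMeas fun α => R α - ∫ β, R β ∂P := bR.sub (.const _)
    have b3 : IsBddMeas fun α => h * γ * μ α := bμ.const_mul _
    have n1 : lpNorm (fun α => h * (E α - ∫ β, E β ∂P)) p P ≤ h * (2 * lpNorm E p P) := by
      rw [IsBddMeas.lpNorm_const_mul, abs_of_nonneg hh]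
      exact mul_le_mul_of_nonneg_left (bE.lpNorm_sub_mean_le hp1) hh
    have n2 : lpNorm (fun α => R α - ∫ β, R β ∂P) p P ≤ 2 * ((C + C') * h ^ 2) :=
      (bR.lpNorm_sub_mean_le hp1).trans
        (mul_le_mul_of_nonneg_left (IsBddMeas.lpNorm_le_const hp1 hRle) two_pos.le)
    have n3 : lpNorm (fun α => h * γ * μ α) p P = h * γ * lpNorm μ p P := by
      rw [IsBddMeas.lpNorm_const_mul, abs_of_nonneg (by positivity)]
    have l1 := IsBddMeas.lpNorm_add_le (P := P) hp1 ((b1.add b2).add b3) (f' := T)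
    have l2 := IsBddMeas.lpNorm_add_le (P := P) hp1 (b1.add b2) (f' := fun α => h * γ * μ α)
    have l3 := IsBddMeas.lpNorm_add_le (P := P) hp1 b1 (f' := fun α => R α - ∫ β, R β ∂P)
    unfold dispersion
    rw [hξ₁]
    have hξe : lpNorm (fun α => δ α - ∫ β, δ β ∂P) p P = lpNorm ξ p P := rfl
    rw [hξe]
    linarith
  · rw [hc₁]
    have h1 := abs_add_le (c + h * ∫ α, E α ∂P) (∫ α, R α ∂P)
    have h2 := abs_add_le c (h * ∫ α, E α ∂P)
    rw [abs_mul, abs_of_nonneg hh] at h2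
    have h3 := mul_le_mul_of_nonneg_left hmeanE hh
    linarith

/-- Uniform-in-time `L^p` stability of mean-field systems with the same mean frequency. -/
theorem lpNorm_phase_sub_le (hp : IsTrapping Γ g m M K κ ϑ νl νr)
    (hs : IsMeanField Γ κ ϑ νl νr P ν θ) (hs' : IsMeanField Γ κ ϑ νl νr P ν' θ')
    (hmean : ∫ α, ν α ∂P = ∫ α, ν' α ∂P) (hp1 : 1 ≤ p) (hp' : p ≠ ∞) {t : ℝ} (ht : 0 ≤ t) :
    lpNorm (fun α => θ t α - θ' t α) p P ≤
      Real.exp (18 * κ * K * (max |νl| |νr| + κ) / (κ * Real.cos ϑ * m)) *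
      (3 * lpNorm (fun α => θ 0 α - θ' 0 α) p P +
        lpNorm (fun α => ν α - ν' α) p P / (κ * Real.cos ϑ)) := by
  obtain ⟨B, C, hr⟩ := hs.exists_hasRates hp
  obtain ⟨B', C', hr'⟩ := hs'.exists_hasRates hp
  have hκ := hp.coupling_pos
  have hM := hp.upper_pos
  have hm := hp.lower_pos
  have hcos := hp.cos_pos
  have hK := hp.lipschitz_nonneg
  set Y := max |νl| |νr| + κ with hY
  have hY0 : 0 ≤ Y := by positivity
  set l := κ * Real.cos ϑ * m with hl
  have hl0 : 0 < l := by positivity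
  set γ := g (∫ α, ν α ∂P) with hγ
  have hγ0 : 0 < γ := hm.trans_le (hp.lower _)
  have hγM : γ ≤ M := hp.upper _
  set a := lpNorm (fun α => ν α - ν' α) p P with ha
  set A := a / (κ * Real.cos ϑ) with hA
  have hA0 : 0 ≤ A := div_nonneg lpNorm_nonneg (by positivity)
  have haA : a = κ * Real.cos ϑ * A := by rw [hA]; field_simp
  set δ : ℝ → Ω → ℝ := fun t α => θ t α - θ' t α with hδ
  have bδ : ∀ t, 0 ≤ t → IsBddMeas (δ t) := fun t ht =>
    (hs.isBddMeas_phase hp ht).sub (hs'.isBddMeas_phase hp ht)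
  set N : ℝ → ℝ := fun t => dispersion p P (δ t) with hN
  have hN0 : ∀ t, 0 ≤ N t := fun t => lpNorm_nonneg
  -- Up to errors the dispersion obeys N' ≤ -γ κ cos ϑ N + γ a, whose equilibrium is A = a / (κ cos
  -- ϑ), independent of γ. Replacing N by max N A removes the forcing, and only the integrable error
  -- rate is left for Grönwall's inequality.
  set W : ℝ → ℝ := fun t => max (N t) A + |∫ α, δ t α ∂P| with hW
  -- The error e counts twice for the dispersion and once for the mean, and e is at most 6 κ K Y
  -- exp(-l t) W, whence 18. The function β is a primitive of the rate, whose integral over [0, ∞)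
  -- is 18 κ K Y / l.
  have key := le_mul_exp_of_step (f := W)
    (b := fun t => 18 * κ * K * Y * Real.exp (-l * t))
    (β := fun t => -(18 * κ * K * Y / l) * Real.exp (-l * t))
    (C := 3 * (C + C')) (C' := 3 * (B + B')) (h₀ := (2 * κ * M)⁻¹) (by positivity) ?_ ?_ ?_ ht
  · have h1 : lpNorm (δ t) p P ≤ W t := by
      have := IsBddMeas.lpNorm_add_const_le (P := P) hp1 (∫ α, δ t α ∂P)
        ((bδ t ht).sub (.const (∫ α, δ t α ∂P)))
      simp only [sub_add_cancel] at this
      refine this.trans (add_le_add (le_max_left _ _) le_rfl)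
    have h2 : W 0 ≤ 3 * lpNorm (δ 0) p P + A := by
      have h3 : N 0 ≤ 2 * lpNorm (δ 0) p P := (bδ 0 le_rfl).lpNorm_sub_mean_le hp1
      have h4 := (bδ 0 le_rfl).abs_integral_le_lpNorm (P := P) hp1
      have h5 : max (N 0) A ≤ N 0 + A := max_le_add_of_nonneg (hN0 0) hA0
      simp only [hW]
      linarith
    have h3 : 0 ≤ W 0 := add_nonneg (le_max_of_le_right hA0) (abs_nonneg _)
    refine h1.trans (key.trans ?_)
    rw [mul_comm]
    refine mul_le_mul (Real.exp_le_exp.2 ?_) h2 h3 (Real.exp_pos _).le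
    have h4 : 0 ≤ 18 * κ * K * Y / l := by positivity
    have h5 := mul_nonneg h4 (Real.exp_pos (-l * t)).le
    simp only [mul_zero, Real.exp_zero, mul_one]
    linarith
  · intro t ht h hh
    have ht' : 0 ≤ t + h := by linarith
    have hd : ∀ α, |δ (t + h) α - δ t α| ≤ (B + B') * h := fun α => by
      have h1 := abs_le.1 (hr.speed t ht h hh α)
      have h2 := abs_le.1 (hr'.speed t ht h hh α)
      rw [abs_le]
      constructor <;> simp only [hδ] <;> linarith
    have hmean1 : |(∫ α, δ (t + h) α ∂P) - ∫ α, δ t α ∂P| ≤ (B + B') * h := by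
      rw [← integral_sub (bδ _ ht').integrable (bδ _ ht).integrable]
      exact abs_integral_le_of_abs_le hd
    have hm1 := abs_le.1 hmean1
    have hdiff : ∀ α, |(δ (t + h) α - ∫ β, δ (t + h) β ∂P) - (δ t α - ∫ β, δ t β ∂P)| ≤
        2 * (B + B') * h := fun α => by
      have h1 := abs_le.1 (hd α)
      rw [abs_le]
      constructor <;> linarith
    have bξ : ∀ t, 0 ≤ t → IsBddMeas fun α => δ t α - ∫ β, δ t β ∂P := fun t ht =>
      (bδ t ht).sub (.const _)
    have hNle : |N (t + h) - N t| ≤ 2 * (B + B') * h := by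
      have h1 := IsBddMeas.lpNorm_add_le (P := P) hp1 (bξ t ht) (f' := fun α =>
        (δ (t + h) α - ∫ β, δ (t + h) β ∂P) - (δ t α - ∫ β, δ t β ∂P))
      have h2 := IsBddMeas.lpNorm_add_le (P := P) hp1 (bξ _ ht') (f' := fun α =>
        (δ t α - ∫ β, δ t β ∂P) - (δ (t + h) α - ∫ β, δ (t + h) β ∂P))
      simp only [add_sub_cancel] at h1 h2
      have h3 := IsBddMeas.lpNorm_le_const (P := P) hp1 hdiff
      have h4 := IsBddMeas.lpNorm_le_const (P := P) hp1
        (fun α => (abs_sub_comm _ _).trans_le (hdiff α))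
      have e1 : N (t + h) = lpNorm (fun α => δ (t + h) α - ∫ β, δ (t + h) β ∂P) p P := rfl
      have e2 : N t = lpNorm (fun α => δ t α - ∫ β, δ t β ∂P) p P := rfl
      rw [abs_le, e1, e2]
      constructor <;> linarith
    have h5 : |max (N (t + h)) A - max (N t) A| ≤ |N (t + h) - N t| :=
      abs_max_sub_max_le_abs _ _ _
    have h6 := abs_abs_sub_abs_le (∫ α, δ (t + h) α ∂P) (∫ α, δ t α ∂P)
    have h7 := abs_le.1 (h5.trans hNle)
    have h8 := abs_le.1 (h6.trans hmean1)
    rw [abs_le]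
    constructor <;> simp only [hW] <;> linarith
  · intro t ht h hh hh0
    have hh1 : κ * M * h ≤ 1 / 2 := by
      have := mul_le_mul_of_nonneg_left hh0 (show 0 ≤ κ * M by positivity)
      refine this.trans (le_of_eq ?_)
      field_simp
    obtain ⟨e, he, hdisp, hmn⟩ := hs.dispersion_step hp hs' hmean hp1 hp' hr hr' ht hh hh1
    set X := Real.exp (-l * t) with hX
    have hX0 : 0 < X := Real.exp_pos _
    have hWN : max (N t) A ≤ W t := le_add_of_nonneg_right (abs_nonneg _)
    have he2 : e ≤ 6 * κ * K * Y * X * W t := by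
      refine he.trans ?_
      have h1 : a + 2 * κ * N t ≤ 3 * κ * W t := by
        have h2 : κ * Real.cos ϑ * A ≤ κ * A := by
          have := mul_le_mul_of_nonneg_left (Real.cos_le_one ϑ) (mul_nonneg hκ.le hA0)
          linarith
        have h3 := mul_le_mul_of_nonneg_left ((le_max_right (N t) A).trans hWN) hκ.le
        have h4 := mul_le_mul_of_nonneg_left ((le_max_left (N t) A).trans hWN) hκ.le
        linarith
      have h5 := mul_le_mul_of_nonneg_left h1 (show 0 ≤ K * (2 * Y * X) by positivity)
      refine h5.trans (le_of_eq ?_)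
      ring
    have hw0 : 0 ≤ h * (γ * κ * Real.cos ϑ) := by positivity
    have hw1 : h * (γ * κ * Real.cos ϑ) ≤ 1 := by
      have h1 : γ * κ * Real.cos ϑ ≤ M * κ * 1 :=
        mul_le_mul (mul_le_mul_of_nonneg_right hγM hκ.le) (Real.cos_le_one _) hcos.le
          (by positivity)
      have := mul_le_mul_of_nonneg_left h1 hh
      linarith
    -- Because a = κ cos ϑ A, the left-hand side is a convex combination of N t and A.
    have hconv : (1 - h * (γ * κ * Real.cos ϑ)) * N t + h * (γ * a) ≤ max (N t) A := by
      have h1 := mul_le_mul_of_nonneg_left (le_max_left (N t) A) (sub_nonneg.2 hw1)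
      have h2 := mul_le_mul_of_nonneg_left (le_max_right (N t) A) hw0
      rw [haA]
      linarith
    have he0 : h * e ≤ h * (6 * κ * K * Y * X * W t) := mul_le_mul_of_nonneg_left he2 hh
    have hW0 : 0 ≤ W t := (le_max_of_le_right hA0).trans hWN
    have hCC : 0 ≤ (C + C') * h ^ 2 := mul_nonneg (add_nonneg hr.nonneg_C hr'.nonneg_C) (sq_nonneg _)
    have hmax : max (N (t + h)) A ≤
        max (N t) A + 2 * (h * (6 * κ * K * Y * X * W t)) + 2 * (C + C') * h ^ 2 := by
      refine max_le ?_ ?_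
      · have : N (t + h) ≤ _ := hdisp
        linarith
      · have h1 := le_max_right (N t) A
        have h2 : 0 ≤ h * (6 * κ * K * Y * X * W t) := by positivity
        linarith
    simp only [hW] at *
    linarith
  · intro t
    have h1 : HasDerivAt (fun t : ℝ => -l * t) (-l) t := by
      simpa using (hasDerivAt_id t).const_mul (-l)
    have h2 := h1.exp.const_mul (-(18 * κ * K * Y / l))
    refine h2.congr_deriv ?_
    field_simp

end IsMeanField

end GKuramoto

namespace GKuramoto

/-! ### The phase space and test functions -/

instance : Fact (0 < 2 * Real.pi) := ⟨Real.two_pi_pos⟩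

/-- The covering map `ℝ × ℝ → 𝕋 × ℝ`. -/
noncomputable def toPhase (z : ℝ × ℝ) : Phase := ((z.1 : Torus), z.2)

theorem isOpenQuotientMap_toPhase : IsOpenQuotientMap toPhase :=
  (QuotientAddGroup.isOpenQuotientMap_mk).prodMap IsOpenQuotientMap.id

theorem continuous_toPhase : Continuous toPhase := isOpenQuotientMap_toPhase.continuous

theorem measurable_toPhase : Measurable toPhase := continuous_toPhase.measurable

theorem continuous_of_comp_toPhase {X : Type*} [TopologicalSpace X] {f : Phase → X}
    (hf : Continuous fun z => f (toPhase z)) : Continuous f :=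
  isOpenQuotientMap_toPhase.isQuotientMap.continuous_iff.2 hf

@[simp] theorem torusSin_coe (x : ℝ) : torusSin (x : Torus) = Real.sin x :=
  Real.sin_periodic.lift_coe x

theorem continuous_torusSin : Continuous torusSin :=
  QuotientAddGroup.isOpenQuotientMap_mk.isQuotientMap.continuous_iff.2 Real.continuous_sin

theorem abs_torusSin_le_one (x : Torus) : |torusSin x| ≤ 1 := by
  induction x using QuotientAddGroup.induction_on with
  | H x => exact (torusSin_coe x).symm ▸ Real.abs_sin_le_one x

theorem continuous_mean_torusSin (ρ : Measure Phase) [IsProbabilityMeasure ρ] :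
    Continuous fun x : Torus => ∫ w, torusSin (w.1 - x) ∂ρ := by
  refine continuous_of_dominated (bound := fun _ => 1) (fun x => ?_)
    (fun x => ae_of_all _ fun w => abs_torusSin_le_one _) (integrable_const _)
    (ae_of_all _ fun w => continuous_torusSin.comp (continuous_const.sub continuous_id))
  exact (continuous_torusSin.comp (continuous_fst.sub continuous_const)).aestronglyMeasurable

theorem continuous_velocity {L : EReal} {F : ℝ → ℝ} (hF : IsResponse L F) (κ : ℝ)
    (ρ : Measure Phase) [IsProbabilityMeasure ρ] : Continuous (velocity L F κ ρ) :=
  hF.inverse_continuous.comp (continuous_snd.add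
    (((continuous_mean_torusSin ρ).comp continuous_fst).const_mul κ))

/-- The lift of a function on `ℝ × (𝕋 × ℝ)`. -/
noncomputable def liftFun (φ : ℝ × Phase → ℝ) (p : ℝ × ℝ × ℝ) : ℝ := φ (p.1, toPhase p.2)

theorem hasFDerivAt_liftFun {φ : ℝ × Phase → ℝ} (hφ : ContDiff ℝ 1 (liftFun φ)) (p : ℝ × ℝ × ℝ) :
    HasFDerivAt (liftFun φ) (fderiv ℝ (liftFun φ) p) p :=
  (hφ.differentiable one_ne_zero p).hasFDerivAt

theorem dTime_toPhase {φ : ℝ × Phase → ℝ} (hφ : ContDiff ℝ 1 (liftFun φ)) (s : ℝ) (z : ℝ × ℝ) :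
    dTime φ (s, toPhase z) = fderiv ℝ (liftFun φ) (s, z) (1, 0, 0) := by
  have h1 : HasDerivAt (fun r : ℝ => ((r, z) : ℝ × ℝ × ℝ)) (1, 0, 0) s :=
    (hasDerivAt_id s).prodMk (hasDerivAt_const s z)
  exact ((hasFDerivAt_liftFun hφ (s, z)).comp_hasDerivAt s h1).deriv

theorem dPhase_toPhase {φ : ℝ × Phase → ℝ} (hφ : ContDiff ℝ 1 (liftFun φ)) (s : ℝ) (z : ℝ × ℝ) :
    dPhase φ (s, toPhase z) = fderiv ℝ (liftFun φ) (s, z) (0, 1, 0) := by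
  have h1 : HasDerivAt (fun r : ℝ => ((s, z.1 + r, z.2) : ℝ × ℝ × ℝ)) (0, 1, 0) 0 :=
    (hasDerivAt_const _ s).prodMk
      (((hasDerivAt_id (0 : ℝ)).const_add z.1).prodMk (hasDerivAt_const _ z.2))
  have h2 : HasFDerivAt (liftFun φ) (fderiv ℝ (liftFun φ) (s, z)) (s, z.1 + 0, z.2) := by
    rw [add_zero]; exact hasFDerivAt_liftFun hφ (s, z)
  have h3 := (h2.comp_hasDerivAt (0 : ℝ) h1).deriv
  rw [← h3]
  unfold dPhase
  congr 1

theorem IsTestFunction.contDiff_liftFun {φ : ℝ × Phase → ℝ} (hφ : IsTestFunction φ) :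
    ContDiff ℝ 1 (liftFun φ) := hφ.contDiff

/-- The integrand of the weak form is the derivative of the test function in the direction of the
characteristic. This turns the weak equation into the chain rule along trajectories. -/
theorem weakIntegrand_toPhase {φ : ℝ × Phase → ℝ} (hφ : ContDiff ℝ 1 (liftFun φ)) (L : EReal)
    (F : ℝ → ℝ) (κ : ℝ) (ρ : Measure Phase) (s : ℝ) (z : ℝ × ℝ) :
    weakIntegrand L F κ ρ φ s (toPhase z) =
      fderiv ℝ (liftFun φ) (s, z) (1, velocity L F κ ρ (toPhase z), 0) := by
  rw [weakIntegrand, dTime_toPhase hφ, dPhase_toPhase hφ, ← smul_eq_mul, ← map_smul, ← map_add]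
  simp

theorem continuous_weakIntegrand {φ : ℝ × Phase → ℝ} (hφ : ContDiff ℝ 1 (liftFun φ)) {L : EReal}
    {F : ℝ → ℝ} (hF : IsResponse L F) (κ : ℝ) (ρ : Measure Phase) [IsProbabilityMeasure ρ]
    (s : ℝ) : Continuous (weakIntegrand L F κ ρ φ s) := by
  refine continuous_of_comp_toPhase ?_
  simp_rw [weakIntegrand_toPhase hφ]
  have h1 : Continuous fun z : ℝ × ℝ => fderiv ℝ (liftFun φ) (s, z) :=
    (hφ.continuous_fderiv one_ne_zero).comp (continuous_const.prodMk continuous_id)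
  have h2 : Continuous fun z : ℝ × ℝ => ((1, velocity L F κ ρ (toPhase z), 0) : ℝ × ℝ × ℝ) :=
    continuous_const.prodMk ((((continuous_velocity hF κ ρ).comp continuous_toPhase)).prodMk
      continuous_const)
  exact h1.clm_apply h2

/-! ### The law of a mean-field system -/

variable {Ω : Type*} [MeasurableSpace Ω]

/-- The distribution on `𝕋 × ℝ` of the phases `θ` and natural frequencies `ν`. -/
noncomputable def law (P : Measure Ω) (θ ν : Ω → ℝ) : Measure Phase :=
  P.map fun α => toPhase (θ α, ν α)

theorem measurable_toPhase_pair {θ ν : Ω → ℝ} (hθ : Measurable θ) (hν : Measurable ν) :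
    Measurable fun α => toPhase (θ α, ν α) := measurable_toPhase.comp (hθ.prodMk hν)

theorem integral_law {P : Measure Ω} {θ ν : Ω → ℝ} (hθ : Measurable θ)
    (hν : Measurable ν) {f : Phase → ℝ} (hf : Continuous f) :
    ∫ z, f z ∂law P θ ν = ∫ α, f (toPhase (θ α, ν α)) ∂P :=
  integral_map (measurable_toPhase_pair hθ hν).aemeasurable hf.aestronglyMeasurable

theorem velocity_law {P : Measure Ω} {θ ν : Ω → ℝ} (hθ : Measurable θ) (hν : Measurable ν)
    (L : EReal) (F : ℝ → ℝ) (κ : ℝ) (x v : ℝ) :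
    velocity L F κ (law P θ ν) (toPhase (x, v)) =
      inverse L F (v + κ * ∫ β, Real.sin (θ β - x) ∂P) := by
  unfold velocity
  rw [integral_law hθ hν (f := fun w : Phase => torusSin (w.1 - (toPhase (x, v)).1))
    (continuous_torusSin.comp (continuous_fst.sub continuous_const))]
  have : ∀ β, torusSin ((toPhase (θ β, ν β)).1 - (toPhase (x, v)).1) = Real.sin (θ β - x) :=
    fun β => torusSin_coe (θ β - x)
  simp_rw [this]
  rfl

theorem drive_mem {κ νl νr : ℝ} (hκ : 0 ≤ κ) {P : Measure Ω} [IsProbabilityMeasure P]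
    {ν : Ω → ℝ} (hν : ∀ α, ν α ∈ Icc νl νr) (θ : Ω → ℝ) (α : Ω) :
    drive κ P ν θ α ∈ Icc (νl - κ) (νr + κ) := by
  have h : |κ * ∫ β, Real.sin (θ β - θ α) ∂P| ≤ κ := by
    rw [abs_mul, abs_of_nonneg hκ]
    exact mul_le_of_le_one_right hκ (abs_integral_le_of_abs_le fun β => Real.abs_sin_le_one _)
  rw [abs_le] at h
  unfold drive
  exact ⟨by linarith [(hν α).1], by linarith [(hν α).2]⟩

variable {L : EReal} {F : ℝ → ℝ} {Γ g : ℝ → ℝ} {m M K κ ϑ νl νr : ℝ} {P : Measure Ω}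
  [IsProbabilityMeasure P] {ν : Ω → ℝ} {θ : ℝ → Ω → ℝ}

namespace IsMeanField

theorem isProbabilityMeasure_law (hs : IsMeanField Γ κ ϑ νl νr P ν θ) {t : ℝ} (ht : 0 ≤ t) :
    IsProbabilityMeasure (law P (θ t) ν) :=
  Measure.isProbabilityMeasure_map
    (measurable_toPhase_pair (hs.measurable_phase t ht) hs.measurable_freq).aemeasurable

theorem velocity_eq (hp : IsTrapping Γ g m M K κ ϑ νl νr) (hs : IsMeanField Γ κ ϑ νl νr P ν θ)
    (hΓ : ∀ y ∈ Icc (νl - κ) (νr + κ), Γ y = inverse L F y) {t : ℝ} (ht : 0 ≤ t) (α : Ω) :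
    velocity L F κ (law P (θ t) ν) (toPhase (θ t α, ν α)) = Γ (drive κ P ν (θ t) α) := by
  rw [velocity_law (hs.measurable_phase t ht) hs.measurable_freq,
    hΓ _ (drive_mem hp.coupling_pos.le hs.freq_mem _ _)]
  rfl

theorem continuousOn_phase (hs : IsMeanField Γ κ ϑ νl νr P ν θ) (α : Ω) :
    ContinuousOn (fun t => θ t α) (Ici 0) :=
  fun t ht => (hs.hasDerivAt t ht α).continuousAt.continuousWithinAt

theorem continuousOn_drive (hs : IsMeanField Γ κ ϑ νl νr P ν θ) (α : Ω) :
    ContinuousOn (fun t => drive κ P ν (θ t) α) (Ici 0) := by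
  refine continuousOn_const.add (continuousOn_const.mul ?_)
  refine continuousOn_of_dominated (bound := fun _ => 1)
    (fun t ht => (integrable_sin (hs.measurable_phase t ht) _).aestronglyMeasurable)
    (fun t _ => ae_of_all _ fun β => Real.abs_sin_le_one _) (integrable_const _)
    (ae_of_all _ fun β => Real.continuous_sin.comp_continuousOn
      ((hs.continuousOn_phase β).sub (hs.continuousOn_phase α)))

/-- The laws of a mean-field system form a measure-valued solution of the kinetic equation. -/
theorem isMeasureSolution (hF : IsResponse L F) (hp : IsTrapping Γ g m M K κ ϑ νl νr)
    (hs : IsMeanField Γ κ ϑ νl νr P ν θ)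
    (hΓ : ∀ y ∈ Icc (νl - κ) (νr + κ), Γ y = inverse L F y) :
    IsMeasureSolution L F κ fun t => law P (θ t) ν := by
  obtain ⟨B, C, hr⟩ := hs.exists_hasRates hp
  have hprob : ∀ t, 0 ≤ t → IsProbabilityMeasure (law P (θ t) ν) :=
    fun t ht => hs.isProbabilityMeasure_law ht
  -- Up to time T all lifted trajectories stay in one compact box, so a test function and its
  -- derivative are bounded there uniformly in the label. This supplies every dominating constant
  -- below.
  have hmem : ∀ T : ℝ, ∀ s ∈ Icc 0 T, ∀ α, ((s, θ s α, ν α) : ℝ × ℝ × ℝ) ∈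
      Icc 0 T ×ˢ Icc (-(ϑ + B * T)) (ϑ + B * T) ×ˢ Icc νl νr := by
    intro T s hs' α
    refine ⟨hs', ?_, hs.freq_mem α⟩
    have h1 := hr.speed 0 le_rfl s hs'.1 α
    rw [zero_add] at h1
    have h2 := hs.init_mem α
    have h3 := mul_le_mul_of_nonneg_left hs'.2 hr.nonneg_B
    rw [abs_le] at h1
    constructor <;> simp only <;> linarith [h2.1, h2.2, hp.theta_mem.1]
  have hcpt : ∀ T : ℝ, IsCompact (Icc 0 T ×ˢ Icc (-(ϑ + B * T)) (ϑ + B * T) ×ˢ Icc νl νr) :=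
    fun T => isCompact_Icc.prod (isCompact_Icc.prod isCompact_Icc)
  have hcurve : ∀ α, ContinuousOn (fun s => ((s, θ s α, ν α) : ℝ × ℝ × ℝ)) (Ici 0) := fun α =>
    continuousOn_id.prodMk ((hs.continuousOn_phase α).prodMk continuousOn_const)
  have hmeas : ∀ s, 0 ≤ s → Measurable fun α => ((s, θ s α, ν α) : ℝ × ℝ × ℝ) := fun s hs' =>
    measurable_const.prodMk ((hs.measurable_phase s hs').prodMk hs.measurable_freq)
  set H : (ℝ × Phase → ℝ) → ℝ → Ω → ℝ := fun φ s α =>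
    fderiv ℝ (liftFun φ) (s, θ s α, ν α) (1, Γ (drive κ P ν (θ s) α), 0) with hH
  have hHmeas : ∀ φ, IsTestFunction φ → ∀ s, 0 ≤ s → Measurable (H φ s) := by
    intro φ hφ s hs'
    have h1 : Continuous fun q : (ℝ × ℝ × ℝ) × ℝ =>
        fderiv ℝ (liftFun φ) q.1 ((1, q.2, 0) : ℝ × ℝ × ℝ) :=
      ((hφ.contDiff_liftFun.continuous_fderiv one_ne_zero).comp continuous_fst).clm_apply
        (continuous_const.prodMk (continuous_snd.prodMk continuous_const))
    exact h1.measurable.comp ((hmeas s hs').prodMk (hs.isBddMeas_velocity hp hs').1)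
  have hHcont : ∀ φ, IsTestFunction φ → ∀ α, ContinuousOn (fun s => H φ s α) (Ici 0) := by
    intro φ hφ α
    exact ((hφ.contDiff_liftFun.continuous_fderiv one_ne_zero).comp_continuousOn
      (hcurve α)).clm_apply (continuousOn_const.prodMk ((hp.continuous.comp_continuousOn
        (hs.continuousOn_drive α)).prodMk continuousOn_const))
  have hHbdd : ∀ φ, IsTestFunction φ → ∀ T : ℝ, ∃ c, ∀ s ∈ Icc 0 T, ∀ α, |H φ s α| ≤ c := by
    intro φ hφ T
    obtain ⟨c, hc⟩ := (hcpt T).exists_bound_of_continuousOn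
      (hφ.contDiff_liftFun.continuous_fderiv one_ne_zero).continuousOn
    refine ⟨c * max 1 B, fun s hs' α => ?_⟩
    have h1 := hc _ (hmem T s hs' α)
    refine (ContinuousLinearMap.le_opNorm _ _).trans
      (mul_le_mul h1 ?_ (norm_nonneg _) ((norm_nonneg _).trans h1))
    simp only [Prod.norm_def, norm_one, norm_zero, Real.norm_eq_abs]
    refine max_le (le_max_left _ _) (max_le ?_ (zero_le_one.trans (le_max_left _ _)))
    exact (hr.abs_velocity_le s hs'.1 α).trans (le_max_right _ _)
  have hint : ∀ φ, IsTestFunction φ → ∀ s, 0 ≤ s →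
      ∫ z, weakIntegrand L F κ (law P (θ s) ν) φ s z ∂law P (θ s) ν = ∫ α, H φ s α ∂P := by
    intro φ hφ s hs'
    have := hprob s hs'
    rw [integral_law (hs.measurable_phase s hs') hs.measurable_freq
      (continuous_weakIntegrand hφ.contDiff_liftFun hF κ _ s)]
    simp_rw [weakIntegrand_toPhase hφ.contDiff_liftFun, hs.velocity_eq hp hΓ hs']
    rfl
  have hintcont : ∀ φ, IsTestFunction φ → ∀ T,
      ContinuousOn (fun s => ∫ α, H φ s α ∂P) (Icc 0 T) := by
    intro φ hφ T
    obtain ⟨c, hc⟩ := hHbdd φ hφ T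
    exact continuousOn_of_dominated (bound := fun _ => c)
      (fun s hs' => (hHmeas φ hφ s hs'.1).aestronglyMeasurable)
      (fun s hs' => ae_of_all _ (hc s hs')) (integrable_const _)
      (ae_of_all _ fun α => (hHcont φ hφ α).mono Icc_subset_Ici_self)
  have hII : ∀ φ, IsTestFunction φ → ∀ t, 0 ≤ t →
      IntervalIntegrable (fun s => ∫ α, H φ s α ∂P) volume 0 t := fun φ hφ t ht =>
    ContinuousOn.intervalIntegrable (by rw [uIcc_of_le ht]; exact hintcont φ hφ t)
  refine ⟨hprob, fun G => ?_, fun φ hφ s hs' => ?_, fun φ hφ t ht => ?_, fun φ hφ t ht => ?_⟩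
  · obtain ⟨c, hc⟩ := G.toBCF.isBounded_range.exists_norm_le
    have h1 : ContinuousOn (fun t => ∫ α, G (toPhase (θ t α, ν α)) ∂P) (Ici 0) := by
      refine continuousOn_of_dominated (bound := fun _ => c) (fun t ht => ?_)
        (fun t _ => ae_of_all _ fun α => hc _ ⟨_, rfl⟩) (integrable_const _)
        (ae_of_all _ fun α => ?_)
      · exact (G.continuous.measurable.comp (measurable_toPhase_pair
          (hs.measurable_phase t ht) hs.measurable_freq)).aestronglyMeasurable
      · exact (G.continuous.comp continuous_toPhase).comp_continuousOn
          ((hs.continuousOn_phase α).prodMk continuousOn_const)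
    refine h1.congr fun t ht => ?_
    exact integral_law (hs.measurable_phase t ht) hs.measurable_freq G.continuous
  · have := hprob s hs'
    have hc := continuous_weakIntegrand hφ.contDiff_liftFun hF κ (law P (θ s) ν) s
    refine (integrable_map_measure hc.aestronglyMeasurable (measurable_toPhase_pair
      (hs.measurable_phase s hs') hs.measurable_freq).aemeasurable).2 ?_
    obtain ⟨c, hc⟩ := hHbdd φ hφ s
    refine (integrable_of_abs_le (hHmeas φ hφ s hs') (hc s ⟨hs', le_rfl⟩)).congr
      (ae_of_all _ fun α => ?_)
    simp only [Function.comp, weakIntegrand_toPhase hφ.contDiff_liftFun,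
      hs.velocity_eq hp hΓ hs', hH]
  · refine (hII φ hφ t ht).congr fun s hs' => ?_
    rw [uIoc_of_le ht] at hs'
    exact (hint φ hφ s hs'.1.le).symm
  · have e1 : ∫ s in (0 : ℝ)..t, ∫ z, weakIntegrand L F κ (law P (θ s) ν) φ s z ∂law P (θ s) ν =
        ∫ s in (0 : ℝ)..t, ∫ α, H φ s α ∂P := by
      refine intervalIntegral.integral_congr fun s hs' => ?_
      rw [uIcc_of_le ht] at hs'
      exact hint φ hφ s hs'.1
    have hφc : ∀ s, Continuous fun z : Phase => φ (s, z) := fun s => by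
      refine continuous_of_comp_toPhase ?_
      exact hφ.contDiff_liftFun.continuous.comp (continuous_const.prodMk continuous_id)
    have e2 : ∀ s, 0 ≤ s →
        ∫ z, φ (s, z) ∂law P (θ s) ν = ∫ α, liftFun φ (s, θ s α, ν α) ∂P := fun s hs' =>
      integral_law (hs.measurable_phase s hs') hs.measurable_freq (hφc s)
    rw [e1, e2 t ht, e2 0 le_rfl]
    obtain ⟨c, hc⟩ := (hcpt t).exists_bound_of_continuousOn
      hφ.contDiff_liftFun.continuous.continuousOn
    obtain ⟨c', hc'⟩ := hHbdd φ hφ t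
    have hm : ∀ s, 0 ≤ s → AEStronglyMeasurable (fun α => liftFun φ (s, θ s α, ν α)) P :=
      fun s hs' => (hφ.contDiff_liftFun.continuous.measurable.comp
        (hmeas s hs')).aestronglyMeasurable
    have hderiv : ∀ s, 0 ≤ s → ∀ α,
        HasDerivAt (fun r => liftFun φ (r, θ r α, ν α)) (H φ s α) s := by
      intro s hs' α
      have h1 : HasDerivAt (fun r => ((r, θ r α, ν α) : ℝ × ℝ × ℝ))
          (1, Γ (drive κ P ν (θ s) α), 0) s :=
        (hasDerivAt_id s).prodMk ((hs.hasDerivAt s hs' α).prodMk (hasDerivAt_const s (ν α)))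
      exact (hasFDerivAt_liftFun hφ.contDiff_liftFun (s, θ s α, ν α)).comp_hasDerivAt s h1
    -- The weak form is the fundamental theorem of calculus for the label average of φ along
    -- trajectories, differentiated under the integral.
    refine (intervalIntegral.integral_eq_sub_of_hasDerivAt_of_le ht
      (f := fun s => ∫ α, liftFun φ (s, θ s α, ν α) ∂P) ?_ (fun s hs' => ?_)
      (hII φ hφ t ht)).symm
    · exact continuousOn_of_dominated (bound := fun _ => c) (fun s hs' => hm s hs'.1)
        (fun s hs' => ae_of_all _ fun α => hc _ (hmem t s hs' α)) (integrable_const _)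
        (ae_of_all _ fun α => hφ.contDiff_liftFun.continuous.comp_continuousOn
          ((hcurve α).mono Icc_subset_Ici_self))
    · refine (hasDerivAt_integral_of_dominated_loc_of_deriv_le (bound := fun _ => c')
        (s := Ioo 0 t) (isOpen_Ioo.mem_nhds hs') ?_ ?_ ?_ ?_ (integrable_const _) ?_).2
      · filter_upwards [isOpen_Ioo.mem_nhds hs'] with r hr' using hm r hr'.1.le
      · exact Integrable.of_bound (hm s hs'.1.le) c
          (ae_of_all _ fun α => hc _ (hmem t s ⟨hs'.1.le, hs'.2.le⟩ α))
      · exact (hHmeas φ hφ s hs'.1.le).aestronglyMeasurable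
      · exact ae_of_all _ fun α r hr' => hc' r ⟨hr'.1.le, hr'.2.le⟩ α
      · exact ae_of_all _ fun α r hr' => hderiv r hr'.1.le α

end IsMeanField

end GKuramoto

namespace GKuramoto

/-! ### Existence of mean-field systems -/

/-- A bounded, Lipschitz vector field on a Banach space has global integral curves. -/
theorem exists_forall_hasDerivAt {E : Type*} [NormedAddCommGroup E] [NormedSpace ℝ E]
    [CompleteSpace E] {v : ℝ → E → E} {K B : NNReal} (hlip : ∀ t, LipschitzWith K (v t))
    (hcont : ∀ x, Continuous fun t => v t x) (hb : ∀ t x, ‖v t x‖ ≤ B) (t₀ : ℝ) (x₀ : E) :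
    ∃ x : ℝ → E, x t₀ = x₀ ∧ ∀ t, HasDerivAt x (v t (x t)) t := by
  have hloc : ∀ n : ℕ, ∃ x : ℝ → E, x t₀ = x₀ ∧
      ∀ t ∈ Ioo (t₀ - (n + 1)) (t₀ + (n + 1)), HasDerivAt x (v t (x t)) t := by
    intro n
    have hn : (0 : ℝ) < n + 1 := by positivity
    -- At speed at most B a curve moves no farther than B(n + 1) in this time, so with a ball of
    -- this radius no smallness of the time interval is needed.
    have hpl : IsPicardLindelof v (tmin := t₀ - (n + 1)) (tmax := t₀ + (n + 1))
        ⟨t₀, by constructor <;> linarith⟩ x₀ (B * (n + 1)) 0 B K :=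
      { lipschitzOnWith := fun t _ => (hlip t).lipschitzOnWith
        continuousOn := fun x _ => (hcont x).continuousOn
        norm_le := fun t _ x _ => hb t x
        mul_max_le := by simp }
    obtain ⟨x, hx0, hx⟩ := hpl.exists_eq_forall_mem_Icc_hasDerivWithinAt₀
    exact ⟨x, hx0, fun t ht =>
      (hx t (Ioo_subset_Icc_self ht)).hasDerivAt (Icc_mem_nhds ht.1 ht.2)⟩
  choose x hx0 hx using hloc
  have hmem : ∀ (n : ℕ) (t : ℝ), |t - t₀| < n + 1 → t ∈ Ioo (t₀ - ((n : ℝ) + 1)) (t₀ + (n + 1)) := by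
    intro n t h
    rw [abs_lt] at h
    constructor <;> linarith
  have hmono : ∀ (n k : ℕ), n ≤ k → ∀ t : ℝ, |t - t₀| < n + 1 → x n t = x k t := by
    intro n k hnk t h1
    have hnk' : (n : ℝ) ≤ k := Nat.cast_le.2 hnk
    refine ODE_solution_unique_of_mem_Ioo (s := fun _ => univ) (v := v) (K := K)
      (a := t₀ - (n + 1)) (b := t₀ + (n + 1)) (t₀ := t₀)
      (fun t _ => (hlip t).lipschitzOnWith) (hmem n t₀ (by simp; positivity))
      (fun s hs => ⟨hx n s hs, mem_univ _⟩) (fun s hs => ⟨hx k s ?_, mem_univ _⟩)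
      ((hx0 n).trans (hx0 k).symm) (hmem n t h1)
    exact ⟨by linarith [hs.1], by linarith [hs.2]⟩
  have hagree : ∀ (n k : ℕ) (t : ℝ), |t - t₀| < n + 1 → |t - t₀| < k + 1 → x n t = x k t := by
    intro n k t h1 h2
    rcases le_total n k with h | h
    · exact hmono n k h t h1
    · exact (hmono k n h t h2).symm
  -- The local solutions agree where they overlap, so at each time any one whose interval is long
  -- enough may be used.
  refine ⟨fun t => x ⌈|t - t₀|⌉₊ t, by simp [hx0], fun t => ?_⟩
  set n := ⌈|t - t₀|⌉₊ with hn
  have ht : |t - t₀| < n + 1 := (Nat.le_ceil _).trans_lt (lt_add_one _)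
  refine (hx n t (hmem n t ht)).congr_of_eventuallyEq ?_
  have hc : Continuous fun s : ℝ => |s - t₀| := by fun_prop
  filter_upwards [(hc.continuousAt (x := t)).eventually_lt_const ht] with s hs
  exact hagree _ _ s ((Nat.le_ceil _).trans_lt (lt_add_one _)) hs

variable {Ω : Type*} [MeasurableSpace Ω] [TopologicalSpace Ω] [BorelSpace Ω]
  [FirstCountableTopology Ω]

theorem continuous_drive {P : Measure Ω} [IsProbabilityMeasure P] (κ : ℝ) {ν θ : Ω → ℝ}
    (hν : Continuous ν) (hθ : Continuous θ) : Continuous (drive κ P ν θ) := by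
  refine hν.add (continuous_const.mul ?_)
  exact continuous_of_dominated (bound := fun _ => 1)
    (fun α => (integrable_sin hθ.measurable _).aestronglyMeasurable)
    (fun α => ae_of_all _ fun β => Real.abs_sin_le_one _) (integrable_const _)
    (ae_of_all _ fun β => Real.continuous_sin.comp (continuous_const.sub hθ))

/-- Mean-field systems with a compact label space exist, and their phases depend continuously on
the label. -/
theorem exists_isMeanField [CompactSpace Ω] {Γ g : ℝ → ℝ} {m M K κ ϑ νl νr : ℝ}
    (hp : IsTrapping Γ g m M K κ ϑ νl νr) (P : Measure Ω) [IsProbabilityMeasure P]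
    {θ₀ ν : Ω → ℝ} (hθ₀ : Continuous θ₀) (hν : Continuous ν) (hθmem : ∀ α, θ₀ α ∈ Icc 0 ϑ)
    (hνmem : ∀ α, ν α ∈ Icc νl νr) :
    ∃ θ : ℝ → Ω → ℝ, θ 0 = θ₀ ∧ IsMeanField Γ κ ϑ νl νr P ν θ ∧ ∀ t, Continuous (θ t) := by
  have hκ := hp.coupling_pos
  have hM := hp.upper_pos
  -- The system is one autonomous equation in the Banach space of continuous functions on the
  -- compact label space, with a bounded vector field of Lipschitz constant 2 M κ.
  let v : C(Ω, ℝ) → C(Ω, ℝ) := fun θ =>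
    ⟨fun α => Γ (drive κ P ν θ α), hp.continuous.comp (continuous_drive κ hν θ.continuous)⟩
  have hlip : LipschitzWith (Real.toNNReal (2 * M * κ)) v := by
    refine LipschitzWith.of_dist_le_mul fun θ θ' => ?_
    rw [Real.coe_toNNReal _ (by positivity)]
    refine (ContinuousMap.dist_le (by positivity)).2 fun α => ?_
    have h1 : ∀ α, |θ α - θ' α| ≤ dist θ θ' := fun α => by
      rw [← Real.dist_eq]; exact ContinuousMap.dist_apply_le_dist α
    have h2 : |drive κ P ν θ α - drive κ P ν θ' α| ≤ κ * (2 * dist θ θ') := by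
      have e : drive κ P ν θ α - drive κ P ν θ' α =
          κ * ∫ β, (Real.sin (θ β - θ α) - Real.sin (θ' β - θ' α)) ∂P := by
        rw [integral_sub (integrable_sin θ.continuous.measurable _)
          (integrable_sin θ'.continuous.measurable _)]
        unfold drive
        ring
      rw [e, abs_mul, abs_of_pos hκ]
      refine mul_le_mul_of_nonneg_left (abs_integral_le_of_abs_le fun β => ?_) hκ.le
      refine (Real.abs_sin_sub_sin_le _ _).trans ?_
      have h3 := abs_le.1 (h1 α)
      have h4 := abs_le.1 (h1 β)
      rw [abs_le]; constructor <;> linarith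
    rw [Real.dist_eq]
    refine (hp.abs_sub_le _ _).trans ((mul_le_mul_of_nonneg_left h2 hM.le).trans (le_of_eq ?_))
    ring
  have hb : ∀ θ, ‖v θ‖ ≤ Real.toNNReal (|Γ 0| + M * (max |νl| |νr| + κ)) := by
    intro θ
    rw [Real.coe_toNNReal _ (by positivity), ContinuousMap.norm_le _ (by positivity)]
    intro α
    have h1 := hp.abs_sub_le (drive κ P ν θ α) 0
    have h2 : |drive κ P ν θ α| ≤ max |νl| |νr| + κ := by
      refine (abs_add_le _ _).trans (add_le_add
        (abs_le_max_abs_abs (hνmem α).1 (hνmem α).2) ?_)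
      rw [abs_mul, abs_of_pos hκ]
      exact mul_le_of_le_one_right hκ.le (abs_integral_le_of_abs_le fun β => Real.abs_sin_le_one _)
    have h3 := mul_le_mul_of_nonneg_left h2 hM.le
    rw [sub_zero] at h1
    have h4 := abs_sub_abs_le_abs_sub (Γ (drive κ P ν θ α)) (Γ 0)
    change |Γ (drive κ P ν θ α)| ≤ _
    linarith
  obtain ⟨θ, h0, hθ⟩ := exists_forall_hasDerivAt (v := fun _ => v) (fun _ => hlip)
    (fun x => continuous_const) (fun _ => hb) 0 ⟨θ₀, hθ₀⟩
  refine ⟨fun t => θ t, by simp only [h0]; rfl, ⟨hν.measurable, fun t _ => (θ t).continuous.measurable,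
    hνmem, fun α => by rw [h0]; exact hθmem α, fun t _ α => ?_⟩, fun t => (θ t).continuous⟩
  exact (ContinuousMap.evalCLM ℝ α).hasFDerivAt.comp_hasDerivAt t (hθ t)

end GKuramoto

namespace GKuramoto

/-! ### Continuously differentiable flows of scalar equations with a parameter -/

/-- A function whose increments factor through a continuous family of linear maps is `C¹`. -/
theorem hasFDerivAt_of_slope {E : Type*} [NormedAddCommGroup E] [NormedSpace ℝ E] {f : E → ℝ}
    {A : E → E → E →L[ℝ] ℝ} (hA : Continuous (Function.uncurry A))
    (hf : ∀ p p', f p' - f p = A p p' (p' - p)) (p : E) : HasFDerivAt f (A p p) p := by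
  rw [hasFDerivAt_iff_isLittleO, Asymptotics.isLittleO_iff]
  intro c hc
  have h1 : Continuous fun p' => ‖A p p' - A p p‖ := by
    have : Continuous fun p' => A p p' := hA.comp (continuous_const.prodMk continuous_id)
    fun_prop
  have h2 : ∀ᶠ p' in 𝓝 p, ‖A p p' - A p p‖ < c :=
    (h1.continuousAt (x := p)).eventually_lt_const (by simpa using hc)
  filter_upwards [h2] with p' hp'
  rw [hf, ← sub_apply]
  exact (ContinuousLinearMap.le_opNorm _ _).trans
    (mul_le_mul_of_nonneg_right hp'.le (norm_nonneg _))

theorem contDiff_one_of_slope {E : Type*} [NormedAddCommGroup E] [NormedSpace ℝ E] {f : E → ℝ}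
    {A : E → E → E →L[ℝ] ℝ} (hA : Continuous (Function.uncurry A))
    (hf : ∀ p p', f p' - f p = A p p' (p' - p)) : ContDiff ℝ 1 f := by
  rw [contDiff_one_iff_fderiv]
  refine ⟨fun p => (hasFDerivAt_of_slope hA hf p).differentiableAt, ?_⟩
  rw [funext fun p => (hasFDerivAt_of_slope hA hf p).fderiv]
  exact hA.comp (continuous_id.prodMk continuous_id)

/-- The variation of constants formula. -/
theorem eq_exp_mul_add_integral {d A B : ℝ → ℝ} {c : ℝ} (hA : Continuous A) (hB : Continuous B)
    (hd : ∀ τ, HasDerivAt d (A τ * d τ + B τ * c) τ) (s T : ℝ) :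
    d T = Real.exp (∫ τ in s..T, A τ) * d s +
      (∫ σ in s..T, Real.exp (∫ τ in σ..T, A τ) * B σ) * c := by
  have hI : ∀ σ, HasDerivAt (fun σ => ∫ τ in σ..T, A τ) (-A σ) σ := fun σ =>
    intervalIntegral.integral_hasDerivAt_left (hA.intervalIntegrable _ _)
      (hA.stronglyMeasurableAtFilter _ _) hA.continuousAt
  have hIc : Continuous fun σ => ∫ τ in σ..T, A τ :=
    continuous_iff_continuousAt.2 fun σ => (hI σ).continuousAt
  have h1 : ∀ σ, HasDerivAt (fun σ => Real.exp (∫ τ in σ..T, A τ) * d σ)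
      (Real.exp (∫ τ in σ..T, A τ) * B σ * c) σ := fun σ => by
    refine ((hI σ).exp.mul (hd σ)).congr_deriv ?_
    ring
  have h2 := intervalIntegral.integral_eq_sub_of_hasDerivAt (a := s) (b := T)
    (fun σ _ => h1 σ) (Continuous.intervalIntegrable (by fun_prop) _ _)
  rw [intervalIntegral.integral_mul_const] at h2
  simp only [intervalIntegral.integral_same, Real.exp_zero, one_mul] at h2
  linarith

/-- A time-dependent scalar vector field `v ν s x` with parameter `ν`, whose increments in `(x, ν)`
are given by bounded continuous slopes. -/
structure IsSlopeField (v : ℝ → ℝ → ℝ → ℝ) (a b : ℝ → ℝ × ℝ → ℝ × ℝ → ℝ) (V : ℝ → ℝ) (K : ℝ) :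
    Prop where
  continuous : Continuous fun p : ℝ × ℝ × ℝ => v p.1 p.2.1 p.2.2
  continuous_bound : Continuous V
  abs_le : ∀ ν s x, |v ν s x| ≤ V ν
  continuous_left : Continuous fun p : ℝ × (ℝ × ℝ) × (ℝ × ℝ) => a p.1 p.2.1 p.2.2
  continuous_right : Continuous fun p : ℝ × (ℝ × ℝ) × (ℝ × ℝ) => b p.1 p.2.1 p.2.2
  abs_left_le : ∀ s z z', |a s z z'| ≤ K
  abs_right_le : ∀ s z z', |b s z z'| ≤ K
  slope : ∀ s x ν x' ν', v ν' s x' - v ν s x =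
    a s (x', ν') (x, ν) * (x' - x) + b s (x', ν') (x, ν) * (ν' - ν)

/-- `X (s, a, ν)` is the solution of `ẋ = v ν τ x` with `x(s) = a`. -/
structure IsFlow (v : ℝ → ℝ → ℝ → ℝ) (X : ℝ × ℝ × ℝ → ℝ → ℝ) : Prop where
  start : ∀ p, X p p.1 = p.2.1
  hasDerivAt : ∀ p τ, HasDerivAt (X p) (v p.2.2 τ (X p τ)) τ

section Flow

variable {v : ℝ → ℝ → ℝ → ℝ} {a b : ℝ → ℝ × ℝ → ℝ × ℝ → ℝ} {V : ℝ → ℝ} {K : ℝ}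
  {X : ℝ × ℝ × ℝ → ℝ → ℝ}

theorem IsSlopeField.lipschitzWith (hv : IsSlopeField v a b V K) (ν s : ℝ) :
    LipschitzWith (Real.toNNReal K) (v ν s) := by
  have hK : 0 ≤ K := (abs_nonneg _).trans (hv.abs_left_le 0 0 0)
  refine LipschitzWith.of_dist_le_mul fun x y => ?_
  rw [Real.coe_toNNReal _ hK, Real.dist_eq, Real.dist_eq, hv.slope s y ν x ν, sub_self, mul_zero,
    add_zero, abs_mul]
  exact mul_le_mul_of_nonneg_right (hv.abs_left_le _ _ _) (abs_nonneg _)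

theorem IsSlopeField.exists_isFlow (hv : IsSlopeField v a b V K) : ∃ X, IsFlow v X := by
  have h : ∀ p : ℝ × ℝ × ℝ, ∃ x : ℝ → ℝ, x p.1 = p.2.1 ∧
      ∀ t, HasDerivAt x (v p.2.2 t (x t)) t := by
    intro p
    refine exists_forall_hasDerivAt (K := Real.toNNReal K) (B := Real.toNNReal (V p.2.2))
      (hv.lipschitzWith p.2.2) (fun x => ?_) (fun t x => ?_) p.1 p.2.1
    · exact hv.continuous.comp (f := fun t => (p.2.2, t, x)) (by fun_prop)
    · exact (hv.abs_le _ _ _).trans (Real.le_coe_toNNReal _)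
  choose X h0 h1 using h
  exact ⟨X, h0, h1⟩

theorem IsFlow.eq_of_eq (hv : IsSlopeField v a b V K) {ν : ℝ} {x y : ℝ → ℝ}
    (hx : ∀ τ, HasDerivAt x (v ν τ (x τ)) τ) (hy : ∀ τ, HasDerivAt y (v ν τ (y τ)) τ) {s : ℝ}
    (h : x s = y s) : x = y :=
  ODE_solution_unique_univ (s := fun _ => univ) (fun t => (hv.lipschitzWith ν t).lipschitzOnWith)
    (fun t => ⟨hx t, mem_univ _⟩) (fun t => ⟨hy t, mem_univ _⟩) h

namespace IsFlow

theorem continuous_time (hX : IsFlow v X) (p : ℝ × ℝ × ℝ) : Continuous (X p) :=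
  continuous_iff_continuousAt.2 fun τ => (hX.hasDerivAt p τ).continuousAt

/-- By uniqueness, restarting at any point of a trajectory reproduces it. Hence functions of the
time-T position are constant along trajectories. -/
theorem apply_along (hv : IsSlopeField v a b V K) (hX : IsFlow v X) (p : ℝ × ℝ × ℝ) (τ : ℝ) :
    X (τ, X p τ, p.2.2) = X p :=
  eq_of_eq hv (hX.hasDerivAt (τ, X p τ, p.2.2)) (hX.hasDerivAt p) (hX.start (τ, X p τ, p.2.2))

theorem add_period (hv : IsSlopeField v a b V K) (hX : IsFlow v X) {c : ℝ}
    (hc : ∀ ν s x, v ν s (x + c) = v ν s x) (s x ν : ℝ) (τ : ℝ) :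
    X (s, x + c, ν) τ = X (s, x, ν) τ + c := by
  refine congr_fun (eq_of_eq hv (hX.hasDerivAt (s, x + c, ν))
    (y := fun τ => X (s, x, ν) τ + c) (fun τ => ?_) (s := s) ?_) τ
  · rw [hc]; exact (hX.hasDerivAt (s, x, ν) τ).add_const c
  · rw [hX.start (s, x + c, ν), hX.start (s, x, ν)]

/-- The slopes along two trajectories. -/
theorem continuous_slope_along (hX : IsFlow v X) {a : ℝ → ℝ × ℝ → ℝ × ℝ → ℝ}
    (ha : Continuous fun p : ℝ × (ℝ × ℝ) × (ℝ × ℝ) => a p.1 p.2.1 p.2.2) (p p' : ℝ × ℝ × ℝ) :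
    Continuous fun τ => a τ (X p' τ, p'.2.2) (X p τ, p.2.2) := by
  have h1 := hX.continuous_time p
  have h2 := hX.continuous_time p'
  exact ha.comp (f := fun τ => (τ, (X p' τ, p'.2.2), (X p τ, p.2.2))) (by fun_prop)

/-- The difference of two trajectories solves a linear scalar equation whose coefficients are the
slopes of the field. The resulting formula is exact, so differentiability of the flow can be read
off without a separate variational equation. -/
theorem sub_eq (hv : IsSlopeField v a b V K) (hX : IsFlow v X) (p p' : ℝ × ℝ × ℝ) (s T : ℝ) :
    X p' T - X p T =
      Real.exp (∫ τ in s..T, a τ (X p' τ, p'.2.2) (X p τ, p.2.2)) * (X p' s - X p s) +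
      (∫ σ in s..T, Real.exp (∫ τ in σ..T, a τ (X p' τ, p'.2.2) (X p τ, p.2.2)) *
        b σ (X p' σ, p'.2.2) (X p σ, p.2.2)) * (p'.2.2 - p.2.2) := by
  refine eq_exp_mul_add_integral (d := fun τ => X p' τ - X p τ)
    (hX.continuous_slope_along hv.continuous_left p p')
    (hX.continuous_slope_along hv.continuous_right p p') (fun τ => ?_) s T
  refine ((hX.hasDerivAt p' τ).sub (hX.hasDerivAt p τ)).congr_deriv ?_
  exact hv.slope _ _ _ _ _

theorem continuous_field_along (hv : IsSlopeField v a b V K) (hX : IsFlow v X) (p : ℝ × ℝ × ℝ) :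
    Continuous fun τ => v p.2.2 τ (X p τ) := by
  have h1 := hX.continuous_time p
  exact hv.continuous.comp (f := fun τ => (p.2.2, τ, X p τ)) (by fun_prop)

/-- The second trajectory is followed between the two starting times. Rescaling the integral to [0,
1] extracts the factor p'.1 - p.1 and leaves one that is meaningful even when the starting times
coincide. -/
theorem sub_start_eq (hv : IsSlopeField v a b V K) (hX : IsFlow v X) (p p' : ℝ × ℝ × ℝ) :
    X p' p.1 - X p p.1 = (p'.2.1 - p.2.1) - (p'.1 - p.1) *
      ∫ σ in (0 : ℝ)..1, v p'.2.2 (p.1 + (p'.1 - p.1) * σ) (X p' (p.1 + (p'.1 - p.1) * σ)) := by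
  have h1 := intervalIntegral.integral_eq_sub_of_hasDerivAt (a := p.1) (b := p'.1)
    (fun τ _ => hX.hasDerivAt p' τ)
    ((hX.continuous_field_along hv p').intervalIntegrable _ _)
  have h2 := intervalIntegral.smul_integral_comp_add_mul (a := 0) (b := 1)
    (fun τ => v p'.2.2 τ (X p' τ)) (p'.1 - p.1) p.1
  rw [smul_eq_mul] at h2
  rw [h2, mul_zero, mul_one, add_zero, add_sub_cancel, h1, hX.start p', hX.start p]
  ring

/-- A crude bound giving joint continuity of the flow, which is needed before the exact difference
formula can be seen to have continuous coefficients. -/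
theorem abs_sub_le (hv : IsSlopeField v a b V K) (hX : IsFlow v X) (p p' : ℝ × ℝ × ℝ) (T : ℝ) :
    |X p' T - X p T| ≤ Real.exp (K * |T - p.1|) * (|p'.2.1 - p.2.1| + |p'.1 - p.1| * V p'.2.2) +
      Real.exp (K * |T - p.1|) * K * |T - p.1| * |p'.2.2 - p.2.2| := by
  have hK : 0 ≤ K := (abs_nonneg _).trans (hv.abs_left_le 0 0 0)
  have hint : ∀ σ ∈ uIcc p.1 T,
      |∫ τ in σ..T, a τ (X p' τ, p'.2.2) (X p τ, p.2.2)| ≤ K * |T - p.1| := by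
    intro σ hσ
    have := intervalIntegral.norm_integral_le_of_norm_le_const (a := σ) (b := T) (C := K)
      (f := fun τ => a τ (X p' τ, p'.2.2) (X p τ, p.2.2)) fun τ _ => hv.abs_left_le _ _ _
    refine this.trans (mul_le_mul_of_nonneg_left ?_ hK)
    exact abs_sub_right_of_mem_uIcc hσ
  have hexp : ∀ σ ∈ uIcc p.1 T,
      |Real.exp (∫ τ in σ..T, a τ (X p' τ, p'.2.2) (X p τ, p.2.2))| ≤ Real.exp (K * |T - p.1|) := by
    intro σ hσ
    rw [abs_of_pos (Real.exp_pos _)]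
    exact Real.exp_le_exp.2 ((le_abs_self _).trans (hint σ hσ))
  rw [hX.sub_eq hv p p' p.1 T]
  refine (abs_add_le _ _).trans (add_le_add ?_ ?_)
  · rw [abs_mul]
    refine mul_le_mul (hexp _ left_mem_uIcc) ?_ (abs_nonneg _) (Real.exp_pos _).le
    rw [hX.sub_start_eq hv]
    refine (abs_sub _ _).trans (add_le_add le_rfl ?_)
    rw [abs_mul]
    refine mul_le_mul_of_nonneg_left ?_ (abs_nonneg _)
    have := intervalIntegral.norm_integral_le_of_norm_le_const (a := 0) (b := 1) (C := V p'.2.2)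
      (f := fun σ => v p'.2.2 (p.1 + (p'.1 - p.1) * σ) (X p' (p.1 + (p'.1 - p.1) * σ)))
      fun τ _ => hv.abs_le _ _ _
    simpa using this
  · rw [abs_mul]
    refine mul_le_mul_of_nonneg_right ?_ (abs_nonneg _)
    refine intervalIntegral.norm_integral_le_of_norm_le_const (E := ℝ)
      (C := Real.exp (K * |T - p.1|) * K) fun σ hσ => ?_
    rw [norm_mul]
    exact mul_le_mul (hexp σ (uIoc_subset_uIcc hσ)) (hv.abs_right_le _ _ _) (norm_nonneg _)
      (Real.exp_pos _).le

theorem continuous_uncurry (hv : IsSlopeField v a b V K) (hX : IsFlow v X) :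
    Continuous (Function.uncurry X) := by
  refine continuous_iff_continuousAt.2 fun ⟨p, τ⟩ => ?_
  rw [ContinuousAt, tendsto_iff_dist_tendsto_zero]
  have hV := hv.continuous_bound
  have hτ := hX.continuous_time p
  have hc : Continuous fun q : (ℝ × ℝ × ℝ) × ℝ =>
      Real.exp (K * |q.2 - p.1|) * (|q.1.2.1 - p.2.1| + |q.1.1 - p.1| * V q.1.2.2) +
      Real.exp (K * |q.2 - p.1|) * K * |q.2 - p.1| * |q.1.2.2 - p.2.2| + |X p q.2 - X p τ| := by
    fun_prop
  have h0 := hc.tendsto (p, τ)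
  simp only [sub_self, abs_zero, zero_mul, add_zero, mul_zero] at h0
  refine squeeze_zero (fun _ => dist_nonneg) (fun q => ?_) h0
  rw [Real.dist_eq]
  calc |X q.1 q.2 - X p τ| = |(X q.1 q.2 - X p q.2) + (X p q.2 - X p τ)| := by
        congr 1; ring
    _ ≤ _ := (abs_add_le _ _).trans (add_le_add (hX.abs_sub_le hv p q.1 q.2) le_rfl)

/-- The time-`T` position depends on the starting time, the starting point and the parameter in a
continuously differentiable way. -/
theorem contDiff (hv : IsSlopeField v a b V K) (hX : IsFlow v X) (T : ℝ) :
    ContDiff ℝ 1 fun p => X p T := by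
  have hXc := hX.continuous_uncurry hv
  have hXc' : ∀ {Z : Type} [TopologicalSpace Z] {f : Z → ℝ × ℝ × ℝ} {g : Z → ℝ},
      Continuous f → Continuous g → Continuous fun z => X (f z) (g z) :=
    fun hf hg => hXc.comp (hf.prodMk hg)
  let α : ((ℝ × ℝ × ℝ) × ℝ × ℝ × ℝ) → ℝ → ℝ := fun z τ => a τ (X z.2 τ, z.2.2.2) (X z.1 τ, z.1.2.2)
  have hα : Continuous (Function.uncurry α) :=
    hv.continuous_left.comp (f := fun y : ((ℝ × ℝ × ℝ) × ℝ × ℝ × ℝ) × ℝ =>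
      (y.2, (X y.1.2 y.2, y.1.2.2.2), (X y.1.1 y.2, y.1.1.2.2)))
      (continuous_snd.prodMk (((hXc' (by fun_prop) (by fun_prop)).prodMk (by fun_prop)).prodMk
        ((hXc' (by fun_prop) (by fun_prop)).prodMk (by fun_prop))))
  have hβ : Continuous fun y : ((ℝ × ℝ × ℝ) × ℝ × ℝ × ℝ) × ℝ =>
      b y.2 (X y.1.2 y.2, y.1.2.2.2) (X y.1.1 y.2, y.1.1.2.2) :=
    hv.continuous_right.comp (f := fun y : ((ℝ × ℝ × ℝ) × ℝ × ℝ × ℝ) × ℝ =>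
      (y.2, (X y.1.2 y.2, y.1.2.2.2), (X y.1.1 y.2, y.1.1.2.2)))
      (continuous_snd.prodMk (((hXc' (by fun_prop) (by fun_prop)).prodMk (by fun_prop)).prodMk
        ((hXc' (by fun_prop) (by fun_prop)).prodMk (by fun_prop))))
  have hI : Continuous fun y : ((ℝ × ℝ × ℝ) × ℝ × ℝ × ℝ) × ℝ => ∫ τ in y.2..T, α y.1 τ := by
    simp_rw [fun y : ((ℝ × ℝ × ℝ) × ℝ × ℝ × ℝ) × ℝ => intervalIntegral.integral_symm (f := α y.1) (μ := volume) T y.2]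
    refine (intervalIntegral.continuous_parametric_intervalIntegral_of_continuous
      (f := fun (y : ((ℝ × ℝ × ℝ) × ℝ × ℝ × ℝ) × ℝ) τ => α y.1 τ) (a₀ := T) ?_ continuous_snd).neg
    exact hα.comp (f := fun u : (((ℝ × ℝ × ℝ) × ℝ × ℝ × ℝ) × ℝ) × ℝ => (u.1.1, u.2)) (by fun_prop)
  let e : ((ℝ × ℝ × ℝ) × ℝ × ℝ × ℝ) → ℝ := fun z => Real.exp (∫ τ in z.1.1..T, α z τ)
  have he : Continuous e := Real.continuous_exp.comp
    (hI.comp (f := fun z : ((ℝ × ℝ × ℝ) × ℝ × ℝ × ℝ) => (z, z.1.1)) (by fun_prop))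
  let w : ((ℝ × ℝ × ℝ) × ℝ × ℝ × ℝ) → ℝ := fun z => ∫ σ in (0 : ℝ)..1,
    v z.2.2.2 (z.1.1 + (z.2.1 - z.1.1) * σ) (X z.2 (z.1.1 + (z.2.1 - z.1.1) * σ))
  have hw : Continuous w := by
    refine intervalIntegral.continuous_parametric_intervalIntegral_of_continuous' ?_ 0 1
    refine hv.continuous.comp (f := fun y : ((ℝ × ℝ × ℝ) × ℝ × ℝ × ℝ) × ℝ => (y.1.2.2.2,
      y.1.1.1 + (y.1.2.1 - y.1.1.1) * y.2, X y.1.2 (y.1.1.1 + (y.1.2.1 - y.1.1.1) * y.2))) ?_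
    exact Continuous.prodMk (by fun_prop) (Continuous.prodMk (by fun_prop)
      (hXc' (by fun_prop) (by fun_prop)))
  let c : ((ℝ × ℝ × ℝ) × ℝ × ℝ × ℝ) → ℝ := fun z => ∫ σ in z.1.1..T, Real.exp (∫ τ in σ..T, α z τ) *
    b σ (X z.2 σ, z.2.2.2) (X z.1 σ, z.1.2.2)
  have hc : Continuous c := by
    have : c = fun z => -∫ σ in T..z.1.1, Real.exp (∫ τ in σ..T, α z τ) *
        b σ (X z.2 σ, z.2.2.2) (X z.1 σ, z.1.2.2) := by
      funext z; exact intervalIntegral.integral_symm _ _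
    rw [this]
    refine (intervalIntegral.continuous_parametric_intervalIntegral_of_continuous (a₀ := T) ?_
      (by fun_prop)).neg
    exact (Real.continuous_exp.comp hI).mul hβ
  let ℓ₁ : ℝ × ℝ × ℝ →L[ℝ] ℝ := ContinuousLinearMap.fst ℝ ℝ (ℝ × ℝ)
  let ℓ₂ : ℝ × ℝ × ℝ →L[ℝ] ℝ :=
    (ContinuousLinearMap.fst ℝ ℝ ℝ).comp (ContinuousLinearMap.snd ℝ ℝ (ℝ × ℝ))
  let ℓ₃ : ℝ × ℝ × ℝ →L[ℝ] ℝ :=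
    (ContinuousLinearMap.snd ℝ ℝ ℝ).comp (ContinuousLinearMap.snd ℝ ℝ (ℝ × ℝ))
  -- The coefficients of the three coordinate increments come from `sub_eq` with the difference at
  -- the starting time replaced by `sub_start_eq`.
  refine contDiff_one_of_slope (A := fun p p' =>
    e (p, p') • ℓ₂ - (e (p, p') * w (p, p')) • ℓ₁ + c (p, p') • ℓ₃) ?_ fun p p' => ?_
  · exact ((he.smul continuous_const).sub ((he.mul hw).smul continuous_const)).add
      (hc.smul continuous_const)
  · rw [hX.sub_eq hv p p' p.1 T, hX.sub_start_eq hv]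
    simp only [add_apply, sub_apply,
      smul_apply, smul_eq_mul, ℓ₁, ℓ₂, ℓ₃, ContinuousLinearMap.comp_apply,
      ContinuousLinearMap.coe_fst', ContinuousLinearMap.coe_snd', Prod.fst_sub, Prod.snd_sub,
      e, w, c, α]
    ring

end IsFlow

end Flow

end GKuramoto

namespace GKuramoto

/-! ### Compactly supported test functions -/

theorem exists_cutoff {a b ε : ℝ} (hab : a < b) (hε : 0 < ε) : ∃ η : ℝ → ℝ, ContDiff ℝ 1 η ∧
    (∀ x ∈ Icc a b, η x = 1) ∧ (∀ x, x ∉ Icc (a - ε) (b + ε) → η x = 0) ∧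
    (∀ x, 0 ≤ η x) ∧ ∀ x, η x ≤ 1 := by
  let f : ContDiffBump ((a + b) / 2) := ⟨(b - a) / 2, (b - a) / 2 + ε, by linarith, by linarith⟩
  refine ⟨f, f.contDiff, fun x hx => f.one_of_mem_closedBall ?_, fun x hx => f.zero_of_le_dist ?_,
    fun x => f.nonneg, fun x => f.le_one⟩
  · rw [Metric.mem_closedBall, Real.dist_eq, abs_le]
    constructor <;> dsimp only [f] <;> linarith [hx.1, hx.2]
  · by_contra h
    rw [not_le, Real.dist_eq, abs_lt] at h
    dsimp only [f] at h
    exact hx ⟨by linarith [h.1], by linarith [h.2]⟩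

theorem vanishesAtInfinity_of_eq_zero {f : ℝ × Phase → ℝ} {R : ℝ}
    (h : ∀ p : ℝ × Phase, R < |p.1| ∨ R < |p.2.2| → f p = 0) : VanishesAtInfinity f := by
  refine Tendsto.mono_left ?_ inf_le_left
  refine tendsto_const_nhds.congr' ?_
  have hc : IsCompact (Icc (-R) R ×ˢ ((univ : Set Torus) ×ˢ Icc (-R) R)) :=
    isCompact_Icc.prod (isCompact_univ.prod isCompact_Icc)
  filter_upwards [hc.compl_mem_cocompact] with p hp
  refine (h p ?_).symm
  by_contra! h'
  exact hp ⟨abs_le.1 h'.1, mem_univ _, abs_le.1 h'.2⟩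

theorem isTestFunction_of_eq_zero {φ : ℝ × Phase → ℝ} {R : ℝ} (hφ : ContDiff ℝ 1 (liftFun φ))
    (h : ∀ p : ℝ × Phase, R < |p.1| ∨ R < |p.2.2| → φ p = 0) : IsTestFunction φ := by
  have hR : ∀ x : ℝ, R < |x| → ∀ᶠ y in 𝓝 x, R < |y| := fun x hx =>
    (continuous_abs.continuousAt (x := x)).eventually_const_lt hx
  refine ⟨hφ, vanishesAtInfinity_of_eq_zero h, vanishesAtInfinity_of_eq_zero (R := R) ?_,
    vanishesAtInfinity_of_eq_zero (R := R) ?_, vanishesAtInfinity_of_eq_zero (R := R) ?_⟩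
  · rintro ⟨s, z⟩ (hp | hp)
    · have : (fun r : ℝ => φ (r, z)) =ᶠ[𝓝 s] fun _ => 0 := by
        filter_upwards [hR s hp] with r hr using h _ (Or.inl hr)
      exact this.deriv_eq.trans (deriv_const _ _)
    · have : (fun r : ℝ => φ (r, z)) = fun _ => 0 := funext fun r => h _ (Or.inr hp)
      simp [dTime, this]
  · rintro ⟨s, z⟩ hp
    have : (fun r : ℝ => φ (s, z.1 + (r : Torus), z.2)) = fun _ => 0 := funext fun r => h _ hp
    simp [dPhase, this]
  · rintro ⟨s, z⟩ (hp | hp)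
    · have : (fun r : ℝ => φ (s, z.1, r)) = fun _ => 0 := funext fun r => h _ (Or.inl hp)
      simp [dFreq, this]
    · have : (fun r : ℝ => φ (s, z.1, r)) =ᶠ[𝓝 z.2] fun _ => 0 := by
        filter_upwards [hR z.2 hp] with r hr using h _ (Or.inr hr)
      exact this.deriv_eq.trans (deriv_const _ _)

/-! ### Conservation of natural frequencies and continuity of phase averages. -/

namespace IsMeasureSolution

variable {L : EReal} {F : ℝ → ℝ} {κ νl νr : ℝ} {ρ : ℝ → Measure Phase}

/-- Natural frequencies are conserved along measure-valued solutions. -/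
theorem ae_freq_mem (hρ : IsMeasureSolution L F κ ρ) (hlr : νl < νr)
    (h0 : ∀ᵐ z ∂ρ 0, z.2 ∈ Icc νl νr) {t : ℝ} (ht : 0 ≤ t) : ∀ᵐ z ∂ρ t, z.2 ∈ Icc νl νr := by
  have := hρ.prob t ht
  have := hρ.prob 0 le_rfl
  have key : ∀ ε : ℝ, 0 < ε → ∀ᵐ z ∂ρ t, z.2 ∈ Icc (νl - ε) (νr + ε) := by
    intro ε hε
    -- The cutoff in time equals 1 on a neighbourhood of [0, t], endpoints included, so its
    -- two-sided time derivative vanishes there. A function of the frequency alone then has zero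
    -- weak integrand, and its integral is conserved.
    obtain ⟨χ, hχ, hχ1, hχ0, -, -⟩ := exists_cutoff (a := -1) (b := t + 1) (by linarith) one_pos
    obtain ⟨η, hη, hη1, hη0, hηn, hηo⟩ := exists_cutoff hlr hε
    let φ : ℝ × Phase → ℝ := fun p => χ p.1 * η p.2.2
    have hφ : IsTestFunction φ := by
      refine isTestFunction_of_eq_zero (R := t + 2 + |νl| + |νr| + ε) ?_ ?_
      · have : ContDiff ℝ 1 fun p : ℝ × ℝ × ℝ => χ p.1 * η p.2.2 :=
          (hχ.comp contDiff_fst).mul (hη.comp (contDiff_snd.comp contDiff_snd))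
        exact this
      · rintro p (hp | hp)
        · have : p.1 ∉ Icc (-1 - 1 : ℝ) (t + 1 + 1) := fun h => by
            have := abs_le.2 ⟨(by linarith [h.1] : -(t + 2) ≤ p.1), by linarith [h.2]⟩
            linarith [abs_nonneg νl, abs_nonneg νr]
          simp [φ, hχ0 _ this]
        · have : p.2.2 ∉ Icc (νl - ε) (νr + ε) := fun h => by
            have := abs_le.2 ⟨(by linarith [h.1, abs_nonneg νr, neg_abs_le νl] :
              -(|νl| + |νr| + ε) ≤ p.2.2),
              by linarith [h.2, le_abs_self νr, abs_nonneg νl]⟩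
            linarith
          simp [φ, hη0 _ this]
    have hw : ∀ s ∈ uIcc 0 t, ∫ z, weakIntegrand L F κ (ρ s) φ s z ∂ρ s = 0 := by
      intro s hs
      rw [uIcc_of_le ht] at hs
      have : weakIntegrand L F κ (ρ s) φ s = fun _ => 0 := by
        funext z
        have h1 : (fun r : ℝ => φ (r, z)) =ᶠ[𝓝 s] fun _ => η z.2 := by
          filter_upwards [Icc_mem_nhds (a := -1) (b := t + 1) (by linarith [hs.1])
            (by linarith [hs.2])] with r hr
          simp [φ, hχ1 r hr]
        have h2 : dTime φ (s, z) = 0 := h1.deriv_eq.trans (deriv_const _ _)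
        have h3 : dPhase φ (s, z) = 0 := by simp [dPhase, φ]
        simp [weakIntegrand, h2, h3]
      simp [this]
    have h1 := hρ.weak_eq φ hφ t ht
    rw [intervalIntegral.integral_congr hw, intervalIntegral.integral_zero] at h1
    simp only [φ, hχ1 t ⟨by linarith, by linarith⟩, hχ1 0 ⟨by linarith, by linarith⟩, one_mul] at h1
    have hη' : ∀ μ : Measure Phase, IsProbabilityMeasure μ →
        Integrable (fun z : Phase => η z.2) μ := fun μ _ =>
      Integrable.of_bound (hη.continuous.comp continuous_snd).aestronglyMeasurable 1
        (.of_forall fun z => by rw [Real.norm_eq_abs, abs_of_nonneg (hηn _)]; exact hηo _)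
    have h2 : ∫ z, η z.2 ∂ρ 0 = 1 := by
      rw [integral_congr_ae (g := fun _ => (1 : ℝ)) (h0.mono fun z hz => hη1 _ hz)]
      simp
    have h3 : ∫ z, (1 - η z.2) ∂ρ t = 0 := by
      rw [integral_sub (integrable_const _) (hη' _ inferInstance)]
      simp only [integral_const, probReal_univ, smul_eq_mul, mul_one]
      linarith
    rw [integral_eq_zero_iff_of_nonneg (fun z => sub_nonneg.2 (hηo _))
      ((integrable_const _).sub (hη' _ inferInstance))] at h3
    filter_upwards [h3] with z hz
    by_contra h
    simp [hη0 _ h] at hz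
  have h := ae_all_iff.2 fun n : ℕ => key (1 / ((n : ℝ) + 1)) (by positivity)
  filter_upwards [h] with z hz
  refine ⟨le_of_forall_pos_le_add fun ε hε => ?_, le_of_forall_pos_le_add fun ε hε => ?_⟩ <;>
    obtain ⟨n, hn⟩ := exists_nat_one_div_lt hε
  · linarith [(hz n).1]
  · linarith [(hz n).2]

/-- Weak continuity covers only functions vanishing at infinity. As the frequencies remain in a
compact interval and the circle is compact, a cutoff in ν changes nothing. -/
theorem continuousOn_integral_fst (hρ : IsMeasureSolution L F κ ρ) (hlr : νl < νr)
    (h0 : ∀ᵐ z ∂ρ 0, z.2 ∈ Icc νl νr) {f : Torus → ℝ} (hf : Continuous f) :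
    ContinuousOn (fun t => ∫ z, f z.1 ∂ρ t) (Ici 0) := by
  obtain ⟨η, hη, hη1, hη0, -, -⟩ := exists_cutoff hlr one_pos
  have hz : Tendsto (fun z : Phase => f z.1 * η z.2) (cocompact Phase) (𝓝 0) := by
    refine tendsto_const_nhds.congr' ?_
    have hc : IsCompact ((univ : Set Torus) ×ˢ Icc (νl - 1) (νr + 1)) :=
      isCompact_univ.prod isCompact_Icc
    filter_upwards [hc.compl_mem_cocompact] with z hz
    rw [hη0 z.2 fun h => hz ⟨mem_univ _, h⟩, mul_zero]
  let G : C₀(Phase, ℝ) :=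
    ⟨⟨fun z => f z.1 * η z.2, (hf.comp continuous_fst).mul (hη.continuous.comp continuous_snd)⟩, hz⟩
  refine (hρ.weak_continuous G).congr fun t ht => ?_
  refine integral_congr_ae ?_
  filter_upwards [hρ.ae_freq_mem hlr h0 ht] with z hz
  change f z.1 = f z.1 * η z.2
  rw [hη1 _ hz, mul_one]

end IsMeasureSolution

/-! ### The field driven by a given mean field -/

/-- The cosine function on the circle. -/
noncomputable def torusCos (x : Torus) : ℝ := torusSin (x + ((Real.pi / 2 : ℝ) : Torus))

@[simp] theorem torusCos_coe (x : ℝ) : torusCos (x : Torus) = Real.cos x := by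
  rw [torusCos, ← AddCircle.coe_add, torusSin_coe, Real.sin_add_pi_div_two]

theorem continuous_torusCos : Continuous torusCos :=
  continuous_torusSin.comp (continuous_id.add continuous_const)

theorem abs_torusCos_le_one (x : Torus) : |torusCos x| ≤ 1 := abs_torusSin_le_one _

theorem torusSin_sub (w : Torus) (x : ℝ) :
    torusSin (w - (x : Torus)) = torusSin w * Real.cos x - torusCos w * Real.sin x := by
  induction w using QuotientAddGroup.induction_on with
  | H y =>
    rw [torusSin_coe, torusCos_coe]
    exact (torusSin_coe (y - x)).trans (Real.sin_sub y x)

theorem integrable_fst {f : Torus → ℝ} (hf : Continuous f) (hb : ∀ x, |f x| ≤ 1)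
    (μ : Measure Phase) [IsFiniteMeasure μ] : Integrable (fun z => f z.1) μ :=
  Integrable.of_bound (hf.comp continuous_fst).aestronglyMeasurable 1 (.of_forall fun _ => hb _)

/-- The slopes are explicit: for Γ the average of g over the segment between two arguments, for sine
and cosine the function `sinSlope`, shifted by π / 2 for the cosine. They are continuous across the
diagonal and bounded, although S and C are merely continuous in time. -/
theorem IsRegularResponse.exists_isSlopeField {Γ g : ℝ → ℝ} {m M K : ℝ}
    (hΓ : IsRegularResponse Γ g m M K) (κ : ℝ) {S C : ℝ → ℝ} (hS : Continuous S)
    (hC : Continuous C) (hS1 : ∀ s, |S s| ≤ 1) (hC1 : ∀ s, |C s| ≤ 1) :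
    ∃ a b V K', IsSlopeField
      (fun ν s x => Γ (ν + κ * (S s * Real.cos x - C s * Real.sin x))) a b V K' := by
  have hg := hΓ.continuous_deriv
  have hM := hΓ.upper_pos
  let Q : ℝ × ℝ → ℝ := fun y => ∫ σ in (0 : ℝ)..1, g (y.2 + (y.1 - y.2) * σ)
  have hQ : Continuous Q :=
    intervalIntegral.continuous_parametric_intervalIntegral_of_continuous' (by fun_prop) 0 1
  have hQm : ∀ y' y, Γ y' - Γ y = Q (y', y) * (y' - y) := by
    intro y' y
    have h1 := intervalIntegral.integral_eq_sub_of_hasDerivAt (a := y) (b := y')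
      (fun τ _ => hΓ.hasDerivAt τ) (hg.intervalIntegrable _ _)
    have h2 := intervalIntegral.smul_integral_comp_add_mul (a := 0) (b := 1) g (y' - y) y
    rw [smul_eq_mul] at h2
    rw [← h1, mul_comm]
    refine Eq.trans ?_ h2.symm
    congr 1 <;> ring
  have hQb : ∀ y, |Q y| ≤ M := by
    intro y
    have := intervalIntegral.norm_integral_le_of_norm_le_const (a := 0) (b := 1) (C := M)
      (f := fun σ => g (y.2 + (y.1 - y.2) * σ)) fun σ _ => by
        rw [Real.norm_eq_abs, abs_of_nonneg (hΓ.lower_pos.le.trans (hΓ.lower _))]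
        exact hΓ.upper _
    simpa using this
  let Y : ℝ → ℝ × ℝ → ℝ := fun s z => z.2 + κ * (S s * Real.cos z.1 - C s * Real.sin z.1)
  have hY : Continuous fun p : ℝ × ℝ × ℝ => Y p.1 p.2 := by fun_prop
  have hYab : ∀ s x, |S s * Real.cos x - C s * Real.sin x| ≤ 2 := fun s x => by
    have h1 : |S s * Real.cos x| ≤ 1 := by
      rw [abs_mul]; exact mul_le_one₀ (hS1 s) (abs_nonneg _) (Real.abs_cos_le_one x)
    have h2 : |C s * Real.sin x| ≤ 1 := by
      rw [abs_mul]; exact mul_le_one₀ (hC1 s) (abs_nonneg _) (Real.abs_sin_le_one x)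
    linarith [abs_sub (S s * Real.cos x) (C s * Real.sin x)]
  let b : ℝ → ℝ × ℝ → ℝ × ℝ → ℝ := fun s z' z => Q (Y s z', Y s z)
  have hb : Continuous fun p : ℝ × (ℝ × ℝ) × (ℝ × ℝ) => b p.1 p.2.1 p.2.2 := by
    have h1 : Continuous fun p : ℝ × (ℝ × ℝ) × (ℝ × ℝ) => Y p.1 p.2.1 := by fun_prop
    have h2 : Continuous fun p : ℝ × (ℝ × ℝ) × (ℝ × ℝ) => Y p.1 p.2.2 := by fun_prop
    exact hQ.comp (h1.prodMk h2)
  let c : ℝ → ℝ × ℝ → ℝ × ℝ → ℝ := fun s z' z =>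
    S s * sinSlope (z'.1 + Real.pi / 2) (z.1 + Real.pi / 2) - C s * sinSlope z'.1 z.1
  have hc : Continuous fun p : ℝ × (ℝ × ℝ) × (ℝ × ℝ) => c p.1 p.2.1 p.2.2 := by
    have h1 := continuous_sinSlope.comp (f := fun p : ℝ × (ℝ × ℝ) × (ℝ × ℝ) =>
      (p.2.1.1 + Real.pi / 2, p.2.2.1 + Real.pi / 2)) (by fun_prop)
    have h2 := continuous_sinSlope.comp (f := fun p : ℝ × (ℝ × ℝ) × (ℝ × ℝ) =>
      (p.2.1.1, p.2.2.1)) (by fun_prop)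
    exact ((hS.comp continuous_fst).mul h1).sub ((hC.comp continuous_fst).mul h2)
  have hcb : ∀ s z' z, |c s z' z| ≤ 2 := fun s z' z => by
    have h1 : |S s * sinSlope (z'.1 + Real.pi / 2) (z.1 + Real.pi / 2)| ≤ 1 := by
      rw [abs_mul]; exact mul_le_one₀ (hS1 s) (abs_nonneg _) (abs_sinSlope_le_one _ _)
    have h2 : |C s * sinSlope z'.1 z.1| ≤ 1 := by
      rw [abs_mul]; exact mul_le_one₀ (hC1 s) (abs_nonneg _) (abs_sinSlope_le_one _ _)
    exact (abs_sub _ _).trans (by linarith)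
  have hcs : ∀ s z' z, κ * c s z' z * (z'.1 - z.1) =
      κ * (S s * Real.cos z'.1 - C s * Real.sin z'.1) -
        κ * (S s * Real.cos z.1 - C s * Real.sin z.1) := fun s z' z => by
    have h1 := sinSlope_mul (z'.1 + Real.pi / 2) (z.1 + Real.pi / 2)
    have h2 := sinSlope_mul z'.1 z.1
    rw [Real.sin_add_pi_div_two, Real.sin_add_pi_div_two, add_sub_add_right_eq_sub] at h1
    linear_combination κ * S s * h1 - κ * C s * h2
  refine ⟨fun s z' z => b s z' z * (κ * c s z' z), b, fun ν => |Γ 0| + M * (|ν| + |κ| * 2),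
    max M (M * (|κ| * 2)), ?_, by fun_prop, fun ν s x => ?_, hb.mul (hc.const_mul κ), hb,
    fun s z z' => le_max_of_le_right ?_, fun s z z' => le_max_of_le_left (hQb _),
    fun s x ν x' ν' => ?_⟩
  · exact hΓ.continuous.comp (hY.comp (f := fun p : ℝ × ℝ × ℝ => (p.2.1, p.2.2, p.1)) (by fun_prop))
  · have h1 := hQm (Y s (x, ν)) 0
    have h2 : |Γ (Y s (x, ν)) - Γ 0| ≤ M * (|ν| + |κ| * 2) := by
      rw [h1, abs_mul, sub_zero]
      refine mul_le_mul (hQb _) ((abs_add_le _ _).trans ?_) (abs_nonneg _) hM.le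
      rw [abs_mul]
      gcongr
      exact hYab s x
    have h3 := abs_sub_abs_le_abs_sub (Γ (Y s (x, ν))) (Γ 0)
    change |Γ (Y s (x, ν))| ≤ _
    linarith
  · rw [abs_mul, abs_mul]
    gcongr
    · exact hQb _
    · exact hcb _ _ _
  · change Γ (Y s (x', ν')) - Γ (Y s (x, ν)) = _
    rw [hQm]
    have := hcs s (x', ν') (x, ν)
    dsimp only [b, Y] at this ⊢
    linear_combination (Q (ν' + κ * (S s * Real.cos x' - C s * Real.sin x'),
      ν + κ * (S s * Real.cos x - C s * Real.sin x))) * (-this)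

end GKuramoto

namespace GKuramoto

/-! ### Measures on the phase space are determined by `C¹` functions -/

/-- The bounded functions on `𝕋 × ℝ` of class `C¹`. -/
noncomputable def smoothSubalgebra : StarSubalgebra ℝ (BoundedContinuousFunction Phase ℝ) where
  carrier := {f | ContDiff ℝ 1 fun z => f (toPhase z)}
  mul_mem' {f g} (hf : ContDiff ℝ 1 fun z => f (toPhase z))
      (hg : ContDiff ℝ 1 fun z => g (toPhase z)) := hf.mul hg
  add_mem' {f g} (hf : ContDiff ℝ 1 fun z => f (toPhase z))
      (hg : ContDiff ℝ 1 fun z => g (toPhase z)) := hf.add hg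
  algebraMap_mem' r := (contDiff_const : ContDiff ℝ 1 fun _ : ℝ × ℝ => algebraMap ℝ ℝ r)
  star_mem' {f} hf := by
    change ContDiff ℝ 1 fun z => star (f (toPhase z))
    simpa using hf

theorem coe_eq_of_sin_eq_cos_eq {x y : ℝ} (hs : Real.sin x = Real.sin y)
    (hc : Real.cos x = Real.cos y) : (x : Torus) = (y : Torus) :=
  Real.Angle.cos_sin_inj hc hs

/-- Sine and cosine separate phases, and the bounded injective function arctan separates
frequencies. -/
theorem separatesPoints_smoothSubalgebra : (smoothSubalgebra.map
    (BoundedContinuousFunction.toContinuousMapStarₐ ℝ)).SeparatesPoints := by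
  have hmem : ∀ (f : Phase → ℝ) (hf : ContDiff ℝ 1 fun z => f (toPhase z)) (C : ℝ)
      (hC : ∀ z, |f z| ≤ C) {z w : Phase}, f z ≠ f w →
      ∃ h ∈ (fun f : C(Phase, ℝ) => (f : Phase → ℝ)) '' ((smoothSubalgebra.map
        (BoundedContinuousFunction.toContinuousMapStarₐ ℝ)).toSubalgebra :
          Set C(Phase, ℝ)), h z ≠ h w := by
    intro f hf C hC z w h
    have hfc := continuous_of_comp_toPhase hf.continuous
    exact ⟨f, ⟨⟨f, hfc⟩, ⟨.ofNormedAddCommGroup f hfc C hC, hf, rfl⟩, rfl⟩, h⟩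
  intro z w hzw
  by_contra! hne
  have h' : ∀ (f : Phase → ℝ) (hf : ContDiff ℝ 1 fun z => f (toPhase z)) (C : ℝ)
      (hC : ∀ z, |f z| ≤ C), f z = f w := by
    intro f hf C hC
    by_contra h
    obtain ⟨h, h1, h2⟩ := hmem f hf C hC h
    exact h2 (hne h h1)
  obtain ⟨⟨x, ν⟩, rfl⟩ := isOpenQuotientMap_toPhase.surjective z
  obtain ⟨⟨y, ν'⟩, rfl⟩ := isOpenQuotientMap_toPhase.surjective w
  have h1 : Real.sin x = Real.sin y := h' (fun z => torusSin z.1)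
    (Real.contDiff_sin.comp contDiff_fst) 1 fun z => abs_torusSin_le_one _
  have h2 : torusCos x = torusCos y := h' (fun z => torusCos z.1) (by
    have : ContDiff ℝ 1 fun z : ℝ × ℝ => Real.cos z.1 := Real.contDiff_cos.comp contDiff_fst
    simpa only [toPhase, torusCos_coe] using this) 1 fun z => abs_torusCos_le_one _
  have h3 : Real.arctan ν = Real.arctan ν' := h' (fun z => Real.arctan z.2)
    (Real.contDiff_arctan.comp contDiff_snd) (Real.pi / 2) fun z =>
      (abs_lt.2 ⟨Real.neg_pi_div_two_lt_arctan _, Real.arctan_lt_pi_div_two _⟩).le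
  rw [torusCos_coe, torusCos_coe] at h2
  refine hzw (Prod.ext (coe_eq_of_sin_eq_cos_eq h1 h2) (Real.arctan_injective h3))

theorem measure_ext_of_smooth {μ μ' : Measure Phase} [IsProbabilityMeasure μ]
    [IsProbabilityMeasure μ']
    (h : ∀ f : Phase → ℝ, ContDiff ℝ 1 (fun z => f (toPhase z)) → ∫ z, f z ∂μ = ∫ z, f z ∂μ') :
    μ = μ' :=
  ext_of_forall_mem_subalgebra_integral_eq_of_polish separatesPoints_smoothSubalgebra
    fun f hf => h f hf

/-! ### Representation of measure-valued solutions -/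

/-- The measure enters the velocity only through two moments, so its time regularity matters only
for these. -/
theorem mean_torusSin_sub (μ : Measure Phase) [IsFiniteMeasure μ] (x : ℝ) :
    ∫ w, torusSin (w.1 - (x : Torus)) ∂μ =
      (∫ z, torusSin z.1 ∂μ) * Real.cos x - (∫ z, torusCos z.1 ∂μ) * Real.sin x := by
  have h1 := integrable_fst continuous_torusSin abs_torusSin_le_one μ
  have h2 := integrable_fst continuous_torusCos abs_torusCos_le_one μ
  simp_rw [torusSin_sub]
  rw [integral_sub (h1.mul_const _) (h2.mul_const _), integral_mul_const, integral_mul_const]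

theorem abs_integral_fst_le_one {f : Torus → ℝ} (hb : ∀ x, |f x| ≤ 1)
    (μ : Measure Phase) [IsProbabilityMeasure μ] (g : Phase → Torus) :
    |∫ z, f (g z) ∂μ| ≤ 1 := by
  have := norm_integral_le_of_norm_le_const (μ := μ) (f := fun z => f (g z))
    (.of_forall fun z => hb (g z))
  simpa using this

section Transport

variable {v : ℝ → ℝ → ℝ → ℝ} {a b : ℝ → ℝ × ℝ → ℝ × ℝ → ℝ} {V : ℝ → ℝ} {K : ℝ}
  {X : ℝ × ℝ × ℝ → ℝ → ℝ}

theorem IsFlow.periodic (hv : IsSlopeField v a b V K) (hX : IsFlow v X)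
    (hc : ∀ ν s x, v ν s (x + 2 * Real.pi) = v ν s x) (s T ν : ℝ) :
    Function.Periodic (fun x => ((X (s, x, ν) T : ℝ) : Torus)) (2 * Real.pi) := fun x => by
  change ((X (s, x + 2 * Real.pi, ν) T : ℝ) : Torus) = _
  rw [hX.add_period hv hc, AddCircle.coe_add_period]

variable {L : EReal} {F : ℝ → ℝ} {κ νl νr : ℝ} {ρ : ℝ → Measure Phase}

/-- If the velocity of a measure-valued solution is given by a regular periodic field, then the
solution is transported by the flow of this field. -/
theorem IsMeasureSolution.exists_transport (hρ : IsMeasureSolution L F κ ρ) (hlr : νl < νr)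
    (h0 : ∀ᵐ z ∂ρ 0, z.2 ∈ Icc νl νr) (hv : IsSlopeField v a b V K) (hX : IsFlow v X)
    (hc : ∀ ν s x, v ν s (x + 2 * Real.pi) = v ν s x)
    (hvel : ∀ s, 0 ≤ s → ∀ x, ∀ ν ∈ Icc νl νr, velocity L F κ (ρ s) (toPhase (x, ν)) = v ν s x)
    {T : ℝ} (hT : 0 ≤ T) : ∃ Φ : Phase → Phase, Measurable Φ ∧
      (∀ z, Φ (toPhase z) = toPhase (X (0, z) T, z.2)) ∧ ρ T = (ρ 0).map Φ := by
  have hper := hX.periodic hv hc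
  let Φ : ℝ → Phase → Phase := fun s z => ((hper s T z.2).lift z.1, z.2)
  have hΦ : ∀ s z, Φ s (toPhase z) = toPhase (X (s, z) T, z.2) := fun s z => rfl
  have hXT := hX.contDiff hv T
  have hΦc : Continuous (Φ 0) := by
    have h1 : Continuous fun z : ℝ × ℝ => toPhase (X (0, z) T, z.2) :=
      continuous_toPhase.comp ((hXT.continuous.comp (by fun_prop)).prodMk continuous_snd)
    exact continuous_of_comp_toPhase h1
  refine ⟨Φ 0, hΦc.measurable, hΦ 0, ?_⟩
  have := hρ.prob T hT
  have := hρ.prob 0 le_rfl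
  have : IsProbabilityMeasure ((ρ 0).map (Φ 0)) :=
    Measure.isProbabilityMeasure_map hΦc.aemeasurable
  refine measure_ext_of_smooth fun ψ hψ => ?_
  have hψc : Continuous ψ := continuous_of_comp_toPhase hψ.continuous
  rw [integral_map hΦc.aemeasurable hψc.aestronglyMeasurable]
  obtain ⟨χ, hχ, hχ1, hχ0, -, -⟩ := exists_cutoff (a := -1) (b := T + 1) (by linarith) one_pos
  obtain ⟨η, hη, hη1, hη0, -, -⟩ := exists_cutoff hlr one_pos
  -- Φ s carries a state at time s to its position at time T. Apart from the cutoffs, φ solves the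
  -- dual transport equation with final value ψ, so the weak form equates the integral of ψ at time
  -- T with that of ψ ∘ Φ 0 at time 0.
  let φ : ℝ × Phase → ℝ := fun p => χ p.1 * η p.2.2 * ψ (Φ p.1 p.2)
  have hφ1 : ContDiff ℝ 1 (liftFun φ) := by
    have h1 : ContDiff ℝ 1 fun p : ℝ × ℝ × ℝ => χ p.1 * η p.2.2 :=
      (hχ.comp contDiff_fst).mul (hη.comp (contDiff_snd.comp contDiff_snd))
    have h2 : ContDiff ℝ 1 fun p : ℝ × ℝ × ℝ => ψ (toPhase (X p T, p.2.2)) :=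
      hψ.comp (hXT.prodMk (contDiff_snd.comp contDiff_snd))
    exact h1.mul h2
  have hφ : IsTestFunction φ := by
    refine isTestFunction_of_eq_zero (R := T + 2 + |νl| + |νr| + 1) hφ1 ?_
    rintro p (hp | hp)
    · have : p.1 ∉ Icc (-1 - 1 : ℝ) (T + 1 + 1) := fun h => by
        have := abs_le.2 ⟨(by linarith [h.1] : -(T + 2) ≤ p.1), by linarith [h.2]⟩
        linarith [abs_nonneg νl, abs_nonneg νr]
      simp [φ, hχ0 _ this]
    · have : p.2.2 ∉ Icc (νl - 1) (νr + 1) := fun h => by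
        have := abs_le.2 ⟨(by linarith [h.1, abs_nonneg νr, neg_abs_le νl] :
          -(|νl| + |νr| + 1) ≤ p.2.2), by linarith [h.2, le_abs_self νr, abs_nonneg νl]⟩
        linarith
      simp [φ, hη0 _ this]
  have hw : ∀ s ∈ uIcc 0 T, ∫ z, weakIntegrand L F κ (ρ s) φ s z ∂ρ s = 0 := by
    intro s hs
    rw [uIcc_of_le hT] at hs
    refine integral_eq_zero_of_ae ?_
    filter_upwards [hρ.ae_freq_mem hlr h0 hs.1] with z hz
    obtain ⟨⟨x, ν⟩, rfl⟩ := isOpenQuotientMap_toPhase.surjective z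
    rw [weakIntegrand_toPhase hφ1, hvel s hs.1 x ν hz]
    have h1 : HasDerivAt (fun r => ((r, X (s, x, ν) r, ν) : ℝ × ℝ × ℝ))
        (1, v ν s x, 0) s := by
      have := hX.hasDerivAt (s, x, ν) s
      rw [hX.start (s, x, ν)] at this
      exact (hasDerivAt_id s).prodMk (this.prodMk (hasDerivAt_const s ν))
    have h2 : HasFDerivAt (liftFun φ) (fderiv ℝ (liftFun φ) (s, x, ν))
        (s, X (s, x, ν) s, ν) := by
      rw [hX.start (s, x, ν)]; exact hasFDerivAt_liftFun hφ1 _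
    have h3 := h2.comp_hasDerivAt s h1
    have h4 : (liftFun φ ∘ fun r => ((r, X (s, x, ν) r, ν) : ℝ × ℝ × ℝ)) =ᶠ[𝓝 s]
        fun _ => η ν * ψ (toPhase (X (s, x, ν) T, ν)) := by
      filter_upwards [Icc_mem_nhds (a := -1) (b := T + 1) (by linarith [hs.1])
        (by linarith [hs.2])] with r hr
      have h5 := congr_fun (hX.apply_along hv (s, x, ν) r) T
      change χ r * η ν * ψ (toPhase (X (r, X (s, x, ν) r, ν) T, ν)) = _
      rw [hχ1 r hr, one_mul, h5]
    exact h3.unique ((hasDerivAt_const s _).congr_of_eventuallyEq h4)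
  have h1 := hρ.weak_eq φ hφ T hT
  rw [intervalIntegral.integral_congr hw, intervalIntegral.integral_zero, sub_eq_zero] at h1
  have h2 : ∫ z, φ (T, z) ∂ρ T = ∫ z, ψ z ∂ρ T := by
    refine integral_congr_ae ?_
    filter_upwards [hρ.ae_freq_mem hlr h0 hT] with z hz
    obtain ⟨⟨x, ν⟩, rfl⟩ := isOpenQuotientMap_toPhase.surjective z
    change χ T * η ν * ψ (toPhase (X (T, x, ν) T, ν)) = _
    rw [hχ1 T ⟨by linarith, by linarith⟩, hη1 ν hz, hX.start (T, x, ν), one_mul, one_mul]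
  have h3 : ∫ z, φ (0, z) ∂ρ 0 = ∫ z, ψ (Φ 0 z) ∂ρ 0 := by
    refine integral_congr_ae ?_
    filter_upwards [h0] with z hz
    change χ 0 * η z.2 * ψ (Φ 0 z) = _
    rw [hχ1 0 ⟨by linarith, by linarith⟩, hη1 _ hz, one_mul, one_mul]
  rw [← h2, h1, h3]

end Transport

/-- Every measure-valued solution is the law of a mean-field system on any space of labels which
represents the initial datum. -/
theorem IsMeasureSolution.exists_isMeanField {L : EReal} {F Γ g : ℝ → ℝ} {m M K κ ϑ νl νr : ℝ}
    {ρ : ℝ → Measure Phase} (hρ : IsMeasureSolution L F κ ρ)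
    (hp : IsTrapping Γ g m M K κ ϑ νl νr)
    (hΓ : ∀ y ∈ Icc (νl - κ) (νr + κ), Γ y = inverse L F y) {Ω : Type*} [MeasurableSpace Ω]
    {P : Measure Ω} [IsProbabilityMeasure P] {θ₀ ν : Ω → ℝ} (hθ₀ : Measurable θ₀)
    (hν : Measurable ν) (hθmem : ∀ α, θ₀ α ∈ Icc 0 ϑ) (hνmem : ∀ α, ν α ∈ Icc νl νr)
    (h : ρ 0 = law P θ₀ ν) :
    ∃ θ : ℝ → Ω → ℝ, θ 0 = θ₀ ∧ IsMeanField Γ κ ϑ νl νr P ν θ ∧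
      ∀ t, 0 ≤ t → ρ t = law P (θ t) ν := by
  have hκ := hp.coupling_pos
  have h0 : ∀ᵐ z ∂ρ 0, z.2 ∈ Icc νl νr := by
    rw [h, law, ae_map_iff (measurable_toPhase_pair hθ₀ hν).aemeasurable
      (measurable_snd measurableSet_Icc)]
    exact .of_forall hνmem
  have hmax : ∀ s : ℝ, IsProbabilityMeasure (ρ (max s 0)) := fun s => hρ.prob _ (le_max_right _ _)
  -- Freezing the moments at negative times makes the field continuous for all times, so that the
  -- flow is global in both directions.
  let S : ℝ → ℝ := fun s => ∫ z, torusSin z.1 ∂ρ (max s 0)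
  let C : ℝ → ℝ := fun s => ∫ z, torusCos z.1 ∂ρ (max s 0)
  have hS : Continuous S :=
    (hρ.continuousOn_integral_fst hp.freq_lt h0 continuous_torusSin).comp_continuous
      (by fun_prop) fun s => mem_Ici.2 (le_max_right _ _)
  have hC : Continuous C :=
    (hρ.continuousOn_integral_fst hp.freq_lt h0 continuous_torusCos).comp_continuous
      (by fun_prop) fun s => mem_Ici.2 (le_max_right _ _)
  obtain ⟨a, b, V, K', hv⟩ := hp.toIsRegularResponse.exists_isSlopeField κ hS hC
    (fun s => abs_integral_fst_le_one abs_torusSin_le_one _ _)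
    (fun s => abs_integral_fst_le_one abs_torusCos_le_one _ _)
  obtain ⟨X, hX⟩ := hv.exists_isFlow
  have hmean : ∀ s, 0 ≤ s → ∀ x : ℝ, S s * Real.cos x - C s * Real.sin x =
      ∫ w, torusSin (w.1 - (x : Torus)) ∂ρ s := by
    intro s hs x
    have := hρ.prob s hs
    rw [mean_torusSin_sub]
    simp only [S, C, max_eq_left hs]
  have htr := fun T => hρ.exists_transport (T := T) hp.freq_lt h0 hv hX
    (fun ν s x => by simp only [Real.cos_add_two_pi, Real.sin_add_two_pi])
    (fun s hs x ν hνm => by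
      have := hρ.prob s hs
      have h1 : |κ * ∫ w, torusSin (w.1 - (x : Torus)) ∂ρ s| ≤ κ := by
        rw [abs_mul, abs_of_pos hκ]
        exact mul_le_of_le_one_right hκ.le (abs_integral_fst_le_one abs_torusSin_le_one _ _)
      rw [abs_le] at h1
      rw [hmean s hs, hΓ _ ⟨by linarith [hνm.1, h1.1], by linarith [hνm.2, h1.2]⟩]
      rfl)
  let θ : ℝ → Ω → ℝ := fun t α => X (0, θ₀ α, ν α) t
  have hθ : ∀ t, Measurable (θ t) := fun t =>
    (hX.contDiff hv t).continuous.measurable.comp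
      (measurable_const.prodMk (hθ₀.prodMk hν))
  have hlaw : ∀ t, 0 ≤ t → ρ t = law P (θ t) ν := by
    intro t ht
    obtain ⟨Φ, hΦm, hΦ, hΦρ⟩ := htr t ht
    rw [hΦρ, h, law, Measure.map_map hΦm (measurable_toPhase_pair hθ₀ hν), law]
    exact congr_arg (fun f => P.map f) (funext fun α => hΦ _)
  refine ⟨θ, funext fun α => hX.start (0, θ₀ α, ν α), ⟨hν, fun t _ => hθ t, hνmem,
    fun α => ?_, fun t ht α => ?_⟩, hlaw⟩
  · change X (0, θ₀ α, ν α) 0 ∈ _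
    rw [hX.start (0, θ₀ α, ν α)]
    exact hθmem α
  -- Self-consistency: since the solution is the law of these trajectories, the prescribed moments
  -- are their own label averages, and the flow equation becomes the mean-field equation.
  · refine (hX.hasDerivAt (0, θ₀ α, ν α) t).congr_deriv ?_
    change Γ (ν α + κ * (S t * Real.cos (θ t α) - C t * Real.sin (θ t α))) = _
    rw [hmean t ht, hlaw t ht, integral_law (hθ t) hν
      (f := fun w : Phase => torusSin (w.1 - ((θ t α : ℝ) : Torus)))
      (continuous_torusSin.comp (continuous_fst.sub continuous_const))]
    rfl

end GKuramoto

namespace GKuramoto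

/-! ### Changing the space of labels -/

section Labels

variable {Ω Ω' : Type*} [MeasurableSpace Ω] [MeasurableSpace Ω'] {P : Measure Ω} {P' : Measure Ω'}

theorem drive_comp {f : Ω' → Ω} (hf : MeasurePreserving f P' P) (κ : ℝ) {ν θ : Ω → ℝ}
    (hθ : Measurable θ) (α : Ω') : drive κ P' (ν ∘ f) (θ ∘ f) α = drive κ P ν θ (f α) := by
  unfold drive
  rw [← hf.map_eq, integral_map hf.measurable.aemeasurable
    (Measurable.aestronglyMeasurable (by fun_prop))]
  rfl

theorem law_comp {f : Ω' → Ω} (hf : MeasurePreserving f P' P) {θ ν : Ω → ℝ} (hθ : Measurable θ)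
    (hν : Measurable ν) : law P' (θ ∘ f) (ν ∘ f) = law P θ ν := by
  rw [law, law, ← hf.map_eq, Measure.map_map (measurable_toPhase_pair hθ hν) hf.measurable]
  rfl

theorem IsMeanField.comp {Γ : ℝ → ℝ} {κ ϑ νl νr : ℝ} {ν : Ω → ℝ} {θ : ℝ → Ω → ℝ}
    (hs : IsMeanField Γ κ ϑ νl νr P ν θ) {f : Ω' → Ω} (hf : MeasurePreserving f P' P) :
    IsMeanField Γ κ ϑ νl νr P' (ν ∘ f) fun t => θ t ∘ f :=
  ⟨hs.measurable_freq.comp hf.measurable, fun t ht => (hs.measurable_phase t ht).comp hf.measurable,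
    fun α => hs.freq_mem (f α), fun α => hs.init_mem (f α), fun t ht α => by
      rw [drive_comp hf κ (hs.measurable_phase t ht)]
      exact hs.hasDerivAt t ht (f α)⟩

/-- Mean-field systems exist over any probability space of labels. -/
theorem exists_isMeanField_of_measurable {Γ g : ℝ → ℝ} {m M K κ ϑ νl νr : ℝ}
    (hp : IsTrapping Γ g m M K κ ϑ νl νr) (P : Measure Ω) [IsProbabilityMeasure P] {θ₀ ν : Ω → ℝ}
    (hθ₀ : Measurable θ₀) (hν : Measurable ν) (hθmem : ∀ α, θ₀ α ∈ Icc 0 ϑ)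
    (hνmem : ∀ α, ν α ∈ Icc νl νr) :
    ∃ θ : ℝ → Ω → ℝ, θ 0 = θ₀ ∧ IsMeanField Γ κ ϑ νl νr P ν θ := by
  -- Labels with the same data behave alike, so the system is solved over the compact rectangle of
  -- data with the image measure and pulled back.
  let f : Ω → ↥(Icc 0 ϑ ×ˢ Icc νl νr) := fun α => ⟨(θ₀ α, ν α), hθmem α, hνmem α⟩
  have hf : Measurable f := (hθ₀.prodMk hν).subtype_mk
  have : CompactSpace ↥(Icc 0 ϑ ×ˢ Icc νl νr) :=
    isCompact_iff_compactSpace.1 (isCompact_Icc.prod isCompact_Icc)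
  have : IsProbabilityMeasure (P.map f) := Measure.isProbabilityMeasure_map hf.aemeasurable
  obtain ⟨θ, h0, hs, -⟩ := exists_isMeanField hp (P.map f) (θ₀ := fun z => z.1.1)
    (ν := fun z => z.1.2) (by fun_prop) (by fun_prop) (fun z => z.2.1) (fun z => z.2.2)
  exact ⟨fun t => θ t ∘ f, by simp only [h0]; rfl, hs.comp ⟨hf, rfl⟩⟩

end Labels

/-! ### Lifting measures supported in the strip -/

section Lift

variable {ϑ νl νr : ℝ}

open Classical in
/-- A section of the projection `toPhase` over the strip, with values in the open rectangle. -/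
noncomputable def stripLift (ϑ νl νr : ℝ) (z : Phase) : ℝ × ℝ :=
  -- The default value is the centre of the rectangle. Membership in the rectangle thus holds for
  -- every label, not just almost every one.
  if ((AddCircle.equivIco (2 * Real.pi) 0 z.1 : ℝ), z.2) ∈ Ioo 0 ϑ ×ˢ Ioo νl νr then
    ((AddCircle.equivIco (2 * Real.pi) 0 z.1 : ℝ), z.2) else (ϑ / 2, (νl + νr) / 2)

theorem measurable_stripLift (ϑ νl νr : ℝ) : Measurable (stripLift ϑ νl νr) := by
  have h : Measurable fun z : Phase => ((AddCircle.equivIco (2 * Real.pi) 0 z.1 : ℝ), z.2) :=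
    (measurable_subtype_coe.comp ((AddCircle.measurableEquivIco (2 * Real.pi) 0).measurable.comp
      measurable_fst)).prodMk measurable_snd
  exact Measurable.ite (h (measurableSet_Ioo.prod measurableSet_Ioo)) h measurable_const

theorem stripLift_mem (hϑ : 0 < ϑ) (hlr : νl < νr) (z : Phase) :
    stripLift ϑ νl νr z ∈ Ioo 0 ϑ ×ˢ Ioo νl νr := by
  unfold stripLift
  split_ifs with h
  · exact h
  · exact ⟨⟨by dsimp only; linarith, by dsimp only; linarith⟩,
      ⟨by dsimp only; linarith, by dsimp only; linarith⟩⟩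

theorem toPhase_stripLift (hϑ : ϑ < Real.pi / 2) {z : Phase} (hz : z ∈ initialStrip ϑ νl νr) :
    toPhase (stripLift ϑ νl νr z) = z := by
  obtain ⟨⟨x, hx, hxz⟩, hν⟩ := hz
  have h1 : (AddCircle.equivIco (2 * Real.pi) 0 z.1 : ℝ) = x := by
    rw [← hxz]
    exact AddCircle.equivIco_coe_of_mem ⟨hx.1.le, by linarith [hx.2, Real.pi_pos]⟩
  rw [stripLift, h1, if_pos ⟨hx, hν⟩]
  exact Prod.ext hxz rfl

theorem ae_toPhase_stripLift (hϑ : ϑ < Real.pi / 2) {μ : Measure Phase}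
    (hμ : μ.support ⊆ initialStrip ϑ νl νr) : ∀ᵐ z ∂μ, toPhase (stripLift ϑ νl νr z) = z := by
  filter_upwards [Measure.support_mem_ae (μ := μ)] with z hz using toPhase_stripLift hϑ (hμ hz)

/-- A measure supported in the strip is the law of its lifted coordinates. -/
theorem law_stripLift (hϑ : ϑ < Real.pi / 2) {μ : Measure Phase}
    (hμ : μ.support ⊆ initialStrip ϑ νl νr) {Ω : Type*} [MeasurableSpace Ω] {P : Measure Ω}
    {f : Ω → Phase} (hf : MeasurePreserving f P μ) :
    law P (fun α => (stripLift ϑ νl νr (f α)).1) (fun α => (stripLift ϑ νl νr (f α)).2) = μ := by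
  have h := measurable_toPhase.comp (measurable_stripLift ϑ νl νr)
  have h1 : law P (fun α => (stripLift ϑ νl νr (f α)).1)
      (fun α => (stripLift ϑ νl νr (f α)).2) = (P.map f).map (toPhase ∘ stripLift ϑ νl νr) :=
    (Measure.map_map h hf.measurable).symm
  rw [h1, hf.map_eq]
  exact (Measure.map_congr (g := id) (ae_toPhase_stripLift hϑ hμ)).trans Measure.map_id

end Lift

/-! ### Wasserstein distances of laws -/

section Wasserstein

variable {Ω : Type*} [MeasurableSpace Ω] {P : Measure Ω} {q : ℝ}

theorem norm_coe_torus_le (x : ℝ) : ‖(x : Torus)‖ ≤ |x| :=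
  QuotientAddGroup.norm_mk_le_norm

theorem phaseDist_rpow (hq : 1 ≤ q) (z w : Phase) :
    phaseDist q z w ^ q = ‖z.1 - w.1‖ ^ q + |z.2 - w.2| ^ q := by
  rw [phaseDist, one_div, Real.rpow_inv_rpow (by positivity) (by linarith)]

theorem lintegral_rpow_abs (hq : 1 ≤ q) (f : Ω → ℝ) :
    ∫⁻ α, ENNReal.ofReal (|f α| ^ q) ∂P = eLpNorm f (ENNReal.ofReal q) P ^ q := by
  have h0 : 0 < q := by linarith
  rw [eLpNorm_eq_lintegral_rpow_enorm_toReal (by simpa using h0) ENNReal.ofReal_ne_top,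
    ENNReal.toReal_ofReal h0.le, one_div, ENNReal.rpow_inv_rpow h0.ne']
  refine lintegral_congr fun α => ?_
  rw [← ENNReal.ofReal_rpow_of_nonneg (abs_nonneg _) h0.le, ← Real.norm_eq_abs, ofReal_norm]

/-- Common labels provide a coupling. Projection to the circle does not increase distances, and the
1/q-th power of a sum of q-th powers is at most the plain sum. -/
theorem wasserstein_law_le (hq : 1 ≤ q) {θ ν θ' ν' : Ω → ℝ} (hθ : Measurable θ)
    (hν : Measurable ν) (hθ' : Measurable θ') (hν' : Measurable ν') :
    wasserstein q (law P θ ν) (law P θ' ν') ≤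
      eLpNorm (fun α => θ α - θ' α) (ENNReal.ofReal q) P +
        eLpNorm (fun α => ν α - ν' α) (ENNReal.ofReal q) P := by
  have h0 : 0 < q := by linarith
  have m1 := measurable_toPhase_pair hθ hν
  have m2 := measurable_toPhase_pair hθ' hν'
  have hmem : P.map (fun α => (toPhase (θ α, ν α), toPhase (θ' α, ν' α))) ∈
      couplings (law P θ ν) (law P θ' ν') :=
    ⟨Measure.map_map measurable_fst (m1.prodMk m2), Measure.map_map measurable_snd (m1.prodMk m2)⟩
  refine (iInf₂_le _ hmem).trans ?_
  refine le_trans ?_ (ENNReal.rpow_add_rpow_le_add _ _ hq)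
  refine ENNReal.rpow_le_rpow ?_ (by positivity)
  rw [← lintegral_rpow_abs hq, ← lintegral_rpow_abs hq,
    ← lintegral_add_left (by fun_prop)]
  refine (lintegral_map_le _ _).trans (lintegral_mono fun α => ?_)
  rw [phaseDist_rpow hq, ← ENNReal.ofReal_add (by positivity) (by positivity)]
  refine ENNReal.ofReal_le_ofReal (add_le_add ?_ le_rfl)
  exact Real.rpow_le_rpow (norm_nonneg _) (norm_coe_torus_le (θ α - θ' α)) h0.le

/-- For lifts in a common short interval, the norms of the differences of the coordinates are
bounded by the cost of the coupling. -/
theorem eLpNorm_le_cost (hq : 1 ≤ q) {f f' : Ω → Phase} {θ ν θ' ν' : Ω → ℝ}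
    (hf : ∀ᵐ α ∂P, toPhase (θ α, ν α) = f α) (hf' : ∀ᵐ α ∂P, toPhase (θ' α, ν' α) = f' α)
    (hπ : ∀ α, |θ α - θ' α| ≤ Real.pi) :
    eLpNorm (fun α => θ α - θ' α) (ENNReal.ofReal q) P ≤
        (∫⁻ α, ENNReal.ofReal (phaseDist q (f α) (f' α) ^ q) ∂P) ^ (1 / q) ∧
      eLpNorm (fun α => ν α - ν' α) (ENNReal.ofReal q) P ≤
        (∫⁻ α, ENNReal.ofReal (phaseDist q (f α) (f' α) ^ q) ∂P) ^ (1 / q) := by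
  have h0 : 0 < q := by linarith
  have key : ∀ᵐ α ∂P, phaseDist q (f α) (f' α) ^ q = |θ α - θ' α| ^ q + |ν α - ν' α| ^ q := by
    filter_upwards [hf, hf'] with α h h'
    rw [phaseDist_rpow hq, ← h, ← h']
    -- Arc length equals the distance of the lifts exactly because they differ by at most half a
    -- turn.
    have : ‖((θ α - θ' α : ℝ) : Torus)‖ = |θ α - θ' α| := by
      rw [AddCircle.norm_coe_eq_abs_iff _ Real.two_pi_pos.ne', abs_of_pos Real.two_pi_pos,
        mul_div_cancel_left₀ _ two_ne_zero]
      exact hπ α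
    rw [← this]
    rfl
  constructor <;> rw [one_div, ENNReal.le_rpow_inv_iff h0] <;>
    rw [← lintegral_rpow_abs hq] <;> refine lintegral_mono_ae ?_ <;>
    filter_upwards [key] with α h <;> rw [h] <;> refine ENNReal.ofReal_le_ofReal ?_
  · exact le_add_of_nonneg_right (by positivity)
  · exact le_add_of_nonneg_left (by positivity)

end Wasserstein

end GKuramoto

namespace GKuramoto

/-! ### Cell averages -/

section Cells

variable {f : ℝ → ℝ} {a b R : ℝ}

/-- The uniform distribution on `[0, 1)`. -/
noncomputable def unitMeasure : Measure ℝ := volume.restrict (Ico 0 1)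

instance : IsProbabilityMeasure unitMeasure := ⟨by simp [unitMeasure]⟩

/-- The uniform distribution on `N` points. -/
noncomputable def uniformMeasure (N : ℕ) : Measure (Fin N) :=
  (N : ℝ≥0∞)⁻¹ • ∑ α, Measure.dirac α

/-- The index of the cell `[k / N, (k + 1) / N)` containing a point of `[0, 1)`. -/
noncomputable def cell (N : ℕ) (x : ℝ) : ℕ := min ⌊N * x⌋₊ (N - 1)

/-- The average of a function over the cell `[k / N, (k + 1) / N)`. -/
noncomputable def cellAvg (N : ℕ) (f : ℝ → ℝ) (k : ℕ) : ℝ :=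
  N * ∫ x in ((k : ℝ) / N)..((k + 1 : ℝ) / N), f x

theorem measurable_cell (N : ℕ) : Measurable (cell N) :=
  (Nat.measurable_floor.comp (measurable_const_mul (N : ℝ))).min measurable_const

/-- The truncation at N - 1 only serves to give points outside [0, 1) a valid index; inside it is
inactive. -/
theorem cell_eq {N : ℕ} (hN : 0 < N) {x : ℝ} (hx : x ∈ Ico (0 : ℝ) 1) : cell N x = ⌊N * x⌋₊ := by
  refine min_eq_left ?_
  have h : ⌊N * x⌋₊ < N := by
    rw [Nat.floor_lt (mul_nonneg (Nat.cast_nonneg _) hx.1)]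
    exact mul_lt_of_lt_one_right (by exact_mod_cast hN) hx.2
  omega

/-- The cell index as an element of `Fin N`. -/
noncomputable def cellIndex {N : ℕ} (hN : 0 < N) (x : ℝ) : Fin N :=
  ⟨cell N x, (min_le_right _ _).trans_lt (Nat.sub_lt hN one_pos)⟩

theorem measurePreserving_cellIndex {N : ℕ} (hN : 0 < N) :
    MeasurePreserving (cellIndex hN) unitMeasure (uniformMeasure N) := by
  have hm : Measurable (cellIndex hN) := by
    refine measurable_to_countable' fun α => ?_
    have : cellIndex hN ⁻¹' {α} = cell N ⁻¹' {(α : ℕ)} := by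
      ext x; simp [cellIndex, Fin.ext_iff]
    rw [this]
    exact measurable_cell N (measurableSet_singleton _)
  refine ⟨hm, Measure.ext_of_singleton fun α => ?_⟩
  have hN' : (0 : ℝ) < N := by exact_mod_cast hN
  rw [Measure.map_apply hm (measurableSet_singleton _), unitMeasure,
    Measure.restrict_apply (hm (measurableSet_singleton _))]
  have h1 : cellIndex hN ⁻¹' {α} ∩ Ico (0 : ℝ) 1 = Ico ((α : ℕ) / N : ℝ) (((α : ℕ) + 1) / N) := by
    have hα : ((α : ℕ) : ℝ) + 1 ≤ N := by exact_mod_cast α.2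
    ext x
    simp only [mem_inter_iff, mem_preimage, mem_singleton_iff]
    rw [@mem_Ico _ _ ((α : ℕ) / N : ℝ), div_le_iff₀ hN', lt_div_iff₀ hN']
    constructor
    · rintro ⟨h, hx⟩
      have h2 : ⌊N * x⌋₊ = (α : ℕ) := by rw [← cell_eq hN hx, ← h]; rfl
      rw [Nat.floor_eq_iff (mul_nonneg hN'.le hx.1)] at h2
      exact ⟨by linarith [h2.1], by linarith [h2.2]⟩
    · rintro ⟨h, h'⟩
      have h0 : 0 ≤ x := by
        by_contra hx
        have : ((α : ℕ) : ℝ) < 0 := h.trans_lt (mul_neg_of_neg_of_pos (not_le.1 hx) hN')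
        exact absurd this (not_lt.2 (Nat.cast_nonneg _))
      have hx : x ∈ Ico (0 : ℝ) 1 := ⟨h0, by
        by_contra hx
        nlinarith [not_lt.1 hx]⟩
      refine ⟨Fin.ext ?_, hx⟩
      change cell N x = α
      rw [cell_eq hN hx, Nat.floor_eq_iff (mul_nonneg hN'.le hx.1)]
      exact ⟨by linarith, by linarith⟩
  rw [h1, Real.volume_Ico, uniformMeasure, Measure.smul_apply, Measure.finsetSum_apply,
    Finset.sum_eq_single α (by intro β _ h; simp [h]) (by simp)]
  have h2 : (((α : ℕ) + 1) / N - (α : ℕ) / N : ℝ) = (N : ℝ)⁻¹ := by field_simp; ring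
  rw [h2, ENNReal.ofReal_inv_of_pos hN', ENNReal.ofReal_natCast]
  simp

theorem isProbabilityMeasure_uniformMeasure {N : ℕ} (hN : 0 < N) :
    IsProbabilityMeasure (uniformMeasure N) := by
  rw [← (measurePreserving_cellIndex hN).map_eq]
  exact Measure.isProbabilityMeasure_map (measurePreserving_cellIndex hN).aemeasurable

theorem integral_uniformMeasure {N : ℕ} (g : Fin N → ℝ) :
    ∫ α, g α ∂uniformMeasure N = (N : ℝ)⁻¹ * ∑ α, g α := by
  rw [uniformMeasure, integral_smul_measure,
    integral_finsetSum_measure fun α _ => integrable_dirac (by simp)]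
  simp

theorem law_uniformMeasure {N : ℕ} (θ ν : Fin N → ℝ) :
    law (uniformMeasure N) θ ν = empirical θ ν := by
  have hm : Measurable fun α => toPhase (θ α, ν α) := measurable_of_finite _
  rw [law, uniformMeasure, Measure.map_smul, empirical, ← Measure.mapₗ_apply_of_measurable hm,
    map_sum]
  simp_rw [Measure.mapₗ_apply_of_measurable hm, Measure.map_dirac' hm]
  rfl

theorem IsBddMeas.intervalIntegrable (hf : IsBddMeas f) (x y : ℝ) :
    IntervalIntegrable f volume x y :=
  ⟨hf.integrable, hf.integrable⟩

/-- A function that is positive throughout a nondegenerate interval has positive integral there.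
Strictness matters, since the particles must start in the open strip. -/
theorem cellAvg_mem {N : ℕ} (hN : 0 < N) (hf : IsBddMeas f) (h : ∀ x, f x ∈ Ioo a b) (k : ℕ) :
    cellAvg N f k ∈ Ioo a b := by
  have hN' : (0 : ℝ) < N := by exact_mod_cast hN
  have hlt : (k : ℝ) / N < (k + 1) / N := by gcongr; linarith
  have hc : ∀ c : ℝ, ∫ _ in ((k : ℝ) / N)..((k + 1 : ℝ) / N), c = c / N := fun c => by
    rw [intervalIntegral.integral_const, smul_eq_mul]; field_simp; ring
  have h1 := intervalIntegral.intervalIntegral_pos_of_pos_on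
    ((hf.sub (.const a)).intervalIntegrable _ _) (fun x _ => sub_pos.2 (h x).1) hlt
  have h2 := intervalIntegral.intervalIntegral_pos_of_pos_on
    (((IsBddMeas.const b).sub hf).intervalIntegrable _ _) (fun x _ => sub_pos.2 (h x).2) hlt
  rw [intervalIntegral.integral_sub (hf.intervalIntegrable _ _)
    ((IsBddMeas.const a).intervalIntegrable _ _), hc, sub_pos, div_lt_iff₀' hN'] at h1
  rw [intervalIntegral.integral_sub ((IsBddMeas.const b).intervalIntegrable _ _)
    (hf.intervalIntegrable _ _), hc, sub_pos, lt_div_iff₀' hN'] at h2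
  exact ⟨h1, h2⟩

theorem abs_cellAvg_le (hR : ∀ x, |f x| ≤ R) (N k : ℕ) : |cellAvg N f k| ≤ R := by
  have hR0 : 0 ≤ R := (abs_nonneg _).trans (hR 0)
  rcases N.eq_zero_or_pos with rfl | hN
  · simpa [cellAvg] using hR0
  have hN' : (0 : ℝ) < N := by exact_mod_cast hN
  have h1 := intervalIntegral.norm_integral_le_of_norm_le_const (a := (k : ℝ) / N)
    (b := (k + 1 : ℝ) / N) (C := R) (f := f) fun x _ => hR x
  have h2 : |((k + 1 : ℝ) / N) - k / N| = (N : ℝ)⁻¹ := by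
    rw [show ((k + 1 : ℝ) / N) - k / N = (N : ℝ)⁻¹ by field_simp; ring, abs_of_pos (by positivity)]
  rw [h2, Real.norm_eq_abs] at h1
  rw [cellAvg, abs_mul, abs_of_pos hN']
  calc (N : ℝ) * _ ≤ N * (R * (N : ℝ)⁻¹) := by gcongr
    _ = R := by field_simp

/-- The particles thus have exactly the mean frequency of the limit, which the stability estimate
requires. -/
theorem integral_cellAvg {N : ℕ} (hN : 0 < N) (hf : IsBddMeas f) :
    ∫ α : Fin N, cellAvg N f α ∂uniformMeasure N = ∫ x, f x ∂unitMeasure := by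
  have hN' : (0 : ℝ) < N := by exact_mod_cast hN
  have h1 := intervalIntegral.sum_integral_adjacent_intervals (μ := volume) (f := f) (n := N)
    (a := fun k => (k : ℝ) / N) fun k _ => hf.intervalIntegrable _ _
  rw [integral_uniformMeasure, Fin.sum_univ_eq_sum_range (cellAvg N f)]
  simp only [cellAvg, ← Finset.mul_sum]
  push_cast at h1
  rw [inv_mul_cancel_left₀ hN'.ne', h1, zero_div, div_self hN'.ne',
    intervalIntegral.integral_of_le zero_le_one, unitMeasure, integral_Ico_eq_integral_Ioc]

/-- Cell averages converge almost everywhere. -/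
theorem ae_tendsto_cellAvg (hf : IsBddMeas f) :
    ∀ᵐ x ∂unitMeasure, Tendsto (fun N => cellAvg N f (cell N x)) atTop (𝓝 (f x)) := by
  have hloc : LocallyIntegrable f volume := fun x =>
    ⟨Icc (x - 1) (x + 1), Icc_mem_nhds (by linarith) (by linarith), hf.integrable⟩
  have h1 := IsUnifLocDoublingMeasure.ae_tendsto_average (μ := volume) hloc 1
  have h2 : ∀ᵐ x ∂unitMeasure, x ∈ Ico (0 : ℝ) 1 := ae_restrict_mem measurableSet_Ico
  filter_upwards [ae_restrict_of_ae h1, h2] with x hx hxm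
  have hδ : Tendsto (fun N : ℕ => (1 / 2 : ℝ) * (N : ℝ)⁻¹) atTop (𝓝[>] 0) := by
    refine tendsto_nhdsWithin_iff.2 ⟨?_, ?_⟩
    · simpa using tendsto_inv_atTop_nhds_zero_nat.const_mul (1 / 2 : ℝ)
    · filter_upwards [eventually_gt_atTop 0] with N hN
      have : (0 : ℝ) < N := by exact_mod_cast hN
      exact mem_Ioi.2 (by positivity)
  -- The closed cell is the ball of radius 1/(2N) about its midpoint. It contains x without being
  -- centred there, and the differentiation theorem allows such balls.
  have hball : ∀ N : ℕ, 0 < N → Metric.closedBall (((cell N x : ℝ) + 1 / 2) * (N : ℝ)⁻¹)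
      ((1 / 2 : ℝ) * (N : ℝ)⁻¹) = Icc ((cell N x : ℝ) / N) ((cell N x + 1 : ℝ) / N) := by
    intro N hN
    rw [Real.closedBall_eq_Icc]
    congr 1 <;> ring
  have h3 := hx (fun N : ℕ => ((cell N x : ℝ) + 1 / 2) * (N : ℝ)⁻¹) _ hδ ?_
  · refine h3.congr' ?_
    filter_upwards [eventually_gt_atTop 0] with N hN
    have hN' : (0 : ℝ) < N := by exact_mod_cast hN
    have hle : (cell N x : ℝ) / N ≤ (cell N x + 1) / N := by gcongr; linarith
    rw [hball N hN, setAverage_eq, integral_Icc_eq_integral_Ioc,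
      ← intervalIntegral.integral_of_le hle, Real.volume_real_Icc_of_le hle, cellAvg, smul_eq_mul]
    congr 1
    field_simp
    ring
  · filter_upwards [eventually_gt_atTop 0] with N hN
    have hN' : (0 : ℝ) < N := by exact_mod_cast hN
    rw [one_mul, hball N hN, cell_eq hN hxm, mem_Icc, div_le_iff₀ hN', le_div_iff₀ hN']
    have h4 := Nat.floor_le (mul_nonneg hN'.le hxm.1)
    have h5 := Nat.lt_floor_add_one (N * x)
    constructor <;> linarith

/-- Almost everywhere convergence and the uniform bound 2 R give convergence in L^q by domination.
-/
theorem tendsto_eLpNorm_sub_cellAvg (hf : IsBddMeas f) {q : ℝ} (hq : 1 ≤ q) :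
    Tendsto (fun N => eLpNorm (fun x => f x - cellAvg N f (cell N x)) (ENNReal.ofReal q)
      unitMeasure) atTop (𝓝 0) := by
  have h0 : 0 < q := by linarith
  obtain ⟨hm, R, hR⟩ := id hf
  have hg : ∀ N, Measurable fun x => f x - cellAvg N f (cell N x) := fun N =>
    hm.sub ((measurable_from_nat (f := cellAvg N f)).comp (measurable_cell N))
  have h1 : Tendsto (fun N => ∫⁻ x, ENNReal.ofReal (|f x - cellAvg N f (cell N x)| ^ q)
      ∂unitMeasure) atTop (𝓝 (∫⁻ _, 0 ∂unitMeasure)) := by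
    refine tendsto_lintegral_of_dominated_convergence (fun _ => ENNReal.ofReal ((R + R) ^ q))
      (fun N => ((hg N).abs.pow_const q).ennreal_ofReal) (fun N => .of_forall fun x => ?_)
      (by simp) ?_
    · refine ENNReal.ofReal_le_ofReal (Real.rpow_le_rpow (abs_nonneg _) ?_ h0.le)
      exact (abs_sub _ _).trans (add_le_add (hR x) (abs_cellAvg_le hR N _))
    · filter_upwards [ae_tendsto_cellAvg hf] with x hx
      have h2 : Tendsto (fun N => |f x - cellAvg N f (cell N x)| ^ q) atTop (𝓝 0) := by
        have := ((tendsto_const_nhds (x := f x)).sub hx).abs.rpow_const (p := q) (Or.inr h0.le)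
        simpa [Real.zero_rpow h0.ne'] using this
      simpa [Function.comp_def] using (ENNReal.continuous_ofReal.tendsto 0).comp h2
  rw [lintegral_zero] at h1
  have h2 := h1.ennrpow_const (1 / q)
  rw [ENNReal.zero_rpow_of_pos (by positivity)] at h2
  refine h2.congr fun N => ?_
  rw [lintegral_rpow_abs hq, one_div, ENNReal.rpow_rpow_inv h0.ne']

end Cells

end GKuramoto

namespace GKuramoto

/-! ### Stability in the Wasserstein distance -/

/-- From κ sin ϑ > νr - νl > 0 follows κ > 0, so [νl - κ, νr + κ] is a genuine interval. It contains
every drive, and G needs a regular replacement only there. -/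
theorem IsLargeCoupling.exists_isTrapping {L : EReal} {F : ℝ → ℝ} {κ ϑ νl νr : ℝ}
    (hF : IsResponse L F) (h : IsLargeCoupling L F κ ϑ νl νr) :
    ∃ Γ g m M K, IsTrapping Γ g m M K κ ϑ νl νr ∧
      ∀ y ∈ Icc (νl - κ) (νr + κ), Γ y = inverse L F y := by
  have hsin : 0 < Real.sin ϑ :=
    Real.sin_pos_of_pos_of_lt_pi h.theta_mem.1 (by linarith [h.theta_mem.2, Real.pi_pos])
  have hκ : 0 < κ := pos_of_mul_pos_left ((sub_pos.2 h.freq_lt).trans h.sin_gt) hsin.le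
  obtain ⟨Γ, g, m, M, K, hΓ, heq⟩ := hF.exists_isRegularResponse
    (y₀ := νl - κ) (y₁ := νr + κ) (by linarith [h.freq_lt])
  exact ⟨Γ, g, m, M, K, ⟨hΓ, h.theta_mem, h.freq_lt, h.sin_gt⟩, heq⟩

/-- The Lipschitz constant in the stability estimate for mean-field systems. -/
noncomputable def stabilityConst (m K κ ϑ νl νr : ℝ) : ℝ :=
  Real.exp (18 * κ * K * (max |νl| |νr| + κ) / (κ * Real.cos ϑ * m)) *
    (3 + 1 / (κ * Real.cos ϑ)) + 1

section Stability

variable {L : EReal} {F Γ g : ℝ → ℝ} {m M K κ ϑ νl νr q : ℝ}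

theorem stabilityConst_pos (hp : IsTrapping Γ g m M K κ ϑ νl νr) :
    0 < stabilityConst m K κ ϑ νl νr := by
  have := hp.cos_pos
  have := hp.coupling_pos
  unfold stabilityConst
  positivity

namespace IsMeanField

variable {Ω : Type*} [MeasurableSpace Ω] {P : Measure Ω} [IsProbabilityMeasure P]
  {ν ν' : Ω → ℝ} {θ θ' : ℝ → Ω → ℝ}

theorem wasserstein_law_le (hp : IsTrapping Γ g m M K κ ϑ νl νr)
    (hs : IsMeanField Γ κ ϑ νl νr P ν θ) (hs' : IsMeanField Γ κ ϑ νl νr P ν' θ')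
    (hmean : ∫ α, ν α ∂P = ∫ α, ν' α ∂P) (hq : 1 ≤ q) {t : ℝ} (ht : 0 ≤ t) :
    wasserstein q (law P (θ t) ν) (law P (θ' t) ν') ≤
      ENNReal.ofReal (stabilityConst m K κ ϑ νl νr) *
        (eLpNorm (fun α => θ 0 α - θ' 0 α) (ENNReal.ofReal q) P +
          eLpNorm (fun α => ν α - ν' α) (ENNReal.ofReal q) P) := by
  have hp1 : 1 ≤ ENNReal.ofReal q := ENNReal.one_le_ofReal.2 hq
  have hb : ∀ {t}, 0 ≤ t → IsBddMeas fun α => θ t α - θ' t α := fun ht =>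
    (hs.isBddMeas_phase hp ht).sub (hs'.isBddMeas_phase hp ht)
  have hbν := hs.isBddMeas_freq.sub hs'.isBddMeas_freq
  have hc := hp.cos_pos
  have hκ := hp.coupling_pos
  refine (GKuramoto.wasserstein_law_le hq (hs.measurable_phase t ht) hs.measurable_freq
    (hs'.measurable_phase t ht) hs'.measurable_freq).trans ?_
  have h1 := hs.lpNorm_phase_sub_le hp hs' hmean hp1 ENNReal.ofReal_ne_top ht
  rw [← ofReal_lpNorm (hb ht).memLp, ← ofReal_lpNorm (hb le_rfl).memLp, ← ofReal_lpNorm hbν.memLp,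
    ← ENNReal.ofReal_add lpNorm_nonneg lpNorm_nonneg,
    ← ENNReal.ofReal_add lpNorm_nonneg lpNorm_nonneg,
    ← ENNReal.ofReal_mul (stabilityConst_pos hp).le]
  refine ENNReal.ofReal_le_ofReal ?_
  have hA : 0 ≤ lpNorm (fun α => θ 0 α - θ' 0 α) (ENNReal.ofReal q) P := lpNorm_nonneg
  have hB : 0 ≤ lpNorm (fun α => ν α - ν' α) (ENNReal.ofReal q) P := lpNorm_nonneg
  -- The frequency part of the cost does not change in time; the summand 1 in the constant pays for
  -- it.
  refine (add_le_add_left h1 _).trans ?_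
  unfold stabilityConst
  set E := Real.exp (18 * κ * K * (max |νl| |νr| + κ) / (κ * Real.cos ϑ * m))
  set A := lpNorm (fun α => θ 0 α - θ' 0 α) (ENNReal.ofReal q) P
  set B := lpNorm (fun α => ν α - ν' α) (ENNReal.ofReal q) P
  have hE : 0 ≤ E := (Real.exp_pos _).le
  have h2 : 0 ≤ E * (1 / (κ * Real.cos ϑ)) * A := by positivity
  have h3 : 0 ≤ E * B := mul_nonneg hE hB
  have h4 : (E * (3 + 1 / (κ * Real.cos ϑ)) + 1) * (A + B) - (E * (3 * A + B / (κ * Real.cos ϑ)) +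
    B) = E * (1 / (κ * Real.cos ϑ)) * A + 3 * (E * B) + A := by ring
  linarith

/-- The phases and frequencies of a mean-field system stay in a strip. -/
theorem exists_support_subset (hp : IsTrapping Γ g m M K κ ϑ νl νr)
    (hs : IsMeanField Γ κ ϑ νl νr P ν θ) {t : ℝ} (ht : 0 ≤ t) :
    ∃ c : Torus, (law P (θ t) ν).support ⊆ closedStrip c ϑ νl νr := by
  have hne : Nonempty Ω := nonempty_of_isProbabilityMeasure P
  have hbdd : BddBelow (range (θ t)) :=
    ⟨θ t hne.some - ϑ, by rintro _ ⟨α, rfl⟩; linarith [hs.phase_sub_le hp ht hne.some α]⟩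
  have hcl : IsClosed (closedStrip ((⨅ β, θ t β : ℝ) : Torus) ϑ νl νr) := by
    refine IsClosed.prod ?_ isClosed_Icc
    exact (isCompact_Icc.image (continuous_const.add (AddCircle.continuous_mk' _))).isClosed
  -- The arc begins at the infimum of the lifted phases, all of which lie within ϑ above it.
  refine ⟨((⨅ β, θ t β : ℝ) : Torus), Measure.support_subset_of_isClosed hcl ?_⟩
  refine (ae_map_iff (p := (· ∈ closedStrip ((⨅ β, θ t β : ℝ) : Torus) ϑ νl νr))
    (measurable_toPhase_pair (hs.measurable_phase t ht) hs.measurable_freq).aemeasurable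
    hcl.measurableSet).2 ?_
  refine .of_forall fun α => ⟨⟨θ t α - ⨅ β, θ t β, ⟨?_, ?_⟩, ?_⟩, hs.freq_mem α⟩
  · exact sub_nonneg.2 (ciInf_le hbdd α)
  · have := le_ciInf fun β => (by linarith [hs.phase_sub_le hp ht α β] : θ t α - ϑ ≤ θ t β)
    linarith
  · change ((⨅ β, θ t β : ℝ) : Torus) + ((θ t α - ⨅ β, θ t β : ℝ) : Torus) = ((θ t α : ℝ) : Torus)
    rw [← AddCircle.coe_add, add_sub_cancel]

end IsMeanField

theorem IsTrapping.abs_sub_le_pi (hp : IsTrapping Γ g m M K κ ϑ νl νr) {x y : ℝ}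
    (hx : x ∈ Ioo 0 ϑ) (hy : y ∈ Ioo 0 ϑ) : |x - y| ≤ Real.pi := by
  have := hp.theta_mem.2
  rw [abs_le]
  constructor <;> linarith [hx.1, hx.2, hy.1, hy.2, Real.pi_pos]

/-- Two solutions with initial data in the strip are laws of mean-field systems over any space
of labels carrying a coupling of the initial data. -/
theorem IsMeasureSolution.wasserstein_le {ρ ρ' : ℝ → Measure Phase}
    (hρ : IsMeasureSolution L F κ ρ) (hρ' : IsMeasureSolution L F κ ρ')
    (hp : IsTrapping Γ g m M K κ ϑ νl νr)
    (hΓ : ∀ y ∈ Icc (νl - κ) (νr + κ), Γ y = inverse L F y)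
    (h0 : (ρ 0).support ⊆ initialStrip ϑ νl νr) (h0' : (ρ' 0).support ⊆ initialStrip ϑ νl νr)
    (hmean : ∫ z, z.2 ∂ρ 0 = ∫ z, z.2 ∂ρ' 0) (hq : 1 ≤ q) {t : ℝ} (ht : 0 ≤ t) :
    wasserstein q (ρ t) (ρ' t) ≤
      ENNReal.ofReal (2 * stabilityConst m K κ ϑ νl νr) * wasserstein q (ρ 0) (ρ' 0) := by
  have hΛ := stabilityConst_pos hp
  have hΛ0 : ENNReal.ofReal (2 * stabilityConst m K κ ϑ νl νr) ≠ 0 :=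
    (ENNReal.ofReal_pos.2 (by positivity)).ne'
  -- With the constant on the left, the right-hand side is a bare infimum, and each coupling can be
  -- treated separately as a label space.
  rw [← ENNReal.div_le_iff' hΛ0 ENNReal.ofReal_ne_top]
  refine le_iInf₂ fun γ hγ => ?_
  rw [ENNReal.div_le_iff' hΛ0 ENNReal.ofReal_ne_top]
  have := hρ.prob 0 le_rfl
  have hfst : MeasurePreserving Prod.fst γ (ρ 0) := ⟨measurable_fst, hγ.1⟩
  have hsnd : MeasurePreserving Prod.snd γ (ρ' 0) := ⟨measurable_snd, hγ.2⟩
  have hprob : IsProbabilityMeasure γ := by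
    refine ⟨?_⟩
    rw [← preimage_univ (f := Prod.fst), hfst.measure_preimage MeasurableSet.univ.nullMeasurableSet,
      measure_univ]
  have hσ := measurable_stripLift ϑ νl νr
  have hmem := stripLift_mem (νl := νl) (νr := νr) hp.theta_mem.1 hp.freq_lt
  obtain ⟨θ, hθ0, hs, hlaw⟩ := hρ.exists_isMeanField hp hΓ
    (hσ.comp measurable_fst).fst (hσ.comp measurable_fst).snd
    (fun α => Ioo_subset_Icc_self (hmem α.1).1) (fun α => Ioo_subset_Icc_self (hmem α.1).2)
    (law_stripLift hp.theta_mem.2 h0 hfst).symm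
  obtain ⟨θ', hθ0', hs', hlaw'⟩ := hρ'.exists_isMeanField hp hΓ
    (hσ.comp measurable_snd).fst (hσ.comp measurable_snd).snd
    (fun α => Ioo_subset_Icc_self (hmem α.2).1) (fun α => Ioo_subset_Icc_self (hmem α.2).2)
    (law_stripLift hp.theta_mem.2 h0' hsnd).symm
  have hfreq : ∀ μ : Measure Phase, μ.support ⊆ initialStrip ϑ νl νr →
      ∫ z, (stripLift ϑ νl νr z).2 ∂μ = ∫ z, z.2 ∂μ := fun μ hμ =>
    integral_congr_ae ((ae_toPhase_stripLift hp.theta_mem.2 hμ).mono fun z hz =>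
      congr_arg Prod.snd hz)
  have hm : ∫ α, (stripLift ϑ νl νr (Prod.fst α)).2 ∂γ =
      ∫ α, (stripLift ϑ νl νr (Prod.snd α)).2 ∂γ := by
    rw [← integral_map (φ := Prod.fst) (f := fun z => (stripLift ϑ νl νr z).2)
        measurable_fst.aemeasurable hσ.snd.aestronglyMeasurable,
      ← integral_map (φ := Prod.snd) (f := fun z => (stripLift ϑ νl νr z).2)
        measurable_snd.aemeasurable hσ.snd.aestronglyMeasurable, hγ.1, hγ.2, hfreq _ h0,
      hfreq _ h0', hmean]
  rw [hlaw t ht, hlaw' t ht]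
  refine (hs.wasserstein_law_le hp hs' hm hq ht).trans ?_
  rw [hθ0, hθ0']
  have hcost := eLpNorm_le_cost (P := γ) hq (f := Prod.fst) (f' := Prod.snd)
    (θ := fun α => (stripLift ϑ νl νr α.1).1) (ν := fun α => (stripLift ϑ νl νr α.1).2)
    (θ' := fun α => (stripLift ϑ νl νr α.2).1) (ν' := fun α => (stripLift ϑ νl νr α.2).2)
    (hfst.quasiMeasurePreserving.ae (ae_toPhase_stripLift hp.theta_mem.2 h0))
    (hsnd.quasiMeasurePreserving.ae (ae_toPhase_stripLift hp.theta_mem.2 h0'))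
    fun α => hp.abs_sub_le_pi (hmem α.1).1 (hmem α.2).1
  -- Phase and frequency norms are each bounded by the full cost, which accounts for the factor 2.
  refine (mul_le_mul_right (add_le_add hcost.1 hcost.2) _).trans (le_of_eq ?_)
  rw [mul_comm 2 (stabilityConst m K κ ϑ νl νr), ENNReal.ofReal_mul hΛ.le, ENNReal.ofReal_ofNat,
    mul_assoc]
  exact congr_arg _ (two_mul _).symm

end Stability

/-! ### Well-posedness and the mean-field limit -/

section WellPosed

variable {L : EReal} {F Γ g : ℝ → ℝ} {m M K κ ϑ νl νr q : ℝ}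

/-- Both solutions are laws of mean-field systems over the phase space with measure ρ 0 and
identical data. The L¹ stability estimate then makes their phases agree almost everywhere. -/
theorem IsMeasureSolution.eq_of_eq {ρ ρ' : ℝ → Measure Phase}
    (hρ : IsMeasureSolution L F κ ρ) (hρ' : IsMeasureSolution L F κ ρ')
    (hp : IsTrapping Γ g m M K κ ϑ νl νr)
    (hΓ : ∀ y ∈ Icc (νl - κ) (νr + κ), Γ y = inverse L F y)
    (h0 : (ρ 0).support ⊆ initialStrip ϑ νl νr) (heq : ρ' 0 = ρ 0) {t : ℝ} (ht : 0 ≤ t) :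
    ρ' t = ρ t := by
  have := hρ.prob 0 le_rfl
  have hσ := measurable_stripLift ϑ νl νr
  have hmem := stripLift_mem (νl := νl) (νr := νr) hp.theta_mem.1 hp.freq_lt
  have hl := law_stripLift hp.theta_mem.2 h0 (MeasurePreserving.id (ρ 0))
  obtain ⟨θ, hθ0, hs, hlaw⟩ := hρ.exists_isMeanField hp hΓ hσ.fst hσ.snd
    (fun α => Ioo_subset_Icc_self (hmem α).1) (fun α => Ioo_subset_Icc_self (hmem α).2) hl.symm
  obtain ⟨θ', hθ0', hs', hlaw'⟩ := hρ'.exists_isMeanField hp hΓ hσ.fst hσ.snd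
    (fun α => Ioo_subset_Icc_self (hmem α).1) (fun α => Ioo_subset_Icc_self (hmem α).2)
    (heq.trans hl.symm)
  have h1 := hs.lpNorm_phase_sub_le hp hs' rfl le_rfl ENNReal.one_ne_top ht
  have hb := (hs.isBddMeas_phase hp ht).sub (hs'.isBddMeas_phase hp ht)
  have hz : lpNorm (fun α => θ t α - θ' t α) 1 (ρ 0) = 0 := by
    refine le_antisymm ?_ lpNorm_nonneg
    refine h1.trans (le_of_eq ?_)
    have h3 : lpNorm (fun _ : Phase => (0 : ℝ)) 1 (ρ 0) = 0 := lpNorm_zero _ _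
    simp only [hθ0, hθ0', sub_self, h3]
    simp
  rw [lpNorm_eq_zero hb.memLp one_ne_zero] at hz
  rw [hlaw t ht, hlaw' t ht]
  refine Measure.map_congr ?_
  filter_upwards [hz] with α hα
  rw [sub_eq_zero.1 hα]

theorem IsMeanField.isParticleSolution (hF : IsResponse L F)
    (hp : IsTrapping Γ g m M K κ ϑ νl νr)
    (hΓ : ∀ y ∈ Icc (νl - κ) (νr + κ), Γ y = inverse L F y) {N : ℕ} (hN : 0 < N) {ν : Fin N → ℝ}
    {θ : ℝ → Fin N → ℝ} (hs : IsMeanField Γ κ ϑ νl νr (uniformMeasure N) ν θ) :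
    IsParticleSolution L F κ ν θ := by
  have := isProbabilityMeasure_uniformMeasure hN
  intro t ht α
  have h := hs.hasDerivAt t ht α
  rw [hΓ _ (drive_mem hp.coupling_pos.le hs.freq_mem _ _)] at h
  refine ⟨_, hF.inverse_mem _, h.hasDerivWithinAt, ?_⟩
  rw [hF.apply_inverse, drive, integral_uniformMeasure, div_eq_mul_inv, mul_assoc]

/-- Labelling by [0, 1) is what makes equal cells, and hence equally weighted particles, available.
-/
theorem exists_measurePreserving_unitMeasure (μ : Measure Phase) [IsProbabilityMeasure μ] :
    ∃ f : ℝ → Phase, MeasurePreserving f unitMeasure μ := by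
  obtain ⟨f, hf, hfμ⟩ := μ.exists_measurable_map_eq
  have hproj : Measurable (projIcc (0 : ℝ) 1 zero_le_one) := continuous_projIcc.measurable
  refine ⟨f ∘ projIcc 0 1 zero_le_one, hf.comp hproj, ?_⟩
  have h1 : unitMeasure = (volume : Measure unitInterval).map Subtype.val := by
    rw [unitMeasure, restrict_Ico_eq_restrict_Icc]
    exact (measurePreserving_subtype_coe measurableSet_Icc).map_eq.symm
  rw [h1, Measure.map_map (hf.comp hproj) measurable_subtype_coe, ← hfμ]
  congr 1
  funext x
  exact congr_arg f (projIcc_val _ x)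

/-- Every mean-field system over `[0, 1)` with data in the open rectangle is the limit of
particle systems. -/
theorem exists_particles (hF : IsResponse L F) (hp : IsTrapping Γ g m M K κ ϑ νl νr)
    (hΓ : ∀ y ∈ Icc (νl - κ) (νr + κ), Γ y = inverse L F y) (hq : 1 ≤ q) {ν : ℝ → ℝ}
    {θ : ℝ → ℝ → ℝ} (hs : IsMeanField Γ κ ϑ νl νr unitMeasure ν θ)
    (hθ : ∀ α, θ 0 α ∈ Ioo 0 ϑ) (hν : ∀ α, ν α ∈ Ioo νl νr) :
    ∃ (Θ : ∀ N : ℕ, ℝ → Fin N → ℝ) (V : ∀ N : ℕ, Fin N → ℝ),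
      (∀ N : ℕ, 1 ≤ N →
        (∀ α, Θ N 0 α ∈ Ioo 0 ϑ ∧ V N α ∈ Ioo νl νr) ∧
        IsParticleSolution L F κ (V N) (Θ N) ∧
        IsMeasureSolution L F κ (fun t => empirical (Θ N t) (V N))) ∧
      Tendsto (fun N : ℕ => ⨆ t ∈ Ici (0 : ℝ),
        wasserstein q (law unitMeasure (θ t) ν) (empirical (Θ N t) (V N))) atTop (𝓝 0) := by
  have hbθ := hs.isBddMeas_phase hp le_rfl
  have hbν := hs.isBddMeas_freq
  let δ : ℕ → ℝ≥0∞ := fun N =>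
    eLpNorm (fun x => θ 0 x - cellAvg N (θ 0) (cell N x)) (ENNReal.ofReal q) unitMeasure +
      eLpNorm (fun x => ν x - cellAvg N ν (cell N x)) (ENNReal.ofReal q) unitMeasure
  have hδ : Tendsto (fun N => ENNReal.ofReal (stabilityConst m K κ ϑ νl νr) * δ N) atTop
      (𝓝 0) := by
    have h1 := (tendsto_eLpNorm_sub_cellAvg hbθ hq).add (tendsto_eLpNorm_sub_cellAvg hbν hq)
    have h2 := ENNReal.Tendsto.const_mul (a := ENNReal.ofReal (stabilityConst m K κ ϑ νl νr)) h1
      (Or.inr ENNReal.ofReal_ne_top)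
    simpa using h2
  have key : ∀ N : ℕ, ∃ (Θ : ℝ → Fin N → ℝ) (V : Fin N → ℝ), 1 ≤ N →
      ((∀ α, Θ 0 α ∈ Ioo 0 ϑ ∧ V α ∈ Ioo νl νr) ∧ IsParticleSolution L F κ V Θ ∧
        IsMeasureSolution L F κ (fun t => empirical (Θ t) V)) ∧
      ∀ t, 0 ≤ t → wasserstein q (law unitMeasure (θ t) ν) (empirical (Θ t) V) ≤
        ENNReal.ofReal (stabilityConst m K κ ϑ νl νr) * δ N := by
    intro N
    rcases N.eq_zero_or_pos with rfl | hN
    · exact ⟨fun _ _ => 0, fun _ => 0, fun h => absurd h (by norm_num)⟩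
    have := isProbabilityMeasure_uniformMeasure hN
    have hmp := measurePreserving_cellIndex hN
    let V : Fin N → ℝ := fun α => cellAvg N ν α
    have hθN : ∀ α : Fin N, cellAvg N (θ 0) α ∈ Ioo 0 ϑ := fun α => cellAvg_mem hN hbθ hθ α
    have hνN : ∀ α, V α ∈ Ioo νl νr := fun α => cellAvg_mem hN hbν hν α
    obtain ⟨Θ, h0, hΘ⟩ := exists_isMeanField_of_measurable hp (uniformMeasure N)
      (θ₀ := fun α => cellAvg N (θ 0) α) (ν := V) (measurable_of_finite _)
      (measurable_of_finite _) (fun α => Ioo_subset_Icc_self (hθN α))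
      fun α => Ioo_subset_Icc_self (hνN α)
    have hms := hΘ.isMeasureSolution hF hp hΓ
    simp only [law_uniformMeasure] at hms
    refine ⟨Θ, V, fun _ => ⟨⟨fun α => ⟨by rw [h0]; exact hθN α, hνN α⟩,
      hΘ.isParticleSolution hF hp hΓ hN, hms⟩, fun t ht => ?_⟩⟩
    have hm : ∫ x, ν x ∂unitMeasure = ∫ x, (V ∘ cellIndex hN) x ∂unitMeasure := by
      rw [← integral_cellAvg hN hbν, ← hmp.map_eq,
        integral_map hmp.measurable.aemeasurable (measurable_of_finite _).aestronglyMeasurable]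
      rfl
    -- Pulled back along the cell index, the particle system lives over [0, 1) and can be compared
    -- with the limit label by label. The bound involves only the initial data, so the convergence
    -- is uniform in time.
    have hw := hs.wasserstein_law_le hp (hΘ.comp hmp) hm hq ht
    rw [law_comp hmp (hΘ.measurable_phase t ht) hΘ.measurable_freq, law_uniformMeasure] at hw
    refine hw.trans (le_of_eq ?_)
    simp only [h0]
    rfl
  choose Θ V hΘV using key
  refine ⟨Θ, V, fun N hN => (hΘV N hN).1, ?_⟩
  refine tendsto_of_tendsto_of_tendsto_of_le_of_le' tendsto_const_nhds hδ
    (.of_forall fun _ => zero_le) ?_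
  filter_upwards [eventually_ge_atTop 1] with N hN
  exact iSup₂_le fun t ht => (hΘV N hN).2 t ht

end WellPosed

end GKuramoto

/-! ### The theorem. -/

open GKuramoto in
theorem theorem5p1 (L : EReal) (F : ℝ → ℝ) (hF : IsResponse L F)
    (κ θs νl νr : ℝ) (hκ : IsLargeCoupling L F κ θs νl νr) (q : ℝ) (hq : 1 ≤ q) :
    (∀ ρ₀ : Measure Phase, IsProbabilityMeasure ρ₀ → ρ₀.support ⊆ initialStrip θs νl νr →
      ∃ ρ : ℝ → Measure Phase,
        (IsMeasureSolution L F κ ρ ∧ ρ 0 = ρ₀) ∧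
        (∀ ρ' : ℝ → Measure Phase, IsMeasureSolution L F κ ρ' → ρ' 0 = ρ₀ →
          ∀ t, 0 ≤ t → ρ' t = ρ t) ∧
        (∀ t, 0 ≤ t → ∃ c : Torus, (ρ t).support ⊆ closedStrip c θs νl νr) ∧
        ∃ (Θ : ∀ N : ℕ, ℝ → Fin N → ℝ) (V : ∀ N : ℕ, Fin N → ℝ),
          (∀ N : ℕ, 1 ≤ N →
            (∀ α, Θ N 0 α ∈ Ioo 0 θs ∧ V N α ∈ Ioo νl νr) ∧
            IsParticleSolution L F κ (V N) (Θ N) ∧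
            IsMeasureSolution L F κ (fun t => empirical (Θ N t) (V N))) ∧
          Tendsto (fun N : ℕ => ⨆ t ∈ Ici (0 : ℝ),
            wasserstein q (ρ t) (empirical (Θ N t) (V N))) atTop (𝓝 0)) ∧
    ∃ Λ : ℝ, 0 < Λ ∧ ∀ ρ ρ' : ℝ → Measure Phase,
      IsMeasureSolution L F κ ρ → IsMeasureSolution L F κ ρ' →
      (ρ 0).support ⊆ initialStrip θs νl νr → (ρ' 0).support ⊆ initialStrip θs νl νr →
      ∫ z, z.2 ∂ρ 0 = ∫ z, z.2 ∂ρ' 0 →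
      ∀ t, 0 ≤ t →
        wasserstein q (ρ t) (ρ' t) ≤ ENNReal.ofReal Λ * wasserstein q (ρ 0) (ρ' 0) := by
  obtain ⟨Γ, g, m, M, K, hp, hΓ⟩ := hκ.exists_isTrapping hF
  refine ⟨fun ρ₀ hρ₀ hsupp => ?_, 2 * stabilityConst m K κ θs νl νr,
    mul_pos two_pos (stabilityConst_pos hp), fun ρ ρ' hρ hρ' h0 h0' hmean t ht =>
      hρ.wasserstein_le hρ' hp hΓ h0 h0' hmean hq ht⟩
  obtain ⟨f, hf⟩ := exists_measurePreserving_unitMeasure ρ₀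
  have hσ := (measurable_stripLift θs νl νr).comp hf.measurable
  have hmem := stripLift_mem (νl := νl) (νr := νr) hp.theta_mem.1 hp.freq_lt
  obtain ⟨θ, h0, hs⟩ := exists_isMeanField_of_measurable hp unitMeasure hσ.fst hσ.snd
    (fun α => Ioo_subset_Icc_self (hmem (f α)).1) fun α => Ioo_subset_Icc_self (hmem (f α)).2
  have hlaw : law unitMeasure (θ 0) (fun α => (stripLift θs νl νr (f α)).2) = ρ₀ := by
    rw [h0]; exact law_stripLift hp.theta_mem.2 hsupp hf
  have hsol := hs.isMeasureSolution hF hp hΓ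
  refine ⟨_, ⟨hsol, hlaw⟩, fun ρ' hρ' h' t ht => hsol.eq_of_eq hρ' hp hΓ
    (hlaw.symm ▸ hsupp) (h'.trans hlaw.symm) ht, fun t ht => hs.exists_support_subset hp ht,
    exists_particles hF hp hΓ hq hs (fun α => ?_) fun α => (hmem (f α)).2⟩
  rw [h0]
  exact (hmem (f α)).1
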